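/- Let $d\in\{2,3\}$ and let $\Sigma\subset\mathbb R^d$ be a smooth, closed (compact, without boundary), connected embedded hypersurface with signed distance function $\rho$ (positive in the unbounded component of $\mathbb R^d\setminus\Sigma$), exterior unit normal $n=\nabla\rho$ and nearest point projection $p$. Let $\delta_0>0$ be such that every point of $U_{\delta_0}(\Sigma)=\{|\rho|<\delta_0\}$ has a unique nearest point on $\Sigma$, and let $n^e=n\circ p$. Let $\sigma,c_0$ be real constants and $\tau_0>0$. Then there are constants $C>0$ and $h_0>0$, depending only on $d,\Sigma,\delta_0,\sigma,c_0,\tau_0$, such that the following holds for all $0<h\le h_0$. Let $\mathcal K_{h,0}$ be a finite conforming mesh of closed $d$-simplices whose union $\Omega_0$ contains $U_{\delta_0}(\Sigma)$, shape regular and quasi-uniform with mesh parameter $h$ in the sense that each $K\in\mathcal K_{h,0}$ satisfies $\operatorname{diam}K\le h\le\sigma\operatorname{diam}K$ and contains a ball of radius $\sigma^{-1}\operatorname{diam}K$. Let $V_{h,0}$ be the continuous piecewise linear functions on $\mathcal K_{h,0}$. Let $\rho_h\in V_{h,0}$ and $\Sigma_h=\{x\in\Omega_0:\rho_h(x)=0\}$,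 with exterior unit normal $n_h$ (defined almost everywhere on $\Sigma_h$), be such that $\Sigma_h\subset U_{\delta_0}(\Sigma)$, $p:\Sigma_h\to\Sigma$ is a bijection, and $$\|\rho\|_{L^\infty(\Sigma_h)}\le c_0h^2,\qquad \|n^e-n_h\|_{L^\infty(\Sigma_h)}\le c_0h.$$ Let $\mathcal K_h=\{K\in\mathcal K_{h,0}:K\cap\Sigma_h\ne\emptyset\}$, $\Omega_h=\bigcup_{K\in\mathcal K_h}K$, let $\mathcal F_h$ be the set of common $(d-1)$-dimensional faces of two distinct elements of $\mathcal K_h$, let $n_F$ be a unit normal to $F\in\mathcal F_h$, let $[\,\cdot\,]$ denote the jump across $F$, and let $$V_h=\Big\{v\in V_{h,0}|_{\Omega_h}:\int_{\Sigma_h}v=0\Big\},\qquad |||v|||_h^2=\|(I-n_h\otimes n_h)\nabla v\|_{\Sigma_h}^2+\sum_{F\in\mathcal F_h}\tau_0\,\|[n_F\cdot\nabla v]\|_F^2 ,$$ where $\|\cdot\|_\omega$ is the $L^2(\omega)$ norm. Then $$\|v\|_{\Omega_h}\le C\,h^{1/2}\,|||v|||_h\qquad\text{for all }v\in V_h .$$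 -/

import Mathlib

open MeasureTheory Set Topology
open scoped ContDiff RealInnerProductSpace

noncomputable section

namespace CutFEM

/-- Euclidean space `ℝ^d`. -/
abbrev Pt (d : ℕ) := EuclideanSpace ℝ (Fin d)

/-- A smooth closed (compact, without boundary) connected hypersurface embedded in `ℝ^d`: locally it
is the zero set of a smooth function with nonvanishing differential. -/
structure IsClosedSurface {d : ℕ} (S : Set (Pt d)) : Prop where
  isCompact : IsCompact S
  isConnected : IsConnected S
  locally_level : ∀ x ∈ S, ∃ U : Set (Pt d), IsOpen U ∧ x ∈ U ∧ ∃ φ : Pt d → ℝ,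
    ContDiffOn ℝ ∞ φ U ∧ fderiv ℝ φ x ≠ 0 ∧ S ∩ U = {y ∈ U | φ y = 0}

/-- The exterior of a closed surface: the unbounded part of its complement. -/
def exterior {d : ℕ} (S : Set (Pt d)) : Set (Pt d) :=
  {x | x ∉ S ∧ ¬ Bornology.IsBounded (connectedComponentIn Sᶜ x)}

open scoped Classical in
/-- The signed distance function `ρ` of a closed surface, positive in the exterior. -/
def signedDist {d : ℕ} (S : Set (Pt d)) (x : Pt d) : ℝ :=
  if x ∈ exterior S then Metric.infDist x S else - Metric.infDist x S

/-- The exterior unit normal `n = ∇ρ`. -/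
def unitNormal {d : ℕ} (S : Set (Pt d)) (y : Pt d) : Pt d := gradient (signedDist S) y

/-- The tubular neighborhood `U_δ(S) = {|ρ| < δ}`. -/
def tube {d : ℕ} (S : Set (Pt d)) (δ : ℝ) : Set (Pt d) := {x | |signedDist S x| < δ}

/-- `y` minimizes the Euclidean distance to `x` among the points of `S`. -/
def IsNearestPoint {d : ℕ} (S : Set (Pt d)) (x y : Pt d) : Prop :=
  y ∈ S ∧ ∀ z ∈ S, dist x y ≤ dist x z

/-- The nearest point projection `p` onto `S`. -/
def nearestPoint {d : ℕ} (S : Set (Pt d)) (x : Pt d) : Pt d :=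
  Classical.epsilon (IsNearestPoint S x)

/-- `ν` is the exterior unit normal at `x` of the piecewise flat closed surface `S`: near `x` the set
`S` is the hyperplane through `x` orthogonal to `ν`, and `ν` points to the exterior of `S`. -/
def IsExteriorUnitNormal {d : ℕ} (S : Set (Pt d)) (x ν : Pt d) : Prop :=
  ‖ν‖ = 1 ∧ ∃ r > 0, ∀ y ∈ Metric.ball x r,
    (y ∈ S ↔ ⟪ν, y - x⟫ = 0) ∧ (y ∈ exterior S ↔ 0 < ⟪ν, y - x⟫)

/-- The closed simplex with the given vertices. -/
abbrev hull {d : ℕ} (s : Finset (Pt d)) : Set (Pt d) := convexHull ℝ (s : Set (Pt d))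

/-- A conforming mesh: a finite simplicial complex in `ℝ^d` all of whose faces belong to
`d`-dimensional simplices (triangles for `d = 2`, tetrahedra for `d = 3`). -/
structure Mesh (d : ℕ) extends Geometry.SimplicialComplex ℝ (Pt d) where
  finite_faces : faces.Finite
  pure : ∀ s ∈ faces, ∃ t ∈ faces, s ⊆ t ∧ t.card = d + 1

namespace Mesh

variable {d : ℕ}

/-- The elements of the mesh, each given by its set of vertices. -/
def cells (T : Mesh d) : Finset (Finset (Pt d)) :=
  T.finite_faces.toFinset.filter (fun s => s.card = d + 1)

/-- The (closed) meshed domain `Ω_0`. -/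
def domain (T : Mesh d) : Set (Pt d) := ⋃ s ∈ T.cells, hull s

/-- Shape regular and quasi-uniform with mesh parameter `h`; `σ` bounds the ratio of the diameter
to the radius of an inscribed ball, and the ratio of `h` to the diameters. -/
def IsQuasiUniform (T : Mesh d) (σ h : ℝ) : Prop :=
  ∀ s ∈ T.cells, Metric.diam (hull s) ≤ h ∧ h ≤ σ * Metric.diam (hull s) ∧
    ∃ c, Metric.closedBall c (Metric.diam (hull s) / σ) ⊆ hull s

/-- The space `V_{h,0}` of continuous piecewise linear functions. -/
def V₀ (T : Mesh d) : Set (Pt d → ℝ) :=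
  {v | ContinuousOn v T.domain ∧
    ∀ s ∈ T.cells, ∃ (a : Pt d) (b : ℝ), ∀ x ∈ hull s, v x = ⟪a, x⟫ + b}

/-- The discrete surface `Σ_h`, the zero level set of `ρ_h`. -/
def surface (T : Mesh d) (ρh : Pt d → ℝ) : Set (Pt d) := {x ∈ T.domain | ρh x = 0}

open scoped Classical in
/-- The set `K_h` of elements whose closure meets `Σ_h`. -/
def cutCells (T : Mesh d) (ρh : Pt d → ℝ) : Finset (Finset (Pt d)) :=
  T.cells.filter (fun s => (hull s ∩ T.surface ρh).Nonempty)

/-- The union `Ω_h` of the cut elements. -/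
def cutDomain (T : Mesh d) (ρh : Pt d → ℝ) : Set (Pt d) := ⋃ s ∈ T.cutCells ρh, hull s

/-- The space `V_h`: restrictions to `Ω_h` of functions in `V_{h,0}`, with zero mean on `Σ_h`.
(Values outside `Ω_h` are irrelevant.) -/
def V (T : Mesh d) (ρh : Pt d → ℝ) : Set (Pt d → ℝ) :=
  {v | (∃ w ∈ T.V₀, EqOn v w (T.cutDomain ρh)) ∧ ∫ x in T.surface ρh, v x ∂μHE[d - 1] = 0}

open scoped Classical in
/-- The set `F_h` of internal interfaces in `K_h`: the common `d`-vertex faces of two distinct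
elements of `K_h`. -/
def interfaces (T : Mesh d) (ρh : Pt d → ℝ) : Finset (Finset (Pt d)) :=
  (((T.cutCells ρh).offDiag.image (fun q => q.1 ∩ q.2)).filter (fun F => F.card = d))

open scoped Classical in
/-- The two elements of `K_h` on either side of an interface `F`, in a fixed order. -/
def neighbours (T : Mesh d) (ρh : Pt d → ℝ) (F : Finset (Pt d)) : Finset (Pt d) × Finset (Pt d) :=
  Classical.epsilon (fun q => q ∈ (T.cutCells ρh).offDiag ∧ q.1 ∩ q.2 = F)

/-- A fixed unit normal `n_F` to the face with vertex set `F`. -/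
def faceNormal (F : Finset (Pt d)) : Pt d :=
  Classical.epsilon (fun ν => ‖ν‖ = 1 ∧ ∀ x ∈ F, ∀ y ∈ F, ⟪ν, x - y⟫ = 0)

/-- The jump `[n_F · ∇v]` at a point of the interface `F`. (Only its square is used, so the order
of the two sides does not matter.) -/
def normalJump (T : Mesh d) (ρh v : Pt d → ℝ) (F : Finset (Pt d)) (x : Pt d) : ℝ :=
  ⟪faceNormal F, gradientWithin v (hull (T.neighbours ρh F).1) x⟫ -
    ⟪faceNormal F, gradientWithin v (hull (T.neighbours ρh F).2) x⟫

/-- The stabilization `j_h(v, v) = ∑_F τ₀ ‖[n_F · ∇v]‖²_F`. -/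
def stabilization (T : Mesh d) (τ₀ : ℝ) (ρh v : Pt d → ℝ) : ℝ :=
  ∑ F ∈ T.interfaces ρh, ∫ x in hull F, τ₀ * T.normalJump ρh v F x ^ 2 ∂μHE[d - 1]

/-- Some element containing `x`. -/
def cellAt (T : Mesh d) (x : Pt d) : Finset (Pt d) :=
  Classical.epsilon (fun s => s ∈ T.cells ∧ x ∈ hull s)

/-- The elementwise gradient `∇v`. -/
def grad (T : Mesh d) (v : Pt d → ℝ) (x : Pt d) : Pt d :=
  gradientWithin v (hull (T.cellAt x)) x

/-- The tangent gradient `(I - n_h ⊗ n_h) ∇v`. (Where `Σ_h` runs along a common face of two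
elements, both elements give the same value, since `v` is continuous.) -/
def tangentGrad (T : Mesh d) (nh : Pt d → Pt d) (v : Pt d → ℝ) (x : Pt d) : Pt d :=
  T.grad v x - ⟪nh x, T.grad v x⟫ • nh x

/-- The norm `|||v|||_h`. -/
def energyNorm (T : Mesh d) (τ₀ : ℝ) (ρh : Pt d → ℝ) (nh : Pt d → Pt d) (v : Pt d → ℝ) : ℝ :=
  √((∫ x in T.surface ρh, ‖T.tangentGrad nh v x‖ ^ 2 ∂μHE[d - 1]) + T.stabilization τ₀ ρh v)

/-- The `L²(Ω_h)` norm. -/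
def normCutDomain (T : Mesh d) (ρh v : Pt d → ℝ) : ℝ :=
  √(∫ x in T.cutDomain ρh, v x ^ 2)

/-- The discrete surface `Σ_h` given by `ρh ∈ V_{h,0}`, with exterior unit normal field `nh`,
approximates `S`: it lies in `U_{δ₀}(S)`, the closest point mapping is a bijection onto `S`, and
`|ρ| ≤ c₀ h²` and `|n^e - n_h| ≤ c₀ h` hold on `Σ_h`. -/
structure IsApproximation (T : Mesh d) (S : Set (Pt d)) (δ₀ c₀ h : ℝ) (ρh : Pt d → ℝ)
    (nh : Pt d → Pt d) : Prop where
  mem_V₀ : ρh ∈ T.V₀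
  normal : ∀ᵐ x ∂((μHE[d - 1] : Measure (Pt d)).restrict (T.surface ρh)),
    IsExteriorUnitNormal (T.surface ρh) x (nh x)
  subset_tube : T.surface ρh ⊆ tube S δ₀
  bijOn : BijOn (nearestPoint S) (T.surface ρh) S
  dist_le : ∀ x ∈ T.surface ρh, |signedDist S x| ≤ c₀ * h ^ 2
  normal_le : ∀ᵐ x ∂((μHE[d - 1] : Measure (Pt d)).restrict (T.surface ρh)),
    ‖unitNormal S (nearestPoint S x) - nh x‖ ≤ c₀ * h

end Mesh

end CutFEM

end

/-!
The Poincaré inequality has to hold with a constant that does not depend on the mesh, and the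
discrete surface comes with no bound on how its pieces are glued together. All integrals are
therefore moved to a fixed open neighborhood `U` of the smooth surface `S`, a finite union of balls:
a point `x` of `U` is sent to the point `lift x` of the discrete surface that has the same nearest
point on `S`, and the function `v` and its elementwise gradient `∇v` are pulled back along `lift`.
Measures compare well under `lift`, because the points of `U` that project into a set of diameter
`s` on `S` lie in a cylinder of volume of order `s ^ (d - 1)` (`Setup.lintegral_lift_le`).

On `U` a nonlocal Poincaré inequality holds (`exists_lintegral_le_nearEnergy`): the double integral
of `|f x - f y| ^ 2` over all pairs of points is bounded by `h ^ (- d - 2)` times the one over the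
pairs at distance less than `h`. On a ball this follows by doubling the range of interaction
repeatedly, and connectedness of `S` links the balls. So it suffices to compare values at points
whose lifts lie at distance of order `h`. The pulled back functions may jump, which is harmless here.

The elements at two such lifts are joined by a chain, bounded in length, of cut elements consecutive
ones of which share a facet (`Setup.reflTransGen_nearPairs`). Since `v` is continuous, its gradient
jumps across a facet in the normal direction only, so that the stabilization controls the full jumps
(`Mesh.sum_jump_le_stabilization`). With the Poincaré inequality this bounds the oscillation of
`h ∇v` over `U`.

The normals of the closed surface `S` take every direction; in particular there are two points of
`S` with orthogonal normals (`NormalField.exists_inner_eq_zero`). Near these two points the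
tangential gradients see all of `∇v`, and since the oscillation is under control, `h ∇v` is bounded
by the energy in all of `U` (`Setup.lintegral_grad_sq_le`).

The difference of `v` at two points of the discrete surface at distance of order `h` involves the
tangential gradient, the jumps, and a term of order `h ^ 2 |∇v|`, because both the discrete surface
and its normal are close to those of `S` (`Setup.value_sub_sq_le`). The Poincaré inequality now
shows that `v` is close to a constant `m` over `U` (`exists_lintegral_le_energySq`). A comparison of
each point of the cut domain with the points of `U` that project close to it, and Fubini, bring the
estimate back to the discrete surface, where `v` has mean zero, which bounds `m`, and to the cut
domain, where a ball of radius `h` has volume of order `h ^ d` instead of area of order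
`h ^ (d - 1)`, which yields the additional factor `h` (`Setup.lintegral_value_sub_sq_le_of_measure`).
-/

noncomputable section

namespace CutFEM

/-! ### Unit normals of a closed surface -/

variable {d : ℕ}

/-- `ν` is one of the two unit normals of `S` at `y`: near `y` the set `S` is the zero set of a
function whose differential at `y` is a nonzero multiple of `⟪ν, ·⟫`. -/
def IsUnitNormalAt (S : Set (Pt d)) (y ν : Pt d) : Prop :=
  ‖ν‖ = 1 ∧ ∃ (φ : Pt d → ℝ) (c : ℝ), c ≠ 0 ∧ HasStrictFDerivAt φ (c • innerSL ℝ ν) y ∧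
    ∀ᶠ z in 𝓝 y, (z ∈ S ↔ φ z = 0)

/-- Lagrange multipliers: at a local extremum on `S` the gradient is normal to `S`. -/
theorem IsUnitNormalAt.exists_eq_smul_of_isLocalExtrOn {S : Set (Pt d)} {y ν g : Pt d}
    (hν : IsUnitNormalAt S y ν) (hy : y ∈ S) {f : Pt d → ℝ}
    (hf : HasStrictFDerivAt f (innerSL ℝ g) y) (hext : IsLocalExtrOn f S y) :
    ∃ t : ℝ, g = t • ν := by
  obtain ⟨h1, φ, c, hc, hφ, hS⟩ := hν
  have hφy : φ y = 0 := (hS.self_of_nhds).1 hy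
  have hset : 𝓝[S] y = 𝓝[{x | φ x = φ y}] y := by
    refine nhdsWithin_eq_iff_eventuallyEq.2 (Filter.eventuallyEq_set.2 ?_)
    filter_upwards [hS] with z hz
    simp [hφy, hz]
  have hext' : IsLocalExtrOn f {x | φ x = φ y} y := by
    unfold IsLocalExtrOn at hext ⊢
    rwa [← hset]
  obtain ⟨a, b, hab, h⟩ := hext'.exists_multipliers_of_hasStrictFDerivAt_1d hφ hf
  have h' : (a * c) • ν + b • g = 0 := by
    refine ext_inner_right ℝ fun w => ?_
    have := congrArg (fun F : Pt d →L[ℝ] ℝ => F w) h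
    simp [inner_add_left, inner_smul_left, mul_assoc] at this ⊢
    linarith
  have hb : b ≠ 0 := by
    rintro rfl
    have hν0 : ν ≠ 0 := by rintro rfl; simp at h1
    simp [hν0, hc] at h'
    exact hab (by simp [h'])
  refine ⟨-(b⁻¹ * (a * c)), ?_⟩
  have : b • g = -((a * c) • ν) := by rw [eq_neg_iff_add_eq_zero, add_comm]; exact h'
  calc g = b⁻¹ • (b • g) := by rw [smul_smul, inv_mul_cancel₀ hb, one_smul]
    _ = _ := by rw [this]; simp [smul_smul]

theorem eq_or_eq_neg_of_smul {ν ν' : Pt d} (h : ‖ν‖ = 1) (h' : ‖ν'‖ = 1) {t : ℝ}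
    (ht : ν' = t • ν) : ν' = ν ∨ ν' = -ν := by
  rw [ht, norm_smul, h, mul_one, Real.norm_eq_abs] at h'
  rcases eq_or_eq_neg_of_abs_eq h' with rfl | rfl
  · left; simpa using ht
  · right; simpa using ht

theorem IsUnitNormalAt.eq_or_eq_neg {S : Set (Pt d)} {y ν ν' : Pt d}
    (hν : IsUnitNormalAt S y ν) (hν' : IsUnitNormalAt S y ν') (hy : y ∈ S) :
    ν' = ν ∨ ν' = -ν := by
  obtain ⟨h1, φ, c, hc, hφ, hS⟩ := hν'
  have hφy : φ y = 0 := (hS.self_of_nhds).1 hy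
  have hext : IsLocalExtrOn φ S y := by
    left
    filter_upwards [mem_nhdsWithin_of_mem_nhds hS, self_mem_nhdsWithin] with z hz hzS
    rw [hφy, hz.1 hzS]
  have hφ' : HasStrictFDerivAt φ (innerSL ℝ (c • ν')) y := by simpa using hφ
  obtain ⟨t, ht⟩ := hν.exists_eq_smul_of_isLocalExtrOn hy hφ' hext
  refine eq_or_eq_neg_of_smul hν.1 h1 (t := c⁻¹ * t) ?_
  rw [← smul_smul, ← ht, smul_smul, inv_mul_cancel₀ hc, one_smul]

/-- The vector from a nearest point of `S` to the given point is normal to `S`. -/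
theorem IsUnitNormalAt.exists_sub_eq_smul {S : Set (Pt d)} {x y ν : Pt d}
    (hν : IsUnitNormalAt S y ν) (hxy : IsNearestPoint S x y) : ∃ t : ℝ, x - y = t • ν := by
  have hf : HasStrictFDerivAt (fun z => ‖z - x‖ ^ 2) (innerSL ℝ ((2 : ℝ) • (y - x))) y := by
    have := (hasStrictFDerivAt_norm_sq (y - x)).comp y ((hasStrictFDerivAt_id y).sub_const x)
    convert! this using 1
    ext w
    simp
  have hext : IsLocalExtrOn (fun z => ‖z - x‖ ^ 2) S y := by
    left
    filter_upwards [self_mem_nhdsWithin] with z hz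
    have := hxy.2 z hz
    rw [dist_comm x y, dist_comm x z, dist_eq_norm, dist_eq_norm] at this
    gcongr
  obtain ⟨t, ht⟩ := hν.exists_eq_smul_of_isLocalExtrOn hxy.1 hf hext
  refine ⟨-(t / 2), ?_⟩
  have : y - x = (1 / 2 : ℝ) • (t • ν) := by rw [← ht, smul_smul]; norm_num
  rw [← neg_sub, this, smul_smul, ← neg_smul]; congr 1; ring

/-- Every direction is a normal direction of a compact surface. -/
theorem exists_unitNormal_eq {S : Set (Pt d)} (hS : IsCompact S) (hne : S.Nonempty) {ν : Pt d → Pt d}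
    (hν : ∀ y ∈ S, IsUnitNormalAt S y (ν y)) {e : Pt d} (he : ‖e‖ = 1) :
    ∃ y ∈ S, e = ν y ∨ e = -ν y := by
  obtain ⟨y, hy, hmax⟩ := hS.exists_isMaxOn hne
    (f := fun z => ⟪e, z⟫) (by fun_prop)
  have hf : HasStrictFDerivAt (fun z => ⟪e, z⟫) (innerSL ℝ e) y := (innerSL ℝ e).hasStrictFDerivAt
  obtain ⟨t, ht⟩ := (hν y hy).exists_eq_smul_of_isLocalExtrOn hy hf (Or.inr hmax.localize)
  exact ⟨y, hy, eq_or_eq_neg_of_smul (hν y hy).1 he ht⟩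

/-- To first order, points on a tangent line have distance zero from `S`. -/
theorem IsUnitNormalAt.eventually_infDist_le {S : Set (Pt d)} {y ν : Pt d}
    (hν : IsUnitNormalAt S y ν) (hy : y ∈ S) {w : Pt d} (hw : ⟪ν, w⟫ = 0) {η : ℝ} (hη : 0 < η) :
    ∀ᶠ t in 𝓝[>] (0 : ℝ), Metric.infDist (y + t • w) S ≤ η * t := by
  obtain ⟨h1, φ, c, hc, hφ, hS⟩ := hν
  have hφy : φ y = 0 := (hS.self_of_nhds).1 hy
  have hc2 : 0 < c ^ 2 := by positivity
  have key : ∀ s : ℝ, 0 < s * s → ∀ᶠ t in 𝓝[>] (0 : ℝ), 0 < s * (c * φ (y + t • (w + s • ν))) := by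
    intro s hs
    have hline : HasDerivAt (fun t : ℝ => y + t • (w + s • ν)) (w + s • ν) 0 := by
      simpa using ((hasDerivAt_id (0 : ℝ)).smul_const (w + s • ν)).const_add y
    have hd : HasDerivAt (fun t : ℝ => φ (y + t • (w + s • ν))) (c * s) 0 := by
      have hφ0 : HasFDerivAt φ (c • innerSL ℝ ν) (y + (0 : ℝ) • (w + s • ν)) := by
        simpa using hφ.hasFDerivAt
      have := hφ0.comp_hasDerivAt (0 : ℝ) hline
      convert! this using 1
      simp [inner_add_right, inner_smul_right, hw, h1]
    have := (hasDerivAt_iff_tendsto_slope_zero.1 hd).mono_left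
      (nhdsWithin_mono (0 : ℝ) (fun x (hx : x ∈ Ioi (0 : ℝ)) => (ne_of_gt hx : x ≠ 0)))
    have h2 := (this.const_mul (s * c)).eventually (lt_mem_nhds (a := 0) (by nlinarith))
    filter_upwards [h2, self_mem_nhdsWithin] with t ht ht0
    simp only [zero_add, zero_smul, add_zero, hφy, sub_zero, smul_eq_mul] at ht
    have ht0' : (0 : ℝ) < t := ht0
    have := mul_pos ht0' ht
    calc 0 < t * (s * c * (t⁻¹ * φ (y + t • (w + s • ν)))) := this
      _ = _ := by field_simp
  obtain ⟨K, s, hs, hK⟩ := hφ.exists_lipschitzOnWith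
  obtain ⟨r, hr, hball⟩ := Metric.mem_nhds_iff.1 (Filter.inter_mem hs hS)
  have hsmall : ∀ᶠ t in 𝓝[>] (0 : ℝ), t * (‖w‖ + η) < r := by
    have : Filter.Tendsto (fun t : ℝ => t * (‖w‖ + η)) (𝓝[>] 0) (𝓝 (0 * (‖w‖ + η))) :=
      ((continuous_id.mul continuous_const).tendsto 0).mono_left nhdsWithin_le_nhds
    rw [zero_mul] at this
    exact this.eventually (gt_mem_nhds hr)
  filter_upwards [key η (by positivity), key (-η) (by nlinarith), hsmall, self_mem_nhdsWithin]
    with t hp hm ht ht0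
  have ht0 : 0 < t := ht0
  have hmem : ∀ σ ∈ Icc (-(η * t)) (η * t), y + t • w + σ • ν ∈ Metric.ball y r := by
    intro σ hσ
    rw [mem_ball_iff_norm]
    calc ‖y + t • w + σ • ν - y‖ = ‖t • w + σ • ν‖ := by congr 1; abel
      _ ≤ ‖t • w‖ + ‖σ • ν‖ := norm_add_le _ _
      _ ≤ t * ‖w‖ + η * t := by
        rw [norm_smul, norm_smul, h1, mul_one, Real.norm_of_nonneg ht0.le]
        gcongr
        exact abs_le.2 hσ
      _ < r := by linarith
  have hcont : ContinuousOn (fun σ : ℝ => c * φ (y + t • w + σ • ν)) (Icc (-(η * t)) (η * t)) := by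
    refine continuousOn_const.mul (ContinuousOn.comp (t := s) hK.continuousOn ?_ ?_)
    · fun_prop
    · exact fun σ hσ => (hball (hmem σ hσ)).1
  have hle : -(η * t) ≤ η * t := by nlinarith
  have e1 : y + t • (w + η • ν) = y + t • w + (η * t) • ν := by
    rw [smul_add, smul_smul, mul_comm t, add_assoc]
  have e2 : y + t • (w + (-η) • ν) = y + t • w + (-(η * t)) • ν := by
    rw [smul_add, smul_smul, mul_comm t, add_assoc, neg_mul]
  rw [e1] at hp
  rw [e2] at hm
  have hz := intermediate_value_Icc hle hcont
  obtain ⟨σ, hσ, h0⟩ := hz (show (0 : ℝ) ∈ _ from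
    ⟨by nlinarith, by nlinarith⟩)
  have hzS : y + t • w + σ • ν ∈ S := by
    refine (hball (hmem σ hσ)).2.2 ?_
    simpa [hc] using h0
  calc Metric.infDist (y + t • w) S ≤ dist (y + t • w) (y + t • w + σ • ν) :=
        Metric.infDist_le_dist_of_mem hzS
    _ = |σ| := by rw [dist_eq_norm]; simp [norm_smul, h1]
    _ ≤ η * t := abs_le.2 hσ

theorem abs_signedDist (S : Set (Pt d)) (x : Pt d) : |signedDist S x| = Metric.infDist x S := by
  unfold signedDist
  split_ifs <;> simp [abs_of_nonneg Metric.infDist_nonneg]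

/-- The gradient of the signed distance is normal to `S`, be it a unit normal or, as the junk value
at a point of nondifferentiability, zero. -/
theorem IsUnitNormalAt.exists_unitNormal_eq_smul {S : Set (Pt d)} {y ν : Pt d}
    (hν : IsUnitNormalAt S y ν) (hy : y ∈ S) : ∃ t : ℝ, unitNormal S y = t • ν := by
  by_cases hdiff : DifferentiableAt ℝ (signedDist S) y
  swap
  · exact ⟨0, by simp [unitNormal, gradient_eq_zero_of_not_differentiableAt hdiff]⟩
  have hνν : ⟪ν, ν⟫ = 1 := by rw [real_inner_self_eq_norm_sq, hν.1]; norm_num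
  have h0 : signedDist S y = 0 := by
    rw [← abs_eq_zero, abs_signedDist, Metric.infDist_zero_of_mem hy]
  have hg := hdiff.hasGradientAt.hasFDerivAt
  have hperp : ∀ w : Pt d, ⟪ν, w⟫ = 0 → ⟪unitNormal S y, w⟫ = 0 := by
    intro w hw
    have hline : HasDerivAt (fun t : ℝ => y + t • w) w 0 := by
      simpa using ((hasDerivAt_id (0 : ℝ)).smul_const w).const_add y
    have hd : HasDerivAt (fun t : ℝ => signedDist S (y + t • w)) ⟪unitNormal S y, w⟫ 0 := by
      have hφ0 : HasFDerivAt (signedDist S) ((InnerProductSpace.toDual ℝ _) (unitNormal S y))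
          (y + (0 : ℝ) • w) := by simpa [unitNormal] using hg
      have := hφ0.comp_hasDerivAt (0 : ℝ) hline
      convert! this using 1
    have hs := (hasDerivAt_iff_tendsto_slope_zero.1 hd).mono_left
      (nhdsWithin_mono (0 : ℝ) (fun x (hx : x ∈ Ioi (0 : ℝ)) => (ne_of_gt hx : x ≠ 0)))
    by_contra hne
    have := le_of_tendsto hs.abs (b := |⟪unitNormal S y, w⟫| / 2) (by
      filter_upwards [hν.eventually_infDist_le hy hw (half_pos (abs_pos.2 hne)),
        self_mem_nhdsWithin] with t ht ht0
      have ht0 : 0 < t := ht0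
      simp only [zero_add, zero_smul, add_zero, h0, sub_zero, smul_eq_mul, abs_mul, abs_inv,
        abs_signedDist, abs_of_pos ht0]
      rw [inv_mul_le_iff₀ ht0]
      linarith)
    linarith [abs_pos.2 hne]
  refine ⟨⟪ν, unitNormal S y⟫, ?_⟩
  set g := unitNormal S y
  have h1 : ⟪ν, g - ⟪ν, g⟫ • ν⟫ = 0 := by rw [inner_sub_right, inner_smul_right, hνν]; ring
  have h2 := hperp _ h1
  rw [← sub_eq_zero, ← inner_self_eq_zero (𝕜 := ℝ), inner_sub_left, inner_smul_left, h1, h2]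
  simp

/-- A choice `ν` of unit normals along `S`, without any consistency of signs. The constant `L`
bounds the quadratic deviation of `S` from its tangent planes and, up to sign, the variation of
the normal. -/
structure NormalField (S : Set (Pt d)) (ν : Pt d → Pt d) (L : ℝ) : Prop where
  pos : 0 < L
  normal : ∀ y ∈ S, IsUnitNormalAt S y (ν y)
  taylor : ∀ y ∈ S, ∀ z ∈ S, |⟪ν y, z - y⟫| ≤ L * ‖z - y‖ ^ 2
  lip : ∀ y ∈ S, ∀ z ∈ S, ‖ν z - ν y‖ ≤ L * ‖z - y‖ ∨ ‖ν z + ν y‖ ≤ L * ‖z - y‖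

/-- Near a point of `S`, the normalized gradient of a level function is a Lipschitz field of unit
normals, and the mean value inequality for the level function bounds the deviation of `S` from its
tangent planes. -/
theorem IsClosedSurface.exists_local_normal {S : Set (Pt d)} (hS : IsClosedSurface S) {x : Pt d}
    (hx : x ∈ S) : ∃ ε > 0, ∃ L > 0, ∃ N : Pt d → Pt d, ∀ y ∈ S ∩ Metric.ball x ε,
      IsUnitNormalAt S y (N y) ∧ ∀ z ∈ S ∩ Metric.ball x ε,
        |⟪N y, z - y⟫| ≤ L * ‖z - y‖ ^ 2 ∧ ‖N z - N y‖ ≤ L * ‖z - y‖ := by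
  obtain ⟨U, hU, hxU, φ, hφ, hφx, hSU⟩ := hS.locally_level x hx
  have hφc : ∀ z ∈ U, ContDiffAt ℝ ∞ φ z := fun z hz => hφ.contDiffAt (hU.mem_nhds hz)
  set G : Pt d → Pt d := gradient φ with hG
  have hGc : ContDiffAt ℝ 1 G x := by
    have h1 : ContDiffAt ℝ 1 (fderiv ℝ φ) x := (hφc x hxU).fderiv_right (by norm_cast)
    exact (InnerProductSpace.toDual ℝ (Pt d)).symm.contDiff.contDiffAt.comp x h1
  have hGx : G x ≠ 0 := by
    simpa [hG, gradient] using hφx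
  have hstrict : ∀ z ∈ U, HasStrictFDerivAt φ (innerSL ℝ (G z)) z := by
    intro z hz
    have := (hφc z hz).hasStrictFDerivAt (by simp)
    convert! this using 1
    exact toDual_gradient ..
  have hNc : ContDiffAt ℝ 1 (fun z => ‖G z‖⁻¹ • G z) x :=
    ((hGc.norm ℝ hGx).inv (norm_ne_zero_iff.2 hGx)).smul hGc
  obtain ⟨K, t, ht, hK⟩ := hGc.exists_lipschitzOnWith
  obtain ⟨K', t', ht', hK'⟩ := hNc.exists_lipschitzOnWith
  have hm : ∀ᶠ z in 𝓝 x, ‖G x‖ / 2 < ‖G z‖ :=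
    hGc.continuousAt.norm.eventually (lt_mem_nhds (by simpa using hGx))
  obtain ⟨ε, hε, hball⟩ := Metric.mem_nhds_iff.1
    (Filter.inter_mem (Filter.inter_mem ht ht') (Filter.inter_mem hm (hU.mem_nhds hxU)))
  have hGpos : 0 < ‖G x‖ / 2 := by simpa using hGx
  refine ⟨ε, hε, K / (‖G x‖ / 2) + K' + 1, by positivity, fun z => ‖G z‖⁻¹ • G z, ?_⟩
  rintro y ⟨hyS, hy⟩
  have hyU := (hball hy).2.2
  have hym : ‖G x‖ / 2 < ‖G y‖ := (hball hy).2.1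
  have hy0 : 0 < ‖G y‖ := hGpos.trans hym
  have hzero : ∀ z ∈ U, (z ∈ S ↔ φ z = 0) := by
    intro z hz
    have : z ∈ S ∩ U ↔ z ∈ {y ∈ U | φ y = 0} := by rw [hSU]
    simpa [hz] using this
  refine ⟨⟨by rw [norm_smul, norm_inv, norm_norm, inv_mul_cancel₀ hy0.ne'], φ, ‖G y‖, hy0.ne', ?_, ?_⟩, ?_⟩
  · convert! hstrict y hyU using 1
    ext w
    simp [hy0.ne']
  · filter_upwards [hU.mem_nhds hyU] with z hz using hzero z hz
  · rintro z ⟨hzS, hz⟩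
    constructor
    · have hseg : segment ℝ y z ⊆ Metric.ball x ε := (convex_ball x ε).segment_subset hy hz
      have := Convex.norm_image_sub_le_of_norm_hasFDerivWithin_le' (f := φ) (C := K * ‖z - y‖)
        (f' := fun z => innerSL ℝ (G z)) (φ := innerSL ℝ (G y)) (s := segment ℝ y z) (x := y) (y := z)
        (fun p hp => (hstrict p (hball (hseg hp)).2.2).hasFDerivAt.hasFDerivWithinAt)
        (fun p hp => by
          have h1 := hK.dist_le_mul p (hball (hseg hp)).1.1 y (hball hy).1.1
          rw [dist_eq_norm, dist_eq_norm] at h1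
          rw [← map_sub, innerSL_apply_norm]
          refine h1.trans ?_
          gcongr
          obtain ⟨a, b, ha, hb, hab, rfl⟩ := hp
          have : a • y + b • z - y = b • (z - y) := by
            rw [← eq_sub_iff_add_eq'] at hab
            rw [show a = 1 - b by linarith]; module
          rw [this, norm_smul, Real.norm_of_nonneg hb]
          have : b ≤ 1 := by linarith
          exact mul_le_of_le_one_left (norm_nonneg _) this)
        (convex_segment y z) (left_mem_segment ℝ y z) (right_mem_segment ℝ y z)
      rw [(hzero z (hball hz).2.2).1 hzS, (hzero y hyU).1 hyS, sub_zero, zero_sub, norm_neg] at this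
      simp only [innerSL_apply_apply, Real.norm_eq_abs] at this
      rw [inner_smul_left, abs_mul]
      simp only [conj_trivial, abs_inv, abs_norm]
      rw [inv_mul_le_iff₀ hy0]
      calc _ ≤ K * ‖z - y‖ * ‖z - y‖ := this
        _ = (‖G x‖ / 2) * (K / (‖G x‖ / 2) * ‖z - y‖ ^ 2) := by field_simp
        _ ≤ ‖G y‖ * ((K / (‖G x‖ / 2) + K' + 1) * ‖z - y‖ ^ 2) := by
          gcongr
          have := K'.coe_nonneg
          linarith
    · have := hK'.dist_le_mul z (hball hz).1.2 y (hball hy).1.2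
      rw [dist_eq_norm, dist_eq_norm] at this
      refine this.trans ?_
      gcongr
      have : 0 ≤ K / (‖G x‖ / 2) := by positivity
      linarith

theorem IsClosedSurface.exists_normalField {S : Set (Pt d)} (hS : IsClosedSurface S) :
    ∃ ν L, NormalField S ν L := by
  choose! ε hε L hL N hN using fun x (hx : x ∈ S) => hS.exists_local_normal hx
  obtain ⟨t, hcov⟩ := hS.isCompact.elim_nhds_subcover' (fun x _ => Metric.ball x (ε x / 2))
    (fun x hx => Metric.ball_mem_nhds x (half_pos (hε x hx)))
  have hcov' : ∀ z ∈ S, ∃ x ∈ t, dist z x < ε x / 2 := by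
    intro z hz
    obtain ⟨x, hx, hzx⟩ := mem_iUnion₂.1 (hcov hz)
    exact ⟨x, hx, hzx⟩
  have htne : t.Nonempty := by
    obtain ⟨z, hz⟩ := hS.isConnected.nonempty
    obtain ⟨x, hx, _⟩ := hcov' z hz
    exact ⟨x, hx⟩
  obtain ⟨e, he, hemin⟩ : ∃ e > 0, ∀ x ∈ t, e ≤ ε x / 2 := by
    refine ⟨t.inf' htne fun x => ε x / 2, ?_, fun x hx => Finset.inf'_le _ hx⟩
    simpa using fun x hx _ => half_pos (hε x hx)
  obtain ⟨M, hMmax⟩ : ∃ M, ∀ x ∈ t, L x ≤ M :=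
    ⟨t.sup' htne fun x => L x, fun x hx => Finset.le_sup' (fun x : S => L x) hx⟩
  have hn : ∀ y ∈ S, ∃ ν, IsUnitNormalAt S y ν := by
    intro y hy
    exact ⟨_, (hN y hy y ⟨hy, Metric.mem_ball_self (hε y hy)⟩).1⟩
  choose! ν hν using hn
  have hM : 0 < M := by
    obtain ⟨x, hx⟩ := htne
    exact (hL x x.2).trans_le (hMmax x hx)
  -- The bounds hold locally with `M`; for distant points they follow from `‖ν‖ = 1`.
  refine ⟨ν, M + 2 / e, by positivity, hν, fun y hy z hz => ?_, fun y hy z hz => ?_⟩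
  all_goals
    by_cases hyz : ‖z - y‖ < e
  · obtain ⟨x, hx, hyx⟩ := hcov' y hy
    have hzx : dist z x < ε x := by
      have := dist_triangle z y x
      rw [dist_eq_norm z y] at this
      linarith [hemin x hx]
    have hyx' : dist y x < ε x := by linarith [hε x x.2]
    obtain ⟨h1, h2⟩ := hN x x.2 y ⟨hy, hyx'⟩
    have h3 := (h2 z ⟨hz, hzx⟩).1
    have h4 : |⟪ν y, z - y⟫| = |⟪N x y, z - y⟫| := by
      rcases h1.eq_or_eq_neg (hν y hy) hy with h | h <;> simp [h, inner_neg_left]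
    rw [h4]
    refine h3.trans ?_
    gcongr
    have : 0 < 2 / e := by positivity
    linarith [hMmax x hx]
  · have h1 := abs_real_inner_le_norm (ν y) (z - y)
    rw [(hν y hy).1, one_mul] at h1
    have h2 : 1 ≤ (M + 2 / e) * ‖z - y‖ := by
      calc (1 : ℝ) ≤ 2 / e * e := by field_simp; norm_num
        _ ≤ _ := by gcongr; linarith; linarith
    nlinarith [norm_nonneg (z - y)]
  · obtain ⟨x, hx, hyx⟩ := hcov' y hy
    have hzx : dist z x < ε x := by
      have := dist_triangle z y x
      rw [dist_eq_norm z y] at this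
      linarith [hemin x hx]
    have hyx' : dist y x < ε x := by linarith [hε x x.2]
    obtain ⟨h1, h2⟩ := hN x x.2 y ⟨hy, hyx'⟩
    have h3 := (h2 z ⟨hz, hzx⟩).2
    have h5 : L x * ‖z - y‖ ≤ (M + 2 / e) * ‖z - y‖ := by
      gcongr
      have : 0 < 2 / e := by positivity
      linarith [hMmax x hx]
    have h4 := (hN x x.2 z ⟨hz, hzx⟩).1
    have h6 : ‖-N x z + N x y‖ = ‖N x z - N x y‖ := by rw [← norm_neg]; congr 1; abel
    have h7 : ‖-N x z - -N x y‖ = ‖N x z - N x y‖ := by rw [← norm_neg]; congr 1; abel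
    rcases h1.eq_or_eq_neg (hν y hy) hy with h | h <;>
      rcases h4.eq_or_eq_neg (hν z hz) hz with h' | h' <;> rw [h, h']
    · left; linarith
    · right; linarith
    · right; rw [← sub_eq_add_neg]; linarith
    · left; linarith
  · left
    calc ‖ν z - ν y‖ ≤ ‖ν z‖ + ‖ν y‖ := norm_sub_le _ _
      _ = 2 / e * e := by rw [(hν y hy).1, (hν z hz).1]; field_simp; norm_num
      _ ≤ _ := by gcongr; linarith; linarith

/-! ### The nearest point projection -/

section nearest
variable {S : Set (Pt d)} {ν : Pt d → Pt d} {L : ℝ}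

theorem isNearestPoint_nearestPoint (hS : IsCompact S) (hne : S.Nonempty) (x : Pt d) :
    IsNearestPoint S x (nearestPoint S x) := by
  obtain ⟨y, hy, hmin⟩ := hS.exists_isMinOn hne (f := fun z => dist x z) (by fun_prop)
  exact Classical.epsilon_spec (p := IsNearestPoint S x) ⟨y, hy, fun z hz => hmin hz⟩

theorem IsNearestPoint.dist_eq_infDist {x y : Pt d} (h : IsNearestPoint S x y) :
    dist x y = Metric.infDist x S :=
  le_antisymm ((Metric.le_infDist ⟨y, h.1⟩).2 fun _ hz => h.2 _ hz)
    (Metric.infDist_le_dist_of_mem h.1)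

/-- Within a quarter of the radius of curvature, nearest points depend Lipschitz continuously on
the given points; in particular they are unique. -/
theorem NormalField.norm_sub_le_of_isNearestPoint (hν : NormalField S ν L) {x x' y y' : Pt d} {ε : ℝ}
    (hxy : IsNearestPoint S x y) (hxy' : IsNearestPoint S x' y') (hx : Metric.infDist x S ≤ ε)
    (hx' : Metric.infDist x' S ≤ ε) (hε : 4 * L * ε ≤ 1) : ‖y - y'‖ ≤ 2 * ‖x - x'‖ := by
  have key : ∀ {x y z : Pt d}, IsNearestPoint S x y → Metric.infDist x S ≤ ε → z ∈ S →
      ⟪x - y, z - y⟫ ≤ 1 / 4 * ‖z - y‖ ^ 2 := by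
    intro x y z hxy hx hz
    obtain ⟨t, ht⟩ := (hν.normal y hxy.1).exists_sub_eq_smul hxy
    have ht' : |t| ≤ ε := by
      rw [← hxy.dist_eq_infDist, dist_eq_norm, ht, norm_smul, (hν.normal y hxy.1).1, mul_one] at hx
      exact hx
    rw [ht, inner_smul_left]
    calc t * ⟪ν y, z - y⟫ ≤ |t| * |⟪ν y, z - y⟫| := by rw [← abs_mul]; exact le_abs_self _
      _ ≤ ε * (L * ‖z - y‖ ^ 2) := by
        gcongr
        · exact (abs_nonneg t).trans ht'
        · exact hν.taylor y hxy.1 z hz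
      _ ≤ 1 / 4 * ‖z - y‖ ^ 2 := by nlinarith [sq_nonneg ‖z - y‖]
  have h1 := key hxy hx hxy'.1
  have h2 := key hxy' hx' hxy.1
  have h3 : ⟪x - y, y' - y⟫ + ⟪x' - y', y - y'⟫ = ⟪x - x', y' - y⟫ + ‖y' - y‖ ^ 2 := by
    rw [← real_inner_self_eq_norm_sq]
    simp only [inner_sub_left, inner_sub_right]
    ring
  have h4 := neg_le_of_abs_le (abs_real_inner_le_norm (x - x') (y' - y))
  rw [norm_sub_rev y y'] at *
  by_contra! hcon
  have h5 : 0 < ‖y' - y‖ := (by positivity : (0 : ℝ) ≤ 2 * ‖x - x'‖).trans_lt hcon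
  nlinarith

theorem NormalField.nearestPoint_eq (hν : NormalField S ν L) (hS : IsCompact S) {x y : Pt d} {ε : ℝ}
    (hxy : IsNearestPoint S x y) (hx : Metric.infDist x S ≤ ε) (hε : 4 * L * ε ≤ 1) :
    nearestPoint S x = y := by
  have := hν.norm_sub_le_of_isNearestPoint (isNearestPoint_nearestPoint hS ⟨y, hxy.1⟩ x) hxy hx hx hε
  rw [sub_self, norm_zero, mul_zero] at this
  exact sub_eq_zero.1 (norm_le_zero_iff.1 this)

theorem nearestPoint_mem (hS : IsCompact S) (hne : S.Nonempty) (x : Pt d) : nearestPoint S x ∈ S :=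
  (isNearestPoint_nearestPoint hS hne x).1

theorem nearestPoint_of_mem {x : Pt d} (hS : IsCompact S) (hx : x ∈ S) : nearestPoint S x = x := by
  have h := isNearestPoint_nearestPoint hS ⟨x, hx⟩ x
  have := h.2 x hx
  rw [dist_self] at this
  exact (dist_le_zero.1 this).symm

theorem NormalField.norm_nearestPoint_sub_le (hν : NormalField S ν L) (hS : IsCompact S)
    (hne : S.Nonempty) {x x' : Pt d} {ε : ℝ} (hx : Metric.infDist x S ≤ ε)
    (hx' : Metric.infDist x' S ≤ ε) (hε : 4 * L * ε ≤ 1) :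
    ‖nearestPoint S x - nearestPoint S x'‖ ≤ 2 * ‖x - x'‖ :=
  hν.norm_sub_le_of_isNearestPoint (isNearestPoint_nearestPoint hS hne x)
    (isNearestPoint_nearestPoint hS hne x') hx hx' hε

theorem NormalField.continuousOn_nearestPoint (hν : NormalField S ν L) (hS : IsCompact S)
    (hne : S.Nonempty) {ε : ℝ} (hε : 4 * L * ε ≤ 1) :
    ContinuousOn (nearestPoint S) {x | Metric.infDist x S ≤ ε} := by
  refine (LipschitzOnWith.of_dist_le_mul (K := 2) fun x hx y hy => ?_).continuousOn
  simpa [dist_eq_norm] using hν.norm_nearestPoint_sub_le hS hne hx hy hε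

theorem norm_sub_nearestPoint (hS : IsCompact S) (hne : S.Nonempty) (x : Pt d) :
    ‖x - nearestPoint S x‖ = Metric.infDist x S := by
  rw [← dist_eq_norm, (isNearestPoint_nearestPoint hS hne x).dist_eq_infDist]

/-- Walking along the normal does not change the nearest point. -/
theorem NormalField.nearestPoint_add_smul (hν : NormalField S ν L) (hS : IsCompact S) {z : Pt d}
    (hz : z ∈ S) {t ε : ℝ} (ht : |t| ≤ ε) (hε : 4 * L * ε ≤ 1) :
    nearestPoint S (z + t • ν z) = z := by
  have hd : dist (z + t • ν z) z = |t| := by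
    rw [dist_eq_norm, add_sub_cancel_left, norm_smul, (hν.normal z hz).1, mul_one, Real.norm_eq_abs]
  refine hν.nearestPoint_eq hS ⟨hz, fun w hw => ?_⟩
    (((Metric.infDist_le_dist_of_mem hz).trans hd.le).trans ht) hε
  rw [hd, dist_eq_norm]
  refine abs_le_of_sq_le_sq ?_ (norm_nonneg _)
  have h1 : ‖z + t • ν z - w‖ ^ 2 = t ^ 2 - 2 * (t * ⟪ν z, w - z⟫) + ‖w - z‖ ^ 2 := by
    have : z + t • ν z - w = t • ν z - (w - z) := by abel
    rw [this, @norm_sub_sq_real, norm_smul, (hν.normal z hz).1, inner_smul_left]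
    simp
  have h2 : t * ⟪ν z, w - z⟫ ≤ ε * (L * ‖w - z‖ ^ 2) := by
    calc t * ⟪ν z, w - z⟫ ≤ |t| * |⟪ν z, w - z⟫| := by rw [← abs_mul]; exact le_abs_self _
      _ ≤ _ := by
        gcongr
        · exact (abs_nonneg t).trans ht
        · exact hν.taylor z hz w hw
  nlinarith [sq_nonneg ‖w - z‖]

end nearest

/-! ### Volumes of normal cylinders -/

section volume
variable {S : Set (Pt d)} {ν : Pt d → Pt d} {L : ℝ}

theorem volume_ball_eq (x : Pt d) {r : ℝ} (hr : 0 < r) : volume (Metric.ball x r) =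
    ENNReal.ofReal (r ^ d * volume.real (Metric.ball (0 : Pt d) 1)) := by
  rw [Measure.addHaar_ball_of_pos volume x hr, finrank_euclideanSpace_fin,
    ENNReal.ofReal_mul (by positivity), measureReal_def, ENNReal.ofReal_toReal measure_ball_lt_top.ne]

theorem volume_closedBall_eq (x : Pt d) {r : ℝ} (hr : 0 ≤ r) : volume (Metric.closedBall x r) =
    ENNReal.ofReal (r ^ d * volume.real (Metric.ball (0 : Pt d) 1)) := by
  rw [Measure.addHaar_closedBall volume x hr, finrank_euclideanSpace_fin,
    ENNReal.ofReal_mul (by positivity), measureReal_def, ENNReal.ofReal_toReal measure_ball_lt_top.ne]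

theorem volume_real_unitBall_pos : 0 < volume.real (Metric.ball (0 : Pt d) 1) :=
  ENNReal.toReal_pos (Metric.measure_ball_pos _ _ one_pos).ne' measure_ball_lt_top.ne

/-- The points projecting into a set of diameter `s` lie in a thin cylinder around a normal line. -/
theorem NormalField.volume_nearestPoint_mem_le (hν : NormalField S ν L) (hS : IsCompact S)
    (hd : 1 ≤ d) {ε s : ℝ} (hε0 : 0 < ε) (hε : 4 * L * ε ≤ 1) (hs : 0 < s) (hsε : s ≤ ε)
    {E : Set (Pt d)} (hE : ∀ a ∈ E, ∀ b ∈ E, ‖a - b‖ ≤ s) :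
    volume {x | Metric.infDist x S ≤ ε ∧ nearestPoint S x ∈ E ∩ S} ≤
      ENNReal.ofReal (4 * ε * 3 ^ d * volume.real (Metric.ball (0 : Pt d) 1) * s ^ (d - 1)) := by
  rcases (E ∩ S).eq_empty_or_nonempty with hem | ⟨y, hyE, hy⟩
  · simp [hem]
  -- The cylinder is covered by balls of radius `3 * s`, spaced `s` apart on the normal line at `y`.
  set n := ⌈2 * ε / s⌉₊ + 1 with hn
  have hsub : {x | Metric.infDist x S ≤ ε ∧ nearestPoint S x ∈ E ∩ S} ⊆
      ⋃ k ∈ Finset.range n, Metric.closedBall (y + (-ε + k * s) • ν y) (3 * s) := by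
    rintro x ⟨hx, hpE, hpS⟩
    have hnear := isNearestPoint_nearestPoint hS ⟨y, hy⟩ x
    obtain ⟨t, ht⟩ := (hν.normal _ hpS).exists_sub_eq_smul hnear
    set q := nearestPoint S x
    have ht' : |t| ≤ ε := by
      rw [← hnear.dist_eq_infDist, dist_eq_norm, ht, norm_smul, (hν.normal _ hpS).1, mul_one] at hx
      exact hx
    have hqy : ‖q - y‖ ≤ s := hE q hpE y hyE
    -- The sign of `t'` accounts for the unknown orientation of `ν` at `q` relative to `ν` at `y`.
    obtain ⟨t', ht'ε, hxt'⟩ : ∃ t', |t'| ≤ ε ∧ ‖x - (y + t' • ν y)‖ ≤ 2 * s := by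
      have hb : |t| * (L * ‖q - y‖) ≤ s := by
        have := hν.pos
        calc |t| * (L * ‖q - y‖) ≤ ε * (L * s) := by gcongr
          _ = (4 * L * ε) * s / 4 := by ring
          _ ≤ 1 * s / 4 := by gcongr
          _ ≤ s := by linarith
      rcases hν.lip y hy q hpS with h | h
      · refine ⟨t, ht', ?_⟩
        have : x - (y + t • ν y) = (q - y) + t • (ν q - ν y) := by
          rw [sub_eq_iff_eq_add] at ht
          rw [ht]; module
        rw [this]
        refine (norm_add_le _ _).trans ?_
        rw [norm_smul, Real.norm_eq_abs]
        have : |t| * ‖ν q - ν y‖ ≤ |t| * (L * ‖q - y‖) := by gcongr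
        linarith
      · refine ⟨-t, by simpa using ht', ?_⟩
        have : x - (y + (-t) • ν y) = (q - y) + t • (ν q + ν y) := by
          rw [sub_eq_iff_eq_add] at ht
          rw [ht]; module
        rw [this]
        refine (norm_add_le _ _).trans ?_
        rw [norm_smul, Real.norm_eq_abs]
        have : |t| * ‖ν q + ν y‖ ≤ |t| * (L * ‖q - y‖) := by gcongr
        linarith
    have h0 : 0 ≤ t' + ε := by linarith [neg_le_of_abs_le ht'ε]
    refine mem_iUnion₂.2 ⟨⌊(t' + ε) / s⌋₊, ?_, ?_⟩
    · rw [Finset.mem_range, hn, Nat.lt_succ_iff]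
      refine (Nat.floor_le_floor ?_).trans (Nat.floor_le_ceil _)
      gcongr
      linarith [le_of_abs_le ht'ε]
    · rw [mem_closedBall_iff_norm]
      have h1 : |t' - (-ε + ⌊(t' + ε) / s⌋₊ * s)| ≤ s := by
        have h2 := Nat.floor_le (div_nonneg h0 hs.le)
        have h3 := Nat.lt_floor_add_one ((t' + ε) / s)
        rw [le_div_iff₀ hs] at h2
        rw [div_lt_iff₀ hs] at h3
        rw [abs_le]; constructor <;> nlinarith
      have : x - (y + (-ε + ⌊(t' + ε) / s⌋₊ * s) • ν y) =
          (x - (y + t' • ν y)) + (t' - (-ε + ⌊(t' + ε) / s⌋₊ * s)) • ν y := by module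
      rw [this]
      refine (norm_add_le _ _).trans ?_
      rw [norm_smul, (hν.normal y hy).1, mul_one, Real.norm_eq_abs]
      linarith
  refine (measure_mono hsub).trans ((measure_biUnion_finset_le _ _).trans ?_)
  simp_rw [volume_closedBall_eq _ (by positivity : 0 ≤ 3 * s)]
  rw [Finset.sum_const, Finset.card_range, nsmul_eq_mul, ← ENNReal.ofReal_natCast,
    ← ENNReal.ofReal_mul (by positivity)]
  apply ENNReal.ofReal_le_ofReal
  have hnle : (n : ℝ) ≤ 4 * ε / s := by
    have h1 := (Nat.ceil_lt_add_one (by positivity : 0 ≤ 2 * ε / s)).le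
    have h2 : 1 ≤ ε / s := by rwa [one_le_div hs]
    rw [hn]; push_cast
    have : 4 * ε / s = 2 * ε / s + 2 * (ε / s) := by ring
    linarith
  have hpow : s ^ d = s ^ (d - 1) * s := by rw [← pow_succ]; congr 1; omega
  calc (n : ℝ) * ((3 * s) ^ d * volume.real (Metric.ball (0 : Pt d) 1))
      ≤ 4 * ε / s * ((3 * s) ^ d * volume.real (Metric.ball (0 : Pt d) 1)) := by gcongr
    _ = _ := by rw [mul_pow, hpow]; field_simp

/-- The points near `S` projecting into a ball of radius `s` contain a normal cylinder. -/
theorem NormalField.le_volume_nearestPoint_mem (hν : NormalField S ν L) (hS : IsCompact S)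
    (hd : 1 ≤ d) {ε s : ℝ} (hε : 4 * L * ε ≤ 1) (hs : 0 < s) (hsε : s ≤ ε)
    {z : Pt d} (hz : z ∈ S) :
    ENNReal.ofReal (ε / 2 * (1 / 4) ^ d * volume.real (Metric.ball (0 : Pt d) 1) * s ^ (d - 1)) ≤
      volume {x | Metric.infDist x S < ε ∧ ‖nearestPoint S x - z‖ < s} := by
  -- Disjoint balls of radius `s / 4`, spaced `s` apart on half of the normal line at `z`; the
  -- projection has Lipschitz constant `2`.
  set n := ⌊ε / (2 * s)⌋₊ + 1 with hn
  have hε0 : 0 < ε := hs.trans_le hsε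
  have hν1 := (hν.normal z hz).1
  have hsub : ⋃ k ∈ Finset.range n, Metric.ball (z + (k * s) • ν z) (s / 4) ⊆
      {x | Metric.infDist x S < ε ∧ ‖nearestPoint S x - z‖ < s} := by
    intro x hx
    obtain ⟨k, hk, hx⟩ := mem_iUnion₂.1 hx
    rw [Finset.mem_range, hn, Nat.lt_succ_iff] at hk
    have hks : k * s ≤ ε / 2 := by
      have h1 := (Nat.le_floor_iff (by positivity)).1 hk
      rw [le_div_iff₀ (by positivity)] at h1
      linarith
    rw [mem_ball_iff_norm] at hx
    have habs : |k * s| ≤ ε / 2 := by rwa [abs_of_nonneg (by positivity)]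
    have hc : Metric.infDist (z + (k * s) • ν z) S ≤ ε / 2 := by
      refine (Metric.infDist_le_dist_of_mem hz).trans ?_
      rwa [dist_eq_norm, add_sub_cancel_left, norm_smul, hν1, mul_one, Real.norm_eq_abs]
    have hxε : Metric.infDist x S < ε := by
      have := Metric.infDist_le_infDist_add_dist (s := S) (x := x) (y := z + (k * s) • ν z)
      rw [dist_eq_norm] at this
      linarith
    refine ⟨hxε, ?_⟩
    have h1 := hν.norm_nearestPoint_sub_le hS ⟨z, hz⟩ hxε.le (hc.trans (by linarith)) hε
    rw [hν.nearestPoint_add_smul hS hz (habs.trans (by linarith)) hε] at h1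
    linarith
  refine le_trans ?_ (measure_mono hsub)
  rw [measure_biUnion_finset]
  · simp_rw [volume_ball_eq _ (by positivity : 0 < s / 4)]
    rw [Finset.sum_const, Finset.card_range, nsmul_eq_mul, ← ENNReal.ofReal_natCast,
      ← ENNReal.ofReal_mul (by positivity)]
    apply ENNReal.ofReal_le_ofReal
    have hnle : ε / (2 * s) ≤ n := by
      rw [hn]; push_cast; exact (Nat.lt_floor_add_one _).le
    have hpow : s ^ d = s ^ (d - 1) * s := by rw [← pow_succ]; congr 1; omega
    calc _ = ε / (2 * s) * ((s / 4) ^ d * volume.real (Metric.ball (0 : Pt d) 1)) := by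
          rw [div_pow s, div_pow 1, one_pow, hpow]; field_simp
      _ ≤ _ := by gcongr
  · intro i _ j _ hij
    apply Metric.ball_disjoint_ball
    rw [dist_eq_norm]
    have : z + (i * s) • ν z - (z + (j * s) • ν z) = (((i : ℝ) - j) * s) • ν z := by module
    rw [this, norm_smul, hν1, mul_one, norm_mul, Real.norm_of_nonneg hs.le, Real.norm_eq_abs]
    have h1 : (1 : ℝ) ≤ |(i : ℝ) - j| := by
      have : (1 : ℤ) ≤ |(i : ℤ) - j| := Int.one_le_abs (by omega)
      exact_mod_cast this
    nlinarith
  · exact fun _ _ => measurableSet_ball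

end volume

/-! ### A nonlocal Poincaré inequality -/

section nonlocal
open scoped ENNReal

/-- A measurable kernel satisfying the triangle inequality of the squared distance `|f x - f y|²`
of the values of a function. -/
structure IsSqKernel (D : Pt d → Pt d → ℝ≥0∞) : Prop where
  measurable : Measurable (Function.uncurry D)
  le : ∀ x y z, D x z ≤ 2 * (D x y + D y z)

/-- The part of the double integral of `D` over `B × B` that lies within distance `r` of the
diagonal. -/
def nearEnergy (B : Set (Pt d)) (r : ℝ) (D : Pt d → Pt d → ℝ≥0∞) : ℝ≥0∞ :=
  ∫⁻ x in B, ∫⁻ y in B, {q : Pt d × Pt d | ‖q.1 - q.2‖ < r}.indicator (Function.uncurry D) (x, y)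

theorem measurableSet_near (r : ℝ) : MeasurableSet {q : Pt d × Pt d | ‖q.1 - q.2‖ < r} :=
  measurableSet_lt (by fun_prop) (by fun_prop)

theorem nearEnergy_mono {B B' : Set (Pt d)} (h : B ⊆ B') (r : ℝ) (D : Pt d → Pt d → ℝ≥0∞) :
    nearEnergy B r D ≤ nearEnergy B' r D :=
  lintegral_mono' (Measure.restrict_mono h le_rfl)
    fun _ => lintegral_mono' (Measure.restrict_mono h le_rfl) le_rfl

theorem lintegral_midpoint (g : Pt d → ℝ≥0∞) (x : Pt d) :
    ∫⁻ y, g ((1 / 2 : ℝ) • (x + y)) = 2 ^ d * ∫⁻ m, g m := by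
  have h1 := lintegral_add_left_eq_self (μ := (volume : Measure (Pt d)))
    (fun z => g ((1 / 2 : ℝ) • z)) x
  rw [h1]
  have h2 : MeasurableEmbedding ((1 / 2 : ℝ) • · : Pt d → Pt d) :=
    (Homeomorph.smulOfNeZero (1 / 2 : ℝ) (by norm_num)).measurableEmbedding
  rw [← h2.lintegral_map, Measure.map_addHaar_smul _ (by norm_num), lintegral_smul_measure,
    finrank_euclideanSpace_fin, smul_eq_mul]
  congr 1
  rw [one_div, inv_pow, inv_inv, abs_of_pos (by positivity),
    ENNReal.ofReal_pow (by norm_num)]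
  simp

/-- Doubling the range of interaction: each difference is split at the midpoint, and the midpoint
is taken as a new variable of integration. -/
theorem nearEnergy_two_mul_le {B : Set (Pt d)} (hB : Convex ℝ B) (hBm : MeasurableSet B)
    {D : Pt d → Pt d → ℝ≥0∞} (hD : IsSqKernel D) (r : ℝ) :
    nearEnergy B (2 * r) D ≤ 2 ^ (d + 2) * nearEnergy B r D := by
  set k : ℝ → Pt d × Pt d → ℝ≥0∞ := fun r =>
    ((B ×ˢ B) ∩ {q : Pt d × Pt d | ‖q.1 - q.2‖ < r}).indicator (Function.uncurry D) with hk
  have hkm : ∀ r, Measurable (k r) := fun r =>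
    hD.measurable.indicator ((hBm.prod hBm).inter (measurableSet_near r))
  have hE : ∀ r, nearEnergy B r D = ∫⁻ x, ∫⁻ y, k r (x, y) := by
    intro r
    rw [nearEnergy, ← lintegral_indicator hBm]
    refine lintegral_congr fun x => ?_
    by_cases hx : x ∈ B
    · rw [indicator_of_mem hx, ← lintegral_indicator hBm]
      refine lintegral_congr fun y => ?_
      by_cases hy : y ∈ B
      · rw [indicator_of_mem hy]
        simp [hk, indicator, hx, hy]
      · simp [hk, hy]
    · simp [hk, hx]
  have hpt : ∀ x y, k (2 * r) (x, y) ≤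
      2 * (k r (x, (1 / 2 : ℝ) • (x + y)) + k r ((1 / 2 : ℝ) • (y + x), y)) := by
    intro x y
    by_cases h : (x, y) ∈ (B ×ˢ B) ∩ {q : Pt d × Pt d | ‖q.1 - q.2‖ < 2 * r}
    · have i1 : k (2 * r) (x, y) = D x y := indicator_of_mem h _
      obtain ⟨⟨hx, hy⟩, hxy⟩ := h
      replace hxy : ‖x - y‖ < 2 * r := hxy
      have hm : (1 / 2 : ℝ) • (x + y) ∈ B := by
        rw [smul_add]
        exact hB hx hy (by norm_num) (by norm_num) (by norm_num)
      have e1 : x - (1 / 2 : ℝ) • (x + y) = (1 / 2 : ℝ) • (x - y) := by module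
      have e2 : (1 / 2 : ℝ) • (x + y) - y = (1 / 2 : ℝ) • (x - y) := by module
      have h1 : ‖x - (1 / 2 : ℝ) • (x + y)‖ < r := by
        rw [e1, norm_smul]; norm_num; linarith
      have h2 : ‖(1 / 2 : ℝ) • (x + y) - y‖ < r := by
        rw [e2, norm_smul]; norm_num; linarith
      rw [add_comm y x]
      have i2 : k r (x, (1 / 2 : ℝ) • (x + y)) = D x ((1 / 2 : ℝ) • (x + y)) :=
        indicator_of_mem (show (x, (1 / 2 : ℝ) • (x + y)) ∈
          (B ×ˢ B) ∩ {q : Pt d × Pt d | ‖q.1 - q.2‖ < r} from ⟨⟨hx, hm⟩, h1⟩) _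
      have i3 : k r ((1 / 2 : ℝ) • (x + y), y) = D ((1 / 2 : ℝ) • (x + y)) y :=
        indicator_of_mem (show ((1 / 2 : ℝ) • (x + y), y) ∈
          (B ×ˢ B) ∩ {q : Pt d × Pt d | ‖q.1 - q.2‖ < r} from ⟨⟨hm, hy⟩, h2⟩) _
      rw [i1, i2, i3]
      exact hD.le _ _ _
    · rw [show k (2 * r) (x, y) = 0 from indicator_of_notMem h _]
      exact zero_le
  have hm1 : Measurable fun q : Pt d × Pt d => k r (q.1, (1 / 2 : ℝ) • (q.1 + q.2)) :=
    (hkm r).comp (by fun_prop)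
  have hm2 : Measurable fun q : Pt d × Pt d => k r ((1 / 2 : ℝ) • (q.2 + q.1), q.2) :=
    (hkm r).comp (by fun_prop)
  rw [hE, hE]
  calc ∫⁻ x, ∫⁻ y, k (2 * r) (x, y)
      ≤ ∫⁻ x, ∫⁻ y, 2 * (k r (x, (1 / 2 : ℝ) • (x + y)) + k r ((1 / 2 : ℝ) • (y + x), y)) :=
        lintegral_mono fun x => lintegral_mono fun y => hpt x y
    _ = 2 * ((∫⁻ x, ∫⁻ y, k r (x, (1 / 2 : ℝ) • (x + y))) +
          ∫⁻ x, ∫⁻ y, k r ((1 / 2 : ℝ) • (y + x), y)) := by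
        rw [← lintegral_add_left (Measurable.lintegral_prod_right' hm1),
          ← lintegral_const_mul' _ _ (by norm_num)]
        refine lintegral_congr fun x => ?_
        rw [lintegral_const_mul' _ _ (by norm_num), lintegral_add_left]
        exact hm1.comp measurable_prodMk_left
    _ = 2 * ((∫⁻ x, 2 ^ d * ∫⁻ m, k r (x, m)) + ∫⁻ y, 2 ^ d * ∫⁻ m, k r (m, y)) := by
        rw [lintegral_lintegral_swap (f := fun x y => k r ((1 / 2 : ℝ) • (y + x), y)) hm2.aemeasurable]
        congr 2
        · exact lintegral_congr fun x => lintegral_midpoint (fun m => k r (x, m)) x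
        · exact lintegral_congr fun y => lintegral_midpoint (fun m => k r (m, y)) y
    _ = 2 ^ (d + 2) * ∫⁻ x, ∫⁻ y, k r (x, y) := by
        rw [lintegral_const_mul' _ _ (by simp), lintegral_const_mul' _ _ (by simp),
          lintegral_lintegral_swap (f := fun y m => k r (m, y))
            ((hkm r).comp measurable_swap).aemeasurable]
        ring

theorem nearEnergy_eq_of_le {B : Set (Pt d)} (hBm : MeasurableSet B) {R : ℝ}
    (hB : ∀ x ∈ B, ∀ y ∈ B, ‖x - y‖ < R) (D : Pt d → Pt d → ℝ≥0∞) :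
    nearEnergy B R D = ∫⁻ x in B, ∫⁻ y in B, D x y := by
  refine setLIntegral_congr_fun hBm fun x hx => setLIntegral_congr_fun hBm fun y hy => ?_
  exact indicator_of_mem (show (x, y) ∈ {q : Pt d × Pt d | ‖q.1 - q.2‖ < R} from hB x hx y hy) _

/-- The nonlocal Poincaré inequality on a ball: the range of interaction is doubled until it exceeds
the diameter. -/
theorem lintegral_ball_le_nearEnergy (c : Pt d) {ρ r : ℝ} (hr : 0 < r) (hrρ : r ≤ 2 * ρ)
    {D : Pt d → Pt d → ℝ≥0∞} (hD : IsSqKernel D) :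
    ENNReal.ofReal (r ^ (d + 2)) * ∫⁻ x in Metric.ball c ρ, ∫⁻ y in Metric.ball c ρ, D x y ≤
      ENNReal.ofReal ((4 * ρ) ^ (d + 2)) * nearEnergy (Metric.ball c ρ) r D := by
  have hiter : ∀ k : ℕ, nearEnergy (Metric.ball c ρ) (2 ^ k * r) D ≤
      (2 ^ (d + 2)) ^ k * nearEnergy (Metric.ball c ρ) r D := by
    intro k
    induction k with
    | zero => simp
    | succ k ih =>
      rw [pow_succ', mul_assoc]
      refine (nearEnergy_two_mul_le (convex_ball c ρ) measurableSet_ball hD _).trans ?_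
      rw [pow_succ' (2 ^ (d + 2)), mul_assoc]
      gcongr
  -- `n + 1` doublings take the range `r` beyond the diameter `2 * ρ`, but not beyond `4 * ρ`.
  obtain ⟨n, hn1, hn2⟩ := exists_nat_pow_near (x := 2 * ρ / r) (y := 2)
    ((one_le_div hr).2 hrρ) one_lt_two
  rw [le_div_iff₀ hr] at hn1
  rw [div_lt_iff₀ hr] at hn2
  have hall := nearEnergy_eq_of_le (measurableSet_ball (x := c) (ε := ρ)) (R := 2 ^ (n + 1) * r)
    (fun x hx y hy => by
      rw [mem_ball_iff_norm] at hx hy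
      have : x - y = (x - c) - (y - c) := by abel
      rw [this]
      linarith [norm_sub_le (x - c) (y - c)]) D
  rw [← hall]
  refine (mul_le_mul_right (hiter (n + 1)) _).trans ?_
  rw [← mul_assoc]
  gcongr
  have : ((2 : ℝ≥0∞) ^ (d + 2)) ^ (n + 1) = ENNReal.ofReal ((2 ^ (n + 1)) ^ (d + 2)) := by
    rw [ENNReal.ofReal_pow (by positivity), ENNReal.ofReal_pow (by positivity), pow_right_comm]
    simp
  rw [this, ← ENNReal.ofReal_mul (by positivity), ← mul_pow]
  apply ENNReal.ofReal_le_ofReal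
  refine pow_le_pow_left₀ (by positivity) ?_ _
  calc r * 2 ^ (n + 1) = 2 * (2 ^ n * r) := by ring
    _ ≤ 2 * (2 * ρ) := by gcongr
    _ = 4 * ρ := by ring

/-- Comparison of two sets through a third one. -/
theorem volume_mul_lintegral_le {A B Z : Set (Pt d)} {D : Pt d → Pt d → ℝ≥0∞} (hD : IsSqKernel D) :
    volume Z * ∫⁻ x in A, ∫⁻ y in B, D x y ≤
      2 * (volume B * (∫⁻ x in A, ∫⁻ z in Z, D x z) + volume A * ∫⁻ z in Z, ∫⁻ y in B, D z y) := by
  have hDx : ∀ x, Measurable (D x) := fun x => hD.measurable.comp measurable_prodMk_left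
  have hDy : ∀ y, Measurable fun x => D x y := fun y => hD.measurable.comp measurable_prodMk_right
  have hDm : ∀ Z : Set (Pt d), Measurable fun x => ∫⁻ z in Z, D x z := fun Z =>
    Measurable.lintegral_prod_right' (f := Function.uncurry D) hD.measurable
  calc volume Z * ∫⁻ x in A, ∫⁻ y in B, D x y
      = ∫⁻ z in Z, ∫⁻ x in A, ∫⁻ y in B, D x y := by
        rw [setLIntegral_const, mul_comm]
    _ ≤ ∫⁻ z in Z, ∫⁻ x in A, ∫⁻ y in B, 2 * (D x z + D z y) := by
        gcongr with z x y
        exact hD.le _ _ _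
    _ = ∫⁻ z in Z, 2 * (volume B * (∫⁻ x in A, D x z) + volume A * ∫⁻ y in B, D z y) := by
        refine lintegral_congr fun z => ?_
        have h1 : ∀ x, ∫⁻ y in B, 2 * (D x z + D z y) =
            2 * (volume B * D x z + ∫⁻ y in B, D z y) := by
          intro x
          rw [lintegral_const_mul' _ _ (by norm_num), lintegral_add_right _ (hDx z),
            setLIntegral_const, mul_comm (D x z)]
        simp_rw [h1]
        rw [lintegral_const_mul' _ _ (by norm_num), lintegral_add_left ((hDy z).const_mul _),
          setLIntegral_const, lintegral_const_mul _ (hDy z), mul_comm (volume A)]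
    _ = _ := by
        have hm : Measurable fun z => ∫⁻ x in A, D x z :=
          Measurable.lintegral_prod_left' (f := Function.uncurry D) hD.measurable
        rw [lintegral_const_mul' _ _ (by norm_num), lintegral_add_left (hm.const_mul _),
          lintegral_const_mul _ hm, lintegral_const_mul _ (hDm B),
          lintegral_lintegral_swap (f := fun z x => D x z)
            (hD.measurable.comp measurable_swap).aemeasurable]

theorem setLIntegral_biUnion_finset_le {ι : Type*} [DecidableEq ι] (t : Finset ι)
    (s : ι → Set (Pt d)) (f : Pt d → ℝ≥0∞) :
    ∫⁻ x in ⋃ i ∈ t, s i, f x ≤ ∑ i ∈ t, ∫⁻ x in s i, f x := by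
  induction t using Finset.induction_on with
  | empty => simp
  | insert a t ha ih =>
    rw [Finset.set_biUnion_insert, Finset.sum_insert ha]
    exact (lintegral_union_le _ _ _).trans (by gcongr)

/-- The nonlocal Poincaré inequality on a neighborhood of a connected set that is a finite union of
balls: the double integral over all pairs of points is bounded by that over the pairs of distance
less than `r`, with the optimal power of `r`. -/
theorem exists_lintegral_le_nearEnergy {S : Set (Pt d)} (hS : IsPreconnected S) (t : Finset (Pt d))
    {ρ : ℝ} (hρ : 0 < ρ) (htS : ∀ y ∈ t, y ∈ S) (hcov : S ⊆ ⋃ y ∈ t, Metric.ball y ρ) :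
    ∃ C : ℝ≥0∞, C ≠ ⊤ ∧ ∀ (D : Pt d → Pt d → ℝ≥0∞) (r : ℝ), IsSqKernel D → 0 < r → r ≤ ρ →
      ENNReal.ofReal (r ^ (d + 2)) *
        ∫⁻ x in ⋃ y ∈ t, Metric.ball y ρ, ∫⁻ y in ⋃ y ∈ t, Metric.ball y ρ, D x y ≤
      C * nearEnergy (⋃ y ∈ t, Metric.ball y ρ) r D := by
  classical
  set U := ⋃ y ∈ t, Metric.ball y ρ with hU
  let P : Pt d → Pt d → Prop := fun i j => ∃ C : ℝ≥0∞, C ≠ ⊤ ∧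
    ∀ (D : Pt d → Pt d → ℝ≥0∞) (r : ℝ), IsSqKernel D → 0 < r → r ≤ ρ →
      ENNReal.ofReal (r ^ (d + 2)) * ∫⁻ x in Metric.ball i ρ, ∫⁻ y in Metric.ball j ρ, D x y ≤
        C * nearEnergy U r D
  have hrefl : ∀ i ∈ t, P i i := by
    intro i hi
    refine ⟨ENNReal.ofReal ((4 * ρ) ^ (d + 2)), ENNReal.ofReal_ne_top, fun D r hD hr hrρ => ?_⟩
    refine (lintegral_ball_le_nearEnergy i hr (by linarith) hD).trans ?_
    gcongr
    exact nearEnergy_mono (subset_biUnion_of_mem (u := fun y => Metric.ball y ρ) hi) r D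
  have hstep : ∀ i ∈ t, ∀ j ∈ t, ∀ k ∈ t, P i j →
      (Metric.ball j ρ ∩ Metric.ball k ρ).Nonempty → P i k := by
    rintro i hi j hj k hk ⟨C, hC, hCD⟩ hne
    obtain ⟨C', hC', hCD'⟩ := hrefl k hk
    set Z := Metric.ball j ρ ∩ Metric.ball k ρ with hZ
    have hZ0 : volume Z ≠ 0 :=
      ((Metric.isOpen_ball.inter Metric.isOpen_ball).measure_pos volume hne).ne'
    have hZt : volume Z ≠ ⊤ := measure_ne_top_of_subset inter_subset_left measure_ball_lt_top.ne
    refine ⟨(volume Z)⁻¹ * (2 * (volume (Metric.ball k ρ) * C + volume (Metric.ball i ρ) * C')), ?_, ?_⟩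
    · refine ENNReal.mul_ne_top (ENNReal.inv_ne_top.2 hZ0) (ENNReal.mul_ne_top (by norm_num) ?_)
      exact ENNReal.add_ne_top.2 ⟨ENNReal.mul_ne_top measure_ball_lt_top.ne hC,
        ENNReal.mul_ne_top measure_ball_lt_top.ne hC'⟩
    · intro D r hD hr hrρ
      have h1 := volume_mul_lintegral_le (A := Metric.ball i ρ) (B := Metric.ball k ρ) (Z := Z) hD
      have h2 : ∫⁻ x in Metric.ball i ρ, ∫⁻ z in Z, D x z ≤
          ∫⁻ x in Metric.ball i ρ, ∫⁻ z in Metric.ball j ρ, D x z := by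
        gcongr; exact inter_subset_left
      have h3 : ∫⁻ z in Z, ∫⁻ y in Metric.ball k ρ, D z y ≤
          ∫⁻ z in Metric.ball k ρ, ∫⁻ y in Metric.ball k ρ, D z y :=
        lintegral_mono' (Measure.restrict_mono inter_subset_right le_rfl) le_rfl
      have h4 := hCD D r hD hr hrρ
      have h5 := hCD' D r hD hr hrρ
      rw [mul_assoc, ← ENNReal.mul_le_iff_le_inv hZ0 hZt]
      set q := ENNReal.ofReal (r ^ (d + 2))
      set I := ∫⁻ x in Metric.ball i ρ, ∫⁻ y in Metric.ball k ρ, D x y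
      calc volume Z * (q * I) = q * (volume Z * I) := by ring
        _ ≤ q * (2 * (volume (Metric.ball k ρ) *
              (∫⁻ x in Metric.ball i ρ, ∫⁻ z in Metric.ball j ρ, D x z) +
            volume (Metric.ball i ρ) *
              ∫⁻ z in Metric.ball k ρ, ∫⁻ y in Metric.ball k ρ, D z y)) := by
            refine mul_le_mul_right (h1.trans ?_) _
            gcongr
        _ = 2 * (volume (Metric.ball k ρ) *
              (q * ∫⁻ x in Metric.ball i ρ, ∫⁻ z in Metric.ball j ρ, D x z) +
            volume (Metric.ball i ρ) *
              (q * ∫⁻ z in Metric.ball k ρ, ∫⁻ y in Metric.ball k ρ, D z y)) := by ring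
        _ ≤ 2 * (volume (Metric.ball k ρ) * (C * nearEnergy U r D) +
            volume (Metric.ball i ρ) * (C' * nearEnergy U r D)) := by gcongr
        _ = _ := by ring
  -- By connectedness, any two of the balls are joined by a chain of overlapping balls.
  have hall : ∀ i ∈ t, ∀ j ∈ t, P i j := by
    intro i hi j hj
    by_contra hij
    set A := ⋃ k ∈ {k | k ∈ t ∧ P i k}, Metric.ball k ρ
    set A' := ⋃ k ∈ {k | k ∈ t ∧ ¬ P i k}, Metric.ball k ρ
    have hA : IsOpen A := isOpen_biUnion fun _ _ => Metric.isOpen_ball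
    have hA' : IsOpen A' := isOpen_biUnion fun _ _ => Metric.isOpen_ball
    have hsub : S ⊆ A ∪ A' := by
      intro x hx
      obtain ⟨k, hk, hxk⟩ := mem_iUnion₂.1 (hcov hx)
      by_cases hP : P i k
      · exact Or.inl (mem_biUnion (show k ∈ {k | k ∈ t ∧ P i k} from ⟨hk, hP⟩) hxk)
      · exact Or.inr (mem_biUnion (show k ∈ {k | k ∈ t ∧ ¬ P i k} from ⟨hk, hP⟩) hxk)
    obtain ⟨x, -, hxA, hxA'⟩ := hS A A' hA hA' hsub
      ⟨i, htS i hi, mem_biUnion (show i ∈ {k | k ∈ t ∧ P i k} from ⟨hi, hrefl i hi⟩)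
        (Metric.mem_ball_self hρ)⟩
      ⟨j, htS j hj, mem_biUnion (show j ∈ {k | k ∈ t ∧ ¬ P i k} from ⟨hj, hij⟩)
        (Metric.mem_ball_self hρ)⟩
    obtain ⟨k, ⟨hk, hPk⟩, hxk⟩ := mem_iUnion₂.1 hxA
    obtain ⟨l, ⟨hl, hPl⟩, hxl⟩ := mem_iUnion₂.1 hxA'
    exact hPl (hstep i hi k hk l hl hPk ⟨x, hxk, hxl⟩)
  choose! C hC hCD using hall
  refine ⟨∑ i ∈ t, ∑ j ∈ t, C i j, ?_, fun D r hD hr hrρ => ?_⟩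
  · exact ENNReal.sum_ne_top.2 fun i hi => ENNReal.sum_ne_top.2 fun j hj => hC i hi j hj
  · have h1 : ∫⁻ x in U, ∫⁻ y in U, D x y ≤
        ∑ i ∈ t, ∑ j ∈ t, ∫⁻ x in Metric.ball i ρ, ∫⁻ y in Metric.ball j ρ, D x y := by
      refine (setLIntegral_biUnion_finset_le t _ _).trans (Finset.sum_le_sum fun i _ => ?_)
      rw [← lintegral_finsetSum]
      · exact lintegral_mono fun x => setLIntegral_biUnion_finset_le t _ _
      · exact fun j _ => Measurable.lintegral_prod_right' (f := Function.uncurry D) hD.measurable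
    refine (mul_le_mul_right h1 _).trans ?_
    rw [Finset.mul_sum, Finset.sum_mul]
    refine Finset.sum_le_sum fun i hi => ?_
    rw [Finset.mul_sum, Finset.sum_mul]
    exact Finset.sum_le_sum fun j hj => hCD i hi j hj D r hD hr hrρ

end nonlocal

/-! ### Simplices and meshes -/

/-- `lam` lists the barycentric coordinates of the `d`-simplex with vertex set `s`. -/
structure IsBarycentric (s : Finset (Pt d)) (lam : Pt d → Pt d →ᵃ[ℝ] ℝ) : Prop where
  apply_self : ∀ a ∈ s, lam a a = 1
  apply_of_ne : ∀ a ∈ s, ∀ b ∈ s, a ≠ b → lam a b = 0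
  mem_hull : ∀ x, x ∈ hull s ↔ ∀ a ∈ s, 0 ≤ lam a x
  mem_interior : ∀ x, x ∈ interior (hull s) ↔ ∀ a ∈ s, 0 < lam a x
  sum_eq_one : ∀ x, ∑ a ∈ s, lam a x = 1
  sum_smul : ∀ x, ∑ a ∈ s, lam a x • a = x

theorem affineMap_sum {ι F : Type*} [AddCommGroup F] [Module ℝ F] (f : Pt d →ᵃ[ℝ] F) (t : Finset ι)
    (w : ι → ℝ) (p : ι → Pt d) (hw : ∑ i ∈ t, w i = 1) :
    f (∑ i ∈ t, w i • p i) = ∑ i ∈ t, w i • f (p i) := by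
  have h : ∀ x, f x = f.linear x + f 0 := fun x => congrFun f.decomp x
  rw [h, map_sum]
  simp_rw [h (p _), smul_add, Finset.sum_add_distrib, map_smul]
  rw [← Finset.sum_smul, hw, one_smul]

theorem exists_isBarycentric {s : Finset (Pt d)} (hs : AffineIndependent ℝ ((↑) : s → Pt d))
    (hcard : s.card = d + 1) : ∃ lam, IsBarycentric s lam := by
  classical
  have htop : affineSpan ℝ (range ((↑) : s → Pt d)) = ⊤ := by
    rw [hs.affineSpan_eq_top_iff_card_eq_finrank_add_one]
    simp [hcard]
  let b : AffineBasis s ℝ (Pt d) := ⟨(↑), hs, htop⟩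
  have hb : ∀ i : s, b i = i := fun i => rfl
  have hrange : range b = (s : Set (Pt d)) := by
    ext x; simp [hb]
  refine ⟨fun a => if h : a ∈ s then b.coord ⟨a, h⟩ else 0, ?_, ?_, ?_, ?_, ?_, ?_⟩
  · intro a ha
    simp only [ha, dite_true]
    exact b.coord_apply_eq ⟨a, ha⟩
  · intro a ha c hc hac
    simp only [ha, dite_true]
    exact b.coord_apply_ne (i := ⟨a, ha⟩) (j := ⟨c, hc⟩) (by simpa using hac)
  · intro x
    rw [hull, ← hrange, b.convexHull_eq_nonneg_coord]
    constructor
    · intro h a ha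
      simp only [ha, dite_true]
      exact h ⟨a, ha⟩
    · intro h i
      have := h i i.2
      simpa using this
  · intro x
    rw [hull, ← hrange, b.interior_convexHull]
    constructor
    · intro h a ha
      simp only [ha, dite_true]
      exact h ⟨a, ha⟩
    · intro h i
      have := h i i.2
      simpa using this
  · intro x
    rw [← b.sum_coord_apply_eq_one x, ← Finset.sum_coe_sort s]
    simp
  · intro x
    conv_rhs => rw [← b.linear_combination_coord_eq_self x]
    rw [← Finset.sum_coe_sort s]
    simp [hb]

namespace IsBarycentric
variable {s : Finset (Pt d)} {lam : Pt d → Pt d →ᵃ[ℝ] ℝ}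

theorem affineMap_eq (h : IsBarycentric s lam) {F : Type*} [AddCommGroup F] [Module ℝ F]
    (f : Pt d →ᵃ[ℝ] F) (x : Pt d) : f x = ∑ a ∈ s, lam a x • f a := by
  conv_lhs => rw [← h.sum_smul x]
  exact affineMap_sum f s _ _ (h.sum_eq_one x)

theorem eq_zero_of_mem_affineSpan (h : IsBarycentric s lam) {F : Set (Pt d)} (hF : F ⊆ s) {a : Pt d}
    (ha : a ∈ s) (haF : a ∉ F) {x : Pt d} (hx : x ∈ affineSpan ℝ F) : lam a x = 0 := by
  have : affineSpan ℝ F ≤ (affineSpan ℝ {(0 : ℝ)}).comap (lam a) := by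
    rw [affineSpan_le]
    intro b hb
    have := h.apply_of_ne a ha b (hF hb) (by rintro rfl; exact haF hb)
    simp [this]
  simpa using this hx

end IsBarycentric

theorem affineSpan_ne_top_of_card_le {F : Finset (Pt d)} (hF : F.card ≤ d) :
    affineSpan ℝ (F : Set (Pt d)) ≠ ⊤ := by
  classical
  intro htop
  rcases F.eq_empty_or_nonempty with rfl | hne
  · rw [Finset.coe_empty, AffineSubspace.span_empty] at htop
    exact bot_ne_top htop
  · have h1 : F.card = (F.card - 1) + 1 := by have := hne.card_pos; omega
    have h2 := finrank_vectorSpan_image_finset_le ℝ (id : Pt d → Pt d) F h1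
    rw [Finset.image_id, ← direction_affineSpan, htop, AffineSubspace.direction_top, finrank_top,
      finrank_euclideanSpace_fin] at h2
    have := hne.card_pos
    omega

/-- A nonempty open set is not covered by finitely many proper affine subspaces. -/
theorem exists_mem_forall_notMem_affineSpan {O : Set (Pt d)} (hO : IsOpen O) (hne : O.Nonempty)
    {𝓕 : Set (Finset (Pt d))} (hfin : 𝓕.Finite) (hcard : ∀ F ∈ 𝓕, F.card ≤ d) :
    ∃ y ∈ O, ∀ F ∈ 𝓕, y ∉ affineSpan ℝ (F : Set (Pt d)) := by
  by_contra! hcon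
  have hsub : O ⊆ ⋃ F ∈ 𝓕, (affineSpan ℝ (F : Set (Pt d)) : Set (Pt d)) := by
    intro y hy
    obtain ⟨F, hF, hyF⟩ := hcon y hy
    exact mem_biUnion hF hyF
  -- Proper affine subspaces are null sets.
  have h0 : volume (⋃ F ∈ 𝓕, (affineSpan ℝ (F : Set (Pt d)) : Set (Pt d))) = 0 := by
    rw [measure_biUnion_null_iff hfin.countable]
    intro F hF
    exact Measure.addHaar_affineSubspace _ _ (affineSpan_ne_top_of_card_le (hcard F hF))
  exact (hO.measure_pos volume hne).ne' (measure_mono_null hsub h0)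

namespace Mesh
variable (T : Mesh d)

theorem mem_cells {s : Finset (Pt d)} : s ∈ T.cells ↔ s ∈ T.faces ∧ s.card = d + 1 := by
  simp [cells]

theorem exists_isBarycentric {s : Finset (Pt d)} (hs : s ∈ T.cells) : ∃ lam, IsBarycentric s lam :=
  CutFEM.exists_isBarycentric (T.indep (T.mem_cells.1 hs).1) (T.mem_cells.1 hs).2

theorem isCompact_hull (s : Finset (Pt d)) : IsCompact (hull s) :=
  s.finite_toSet.isCompact_convexHull ℝ

theorem isCompact_domain : IsCompact T.domain :=
  T.cells.isCompact_biUnion fun s _ => isCompact_hull s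

theorem mem_hull_inter [DecidableEq (Pt d)] {s t : Finset (Pt d)} (hs : s ∈ T.cells)
    (ht : t ∈ T.cells) {x : Pt d} (hxs : x ∈ hull s) (hxt : x ∈ hull t) : x ∈ hull (s ∩ t) := by
  have := T.inter_subset_convexHull (T.mem_cells.1 hs).1 (T.mem_cells.1 ht).1 ⟨hxs, hxt⟩
  rwa [hull, Finset.coe_inter]

theorem card_inter_le [DecidableEq (Pt d)] {s t : Finset (Pt d)} (hs : s ∈ T.cells)
    (ht : t ∈ T.cells) (hst : s ≠ t) : (s ∩ t).card ≤ d := by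
  by_contra! h
  have h1 : s ∩ t = s := Finset.eq_of_subset_of_card_le Finset.inter_subset_left
    (by rw [(T.mem_cells.1 hs).2]; omega)
  have h2 : s ∩ t = t := Finset.eq_of_subset_of_card_le Finset.inter_subset_right
    (by rw [(T.mem_cells.1 ht).2]; omega)
  exact hst (h1.symm.trans h2)

/-- Two elements sharing a facet lie on opposite sides of it. -/
theorem barycentric_neg_of_adjacent (hd : 1 ≤ d) {s t F : Finset (Pt d)} (hs : s ∈ T.cells)
    (ht : t ∈ T.cells) (hst : s ≠ t) (hF : F.card = d) (hFs : F ⊆ s) (hFt : F ⊆ t)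
    {lam : Pt d → Pt d →ᵃ[ℝ] ℝ} (hlam : IsBarycentric s lam) {a a' : Pt d} (ha : a ∈ s)
    (haF : a ∉ F) (ha' : a' ∈ t) (ha'F : a' ∉ F) : lam a a' < 0 := by
  classical
  by_contra! hnn
  have hinter : s ∩ t = F := (Finset.eq_of_subset_of_card_le (Finset.subset_inter hFs hFt)
    (by rw [hF]; exact T.card_inter_le hs ht hst)).symm
  have hsF : s = insert a F := (Finset.eq_of_subset_of_card_le
    (Finset.insert_subset ha hFs) (by rw [Finset.card_insert_of_notMem haF, hF,
      (T.mem_cells.1 hs).2])).symm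
  obtain ⟨mu, hmu⟩ := T.exists_isBarycentric ht
  -- The points `q ε` leave the barycenter of `F` towards `a'`.
  set c : Pt d := ∑ f ∈ F, (1 / d : ℝ) • f with hc
  have hd0 : (d : ℝ) ≠ 0 := by positivity
  have hw : ∑ f ∈ F, (1 / d : ℝ) = 1 := by simp [hF, hd0]
  have hcF : c ∈ hull F := by
    refine (convex_convexHull ℝ _).sum_mem (fun _ _ => by positivity) hw
      fun f hf => subset_convexHull ℝ _ hf
  have hev : ∀ᶠ ε in 𝓝[>] (0 : ℝ), ∀ f ∈ F, 0 < (1 - ε) * (1 / d) + ε * lam f a' := by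
    rw [Filter.eventually_all_finset]
    intro f _
    have hcont : Continuous fun ε : ℝ => (1 - ε) * (1 / d : ℝ) + ε * lam f a' := by fun_prop
    refine (hcont.tendsto 0).mono_left nhdsWithin_le_nhds |>.eventually (lt_mem_nhds ?_)
    simp; omega
  obtain ⟨ε, hε, hε0, hε1⟩ := (hev.and (Ioo_mem_nhdsGT (zero_lt_one' ℝ))).exists
  have hq : ∀ f : Pt d →ᵃ[ℝ] ℝ, f (AffineMap.lineMap c a' ε) = (1 - ε) * f c + ε * f a' := by
    intro f
    rw [AffineMap.apply_lineMap, AffineMap.lineMap_apply_ring]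
  set q := AffineMap.lineMap c a' ε
  have hqs : q ∈ hull s := by
    rw [hlam.mem_hull, hsF]
    intro f hf
    rw [hq]
    rcases Finset.mem_insert.1 hf with rfl | hfF
    · rw [hlam.eq_zero_of_mem_affineSpan (F := F) (by exact_mod_cast hFs) ha (by simpa using haF)
        (convexHull_subset_affineSpan _ hcF)]
      nlinarith
    · have : lam f c = 1 / d := by
        rw [hc, affineMap_sum _ _ _ _ hw, Finset.sum_eq_single f]
        · rw [hlam.apply_self f (hFs hfF)]; simp
        · intro g hg hgf
          rw [hlam.apply_of_ne f (hFs hfF) g (hFs hg) hgf.symm, smul_zero]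
        · exact fun h => absurd hfF h
      rw [this]
      exact (hε f hfF).le
  have hqt : q ∈ hull t := by
    have h1 : hull F ⊆ hull t := convexHull_mono (by exact_mod_cast hFt)
    exact (convex_convexHull ℝ _).lineMap_mem (h1 hcF) (subset_convexHull ℝ _ ha') ⟨hε0.le, hε1.le⟩
  have hqF := T.mem_hull_inter hs ht hqs hqt
  rw [hinter] at hqF
  have h1 : mu a' q = 0 := hmu.eq_zero_of_mem_affineSpan (F := F) (by exact_mod_cast hFt) ha'
    (by simpa using ha'F) (convexHull_subset_affineSpan _ hqF)
  have h2 : mu a' c = 0 := hmu.eq_zero_of_mem_affineSpan (F := F) (by exact_mod_cast hFt) ha'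
    (by simpa using ha'F) (convexHull_subset_affineSpan _ hcF)
  rw [hq, h2, hmu.apply_self a' ha'] at h1
  linarith

theorem exists_mem_notMem {s F : Finset (Pt d)} (hs : s ∈ T.cells) (hF : F.card = d) :
    ∃ a ∈ s, a ∉ F := by
  by_contra! h
  have := Finset.card_le_card (show s ⊆ F from h)
  rw [(T.mem_cells.1 hs).2] at this
  omega

/-- A facet belongs to at most two elements. -/
theorem eq_or_eq_of_facet (hd : 1 ≤ d) {s t u F : Finset (Pt d)} (hs : s ∈ T.cells)
    (ht : t ∈ T.cells) (hu : u ∈ T.cells) (hst : s ≠ t) (hF : F.card = d) (hFs : F ⊆ s)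
    (hFt : F ⊆ t) (hFu : F ⊆ u) : u = s ∨ u = t := by
  classical
  by_contra! h
  obtain ⟨hus, hut⟩ := h
  obtain ⟨lam, hlam⟩ := T.exists_isBarycentric hs
  obtain ⟨mu, hmu⟩ := T.exists_isBarycentric ht
  obtain ⟨a, ha, haF⟩ := T.exists_mem_notMem hs hF
  obtain ⟨b, hb, hbF⟩ := T.exists_mem_notMem ht hF
  obtain ⟨c, hc, hcF⟩ := T.exists_mem_notMem hu hF
  have h1 := T.barycentric_neg_of_adjacent hd hs ht hst hF hFs hFt hlam ha haF hb hbF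
  have h2 := T.barycentric_neg_of_adjacent hd hs hu hus.symm hF hFs hFu hlam ha haF hc hcF
  have h3 := T.barycentric_neg_of_adjacent hd ht hu hut.symm hF hFt hFu hmu hb hbF hc hcF
  -- Both coordinates vanish on `F`, hence are proportional.
  have htF : t = insert b F := (Finset.eq_of_subset_of_card_le
    (Finset.insert_subset hb hFt) (by rw [Finset.card_insert_of_notMem hbF, hF,
      (T.mem_cells.1 ht).2])).symm
  have h4 : lam a c = mu b c * lam a b := by
    rw [hmu.affineMap_eq (lam a) c, htF, Finset.sum_insert hbF, Finset.sum_eq_zero, add_zero,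
      smul_eq_mul]
    intro f hf
    rw [hlam.apply_of_ne a ha f (hFs hf) (by rintro rfl; exact haF hf), smul_zero]
  nlinarith

/-- Two elements that have a facet in common. -/
def Adjacent [DecidableEq (Pt d)] (s t : Finset (Pt d)) : Prop := s ≠ t ∧ (s ∩ t).card = d

theorem interior_hull_nonempty {s : Finset (Pt d)} (hs : s ∈ T.cells) :
    (interior (hull s)).Nonempty := by
  rw [interior_convexHull_nonempty_iff_affineSpan_eq_top]
  have := (T.indep (T.mem_cells.1 hs).1).affineSpan_eq_top_iff_card_eq_finrank_add_one.2
    (by simp [(T.mem_cells.1 hs).2])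
  simpa using this

/-- The elements around an interior point of the mesh are linked by facets through that point: a
generic segment close to the point avoids the faces of codimension two. -/
theorem reflTransGen_adjacent [DecidableEq (Pt d)] {z : Pt d} (hz : T.domain ∈ 𝓝 z)
    {s t : Finset (Pt d)} (hs : s ∈ T.cells) (ht : t ∈ T.cells) (hzs : z ∈ hull s) (hzt : z ∈ hull t) :
    Relation.ReflTransGen (fun a b => (b ∈ T.cells ∧ z ∈ hull b) ∧ Adjacent a b) s t := by
  classical
  obtain ⟨r, hr, hball⟩ : ∃ r > 0, Metric.ball z r ⊆
      T.domain ∩ (⋃ u ∈ T.cells.filter (fun u => z ∉ hull u), hull u)ᶜ := by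
    refine Metric.mem_nhds_iff.1 (Filter.inter_mem hz (IsOpen.mem_nhds ?_ ?_))
    · rw [isOpen_compl_iff]
      exact Set.Finite.isClosed_biUnion (Finset.finite_toSet _) fun u _ => (isCompact_hull u).isClosed
    · simp
  have hnear : ∀ x ∈ Metric.ball z r, ∃ u ∈ T.cells, z ∈ hull u ∧ x ∈ hull u := by
    intro x hx
    obtain ⟨hxd, hxc⟩ := hball hx
    obtain ⟨u, hu, hxu⟩ := mem_iUnion₂.1 hxd
    refine ⟨u, hu, ?_, hxu⟩
    by_contra hzu
    exact hxc (mem_iUnion₂.2 ⟨u, Finset.mem_filter.2 ⟨hu, hzu⟩, hxu⟩)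
  have hgen : ∀ u ∈ T.cells, z ∈ hull u → (interior (hull u) ∩ Metric.ball z r).Nonempty := by
    intro u hu hzu
    have hcl : z ∈ closure (interior (hull u)) := by
      rw [(convex_convexHull ℝ _).closure_interior_eq_closure_of_nonempty_interior
        (T.interior_hull_nonempty hu)]
      exact subset_closure hzu
    rw [inter_comm]
    exact mem_closure_iff.1 hcl _ Metric.isOpen_ball (Metric.mem_ball_self hr)
  -- The end points `y` and `q` are chosen such that the segment between them misses every face of
  -- dimension at most `d - 2`: `y` is on none of them, nor is `q` on the join of one with `y`.
  obtain ⟨y, ⟨hys, hyz⟩, hy⟩ := exists_mem_forall_notMem_affineSpan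
    (isOpen_interior.inter Metric.isOpen_ball) (hgen s hs hzs)
    (T.finite_faces.subset (sep_subset T.faces (fun F => F.card < d))) (fun F hF => hF.2.le)
  obtain ⟨q, ⟨hqt, hqz⟩, hq⟩ := exists_mem_forall_notMem_affineSpan
    (isOpen_interior.inter Metric.isOpen_ball) (hgen t ht hzt)
    ((T.finite_faces.subset (sep_subset T.faces (fun F => F.card < d))).image (insert y))
    (by
      rintro _ ⟨F, hF, rfl⟩
      exact (Finset.card_insert_le _ _).trans hF.2)
  set R := fun a b : Finset (Pt d) => (b ∈ T.cells ∧ z ∈ hull b) ∧ Adjacent a b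
  -- The elements linked to `s` and the others are closed sets covering the segment, so they meet on it.
  by_contra hcon
  set A := ⋃ u ∈ T.cells.filter (fun u => z ∈ hull u ∧ Relation.ReflTransGen R s u), hull u
  set A' := ⋃ u ∈ T.cells.filter (fun u => z ∈ hull u ∧ ¬ Relation.ReflTransGen R s u), hull u
  have hA : IsClosed A :=
    Set.Finite.isClosed_biUnion (Finset.finite_toSet _) fun u _ => (isCompact_hull u).isClosed
  have hA' : IsClosed A' :=
    Set.Finite.isClosed_biUnion (Finset.finite_toSet _) fun u _ => (isCompact_hull u).isClosed
  obtain ⟨x, hx, hxA, hxA'⟩ := isPreconnected_closed_iff.1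
    (convex_segment y q).isPreconnected A A' hA hA' (by
      intro x hx
      obtain ⟨u, hu, hzu, hxu⟩ := hnear x ((convex_ball z r).segment_subset hyz hqz hx)
      by_cases h : Relation.ReflTransGen R s u
      · exact Or.inl (mem_iUnion₂.2 ⟨u, Finset.mem_filter.2 ⟨hu, hzu, h⟩, hxu⟩)
      · exact Or.inr (mem_iUnion₂.2 ⟨u, Finset.mem_filter.2 ⟨hu, hzu, h⟩, hxu⟩))
    ⟨y, left_mem_segment ℝ y q, mem_iUnion₂.2 ⟨s, Finset.mem_filter.2 ⟨hs, hzs, .refl⟩,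
      interior_subset hys⟩⟩
    ⟨q, right_mem_segment ℝ y q, mem_iUnion₂.2 ⟨t, Finset.mem_filter.2 ⟨ht, hzt, hcon⟩,
      interior_subset hqt⟩⟩
  obtain ⟨u, hu, hxu⟩ := mem_iUnion₂.1 hxA
  obtain ⟨w, hw, hxw⟩ := mem_iUnion₂.1 hxA'
  obtain ⟨hu, hzu, hsu⟩ := Finset.mem_filter.1 hu
  obtain ⟨hw, hzw, hsw⟩ := Finset.mem_filter.1 hw
  have huw : u ≠ w := by rintro rfl; exact hsw hsu
  have hxF := T.mem_hull_inter hu hw hxu hxw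
  have hcard : (u ∩ w).card ≠ d := fun h => hsw (hsu.tail ⟨⟨hw, hzw⟩, huw, h⟩)
  have hlt : (u ∩ w).card < d := lt_of_le_of_ne (T.card_inter_le hu hw huw) hcard
  have hFne : (u ∩ w).Nonempty := by
    rw [← Finset.coe_nonempty]; exact convexHull_nonempty_iff.1 ⟨x, hxF⟩
  have hF : u ∩ w ∈ {F ∈ T.faces | F.card < d} :=
    ⟨T.down_closed (T.mem_cells.1 hu).1 Finset.inter_subset_left hFne, hlt⟩
  have hxsp := convexHull_subset_affineSpan _ hxF
  rw [segment_eq_image_lineMap] at hx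
  obtain ⟨θ, hθ, rfl⟩ := hx
  rcases eq_or_ne θ 0 with rfl | hθ0
  · rw [AffineMap.lineMap_apply_zero] at hxsp
    exact hy _ hF hxsp
  · refine hq _ (mem_image_of_mem _ hF) ?_
    have h1 : AffineMap.lineMap y q θ ∈ affineSpan ℝ ((insert y (u ∩ w) : Finset (Pt d)) : Set (Pt d)) :=
      affineSpan_mono ℝ (by simp) hxsp
    have h2 : y ∈ affineSpan ℝ ((insert y (u ∩ w) : Finset (Pt d)) : Set (Pt d)) :=
      subset_affineSpan ℝ _ (by simp)
    have h3 := AffineMap.lineMap_mem (θ⁻¹) h2 h1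
    rwa [AffineMap.lineMap_lineMap_right, inv_mul_cancel₀ hθ0, AffineMap.lineMap_apply_one] at h3

end Mesh

/-! ### Areas of plane pieces and of facets -/

/-- The area of a disk in a hyperplane. -/
theorem euclideanHausdorffMeasure_disk (hd : 1 ≤ d) {ν : Pt d} (hν : ν ≠ 0) (c : Pt d) {r : ℝ}
    (hr : 0 ≤ r) : μHE[d - 1] {x : Pt d | ⟪ν, x - c⟫ = 0 ∧ ‖x - c‖ ≤ r} =
      ENNReal.ofReal (r ^ (d - 1) * volume.real (Metric.ball (0 : Pt (d - 1)) 1)) := by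
  obtain ⟨n, rfl⟩ : ∃ n, d = n + 1 := ⟨d - 1, by omega⟩
  simp only [Nat.add_sub_cancel]
  have : Fact (Module.finrank ℝ (Pt (n + 1)) = n + 1) := ⟨finrank_euclideanSpace_fin⟩
  let e := (OrthonormalBasis.fromOrthogonalSpanSingleton (𝕜 := ℝ) n hν).repr.symm
  let f : Pt n → Pt (n + 1) := fun y => (e y : Pt (n + 1)) + c
  have hf : Isometry f := by
    refine Isometry.of_dist_eq fun x y => ?_
    simp only [f, dist_add_right]
    exact e.dist_map x y
  have himg : {x : Pt (n + 1) | ⟪ν, x - c⟫ = 0 ∧ ‖x - c‖ ≤ r} = f '' Metric.closedBall 0 r := by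
    ext x
    constructor
    · rintro ⟨h1, h2⟩
      have hmem : x - c ∈ (Submodule.span ℝ {ν})ᗮ := Submodule.mem_orthogonal_singleton_iff_inner_right.2 h1
      refine ⟨e.symm ⟨x - c, hmem⟩, ?_, ?_⟩
      · rw [mem_closedBall_zero_iff, e.symm.norm_map]
        exact h2
      · simp [f]
    · rintro ⟨y, hy, rfl⟩
      rw [mem_closedBall_zero_iff] at hy
      have h1 := Submodule.mem_orthogonal_singleton_iff_inner_right.1 (e y).2
      constructor
      · simpa [f] using h1
      · have h2 : ‖(e y : Pt (n + 1))‖ = ‖y‖ := e.norm_map y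
        simpa [f, h2] using hy
  rw [himg, hf.euclideanHausdorffMeasure_image, EuclideanSpace.euclideanHausdorffMeasure_eq_volume,
    volume_closedBall_eq _ hr]

/-- `n` is orthogonal to the affine span of `F`. -/
def IsNormalTo (F : Finset (Pt d)) (n : Pt d) : Prop := ∀ x ∈ F, ∀ y ∈ F, ⟪n, x - y⟫ = 0

namespace IsBarycentric
variable {s F : Finset (Pt d)} {lam : Pt d → Pt d →ᵃ[ℝ] ℝ} {a : Pt d}

theorem eq_insert_of_facet [DecidableEq (Pt d)] (hs : s.card = d + 1) (hF : F.card = d) (hFs : F ⊆ s)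
    (ha : a ∈ s) (haF : a ∉ F) : s = insert a F :=
  (Finset.eq_of_subset_of_card_le (Finset.insert_subset ha hFs)
    (by rw [Finset.card_insert_of_notMem haF, hF, hs])).symm

/-- A functional orthogonal to a facet is a multiple of the opposite barycentric coordinate, up to
a constant. -/
theorem inner_sub_eq (h : IsBarycentric s lam) (hs : s.card = d + 1) (hF : F.card = d)
    (hFs : F ⊆ s) (ha : a ∈ s) (haF : a ∉ F) {n : Pt d} (hn : IsNormalTo F n) {f : Pt d} (hf : f ∈ F)
    (x : Pt d) : ⟪n, x - f⟫ = lam a x * ⟪n, a - f⟫ := by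
  classical
  have h1 := h.affineMap_eq ((innerSL ℝ n).toLinearMap.toAffineMap - AffineMap.const ℝ _ ⟪n, f⟫) x
  rw [eq_insert_of_facet hs hF hFs ha haF, Finset.sum_insert haF, Finset.sum_eq_zero, add_zero] at h1
  · simpa [inner_sub_right] using h1
  · intro b hb
    have := hn b hb f hf
    rw [inner_sub_right] at this
    simp [this]

theorem inner_ne_zero (h : IsBarycentric s lam) (hs : s.card = d + 1) (hF : F.card = d)
    (hFs : F ⊆ s) (ha : a ∈ s) (haF : a ∉ F) {n : Pt d} (hn : IsNormalTo F n) (hn0 : n ≠ 0)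
    {f : Pt d} (hf : f ∈ F) : ⟪n, a - f⟫ ≠ 0 := by
  intro h0
  have := h.inner_sub_eq hs hF hFs ha haF hn hf (f + n)
  rw [h0, mul_zero, add_sub_cancel_left, inner_self_eq_zero] at this
  exact hn0 this

theorem exists_isNormalTo (h : IsBarycentric s lam) (hd : 1 ≤ d) (hF : F.card = d)
    (hFs : F ⊆ s) (ha : a ∈ s) (haF : a ∉ F) : ∃ n, ‖n‖ = 1 ∧ IsNormalTo F n := by
  set g := (InnerProductSpace.toDual ℝ (Pt d)).symm (lam a).linear.toContinuousLinearMap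
  have hg : ∀ x y, ⟪g, x - y⟫ = lam a x - lam a y := by
    intro x y
    rw [InnerProductSpace.toDual_symm_apply, ← vsub_eq_sub x y]
    exact (lam a).linearMap_vsub x y
  obtain ⟨f, hf⟩ : F.Nonempty := Finset.card_pos.1 (by omega)
  have h0 : ∀ f ∈ F, lam a f = 0 := fun f hf =>
    h.apply_of_ne a ha f (hFs hf) (by rintro rfl; exact haF hf)
  have hg0 : g ≠ 0 := by
    intro h1
    have := hg a f
    rw [h1, h.apply_self a ha, h0 f hf] at this
    simp at this
  refine ⟨‖g‖⁻¹ • g, by simp [norm_smul, hg0], fun x hx y hy => ?_⟩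
  rw [inner_smul_left, hg, h0 x hx, h0 y hy]
  simp

theorem exists_eq_smul (h : IsBarycentric s lam) (hd : 1 ≤ d) (hs : s.card = d + 1)
    (hF : F.card = d) (hFs : F ⊆ s) (ha : a ∈ s) (haF : a ∉ F) {n G : Pt d} (hn : IsNormalTo F n)
    (hn0 : n ≠ 0) (hG : IsNormalTo F G) : ∃ c : ℝ, G = c • n := by
  obtain ⟨f, hf⟩ : F.Nonempty := Finset.card_pos.1 (by omega)
  refine ⟨⟪G, a - f⟫ / ⟪n, a - f⟫, ext_inner_right ℝ fun w => ?_⟩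
  have h1 := h.inner_sub_eq hs hF hFs ha haF hn hf (f + w)
  have h2 := h.inner_sub_eq hs hF hFs ha haF hG hf (f + w)
  have h3 := h.inner_ne_zero hs hF hFs ha haF hn hn0 hf
  rw [add_sub_cancel_left] at h1 h2
  rw [h2, inner_smul_left, h1]
  simp only [conj_trivial]
  field_simp

theorem isNormalTo_mem_hull {n : Pt d} (hn : IsNormalTo F n) {x y : Pt d} (hx : x ∈ hull F)
    (hy : y ∈ hull F) : ⟪n, x - y⟫ = 0 := by
  have hne : F.Nonempty := by
    rw [← Finset.coe_nonempty]; exact convexHull_nonempty_iff.1 ⟨x, hx⟩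
  obtain ⟨f, hf⟩ := hne
  have hsub : hull F ⊆ {z | ⟪n, z - f⟫ = 0} := by
    refine convexHull_min (fun z hz => hn z hz f hf) ?_
    have : {z | ⟪n, z - f⟫ = 0} = {z | (innerSL ℝ n) z = ⟪n, f⟫} := by
      ext z; simp [inner_sub_right, sub_eq_zero]
    rw [this]
    exact convex_hyperplane (innerSL ℝ n).toLinearMap.isLinear ⟪n, f⟫
  have h1 : ⟪n, x - f⟫ = 0 := hsub hx
  have h2 : ⟪n, y - f⟫ = 0 := hsub hy
  have : x - y = (x - f) - (y - f) := by abel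
  rw [this, inner_sub_right, h1, h2, sub_zero]

/-- A facet of a simplex contains a disk of the same radius as any ball in the simplex, by central
projection from the opposite vertex. -/
theorem exists_disk_subset_hull (h : IsBarycentric s lam) (hd : 1 ≤ d) (hs : s.card = d + 1)
    (hF : F.card = d) (hFs : F ⊆ s) (ha : a ∈ s) (haF : a ∉ F) {n : Pt d} (hn : IsNormalTo F n)
    (hn0 : n ≠ 0) {c : Pt d} {r : ℝ} (hr : 0 < r) (hball : Metric.closedBall c r ⊆ hull s) :
    ∃ c', {x | ⟪n, x - c'⟫ = 0 ∧ ‖x - c'‖ ≤ r} ⊆ hull F := by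
  classical
  obtain ⟨f, hf⟩ : F.Nonempty := Finset.card_pos.1 (by omega)
  have hsF := eq_insert_of_facet hs hF hFs ha haF
  have hint : ∀ b ∈ s, 0 < lam b c := (h.mem_interior c).1
    (interior_mono (Metric.ball_subset_closedBall.trans hball)
      (by rw [Metric.isOpen_ball.interior_eq]; exact Metric.mem_ball_self hr))
  set t := lam a c with ht
  have ht0 : 0 < t := hint a ha
  have ht1 : t < 1 := by
    have h1 := h.sum_eq_one c
    rw [hsF, Finset.sum_insert haF] at h1
    have h2 := Finset.single_le_sum (f := fun b => lam b c) (fun b hb => (hint b (hFs hb)).le) hf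
    have h3 := hint f (hFs hf)
    linarith
  have h1t : 0 < 1 - t := by linarith
  refine ⟨AffineMap.lineMap a c (1 - t)⁻¹, ?_⟩
  set c' := AffineMap.lineMap a c (1 - t)⁻¹ with hc'
  have hlc' : lam a c' = 0 := by
    rw [hc', AffineMap.apply_lineMap, AffineMap.lineMap_apply_ring, h.apply_self a ha, ← ht]
    field_simp; ring
  rintro x ⟨hx1, hx2⟩
  have hlx : lam a x = 0 := by
    have e1 := h.inner_sub_eq hs hF hFs ha haF hn hf x
    have e2 := h.inner_sub_eq hs hF hFs ha haF hn hf c'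
    have e3 := h.inner_ne_zero hs hF hFs ha haF hn hn0 hf
    rw [hlc', zero_mul] at e2
    have : x - f = (x - c') + (c' - f) := by abel
    rw [this, inner_add_right, hx1, e2, add_zero] at e1
    simpa [e3] using e1.symm
  have hp : AffineMap.lineMap a x (1 - t) ∈ hull s := by
    apply hball
    have : AffineMap.lineMap a x (1 - t) - c = (1 - t) • (x - c') := by
      rw [hc', AffineMap.lineMap_apply_module', AffineMap.lineMap_apply_module']
      rw [smul_sub, smul_sub, smul_add, smul_smul, mul_inv_cancel₀ h1t.ne']
      module
    rw [mem_closedBall_iff_norm, this, norm_smul, Real.norm_of_nonneg h1t.le]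
    nlinarith [norm_nonneg (x - c')]
  have hlf : ∀ b ∈ F, 0 ≤ lam b x := by
    intro b hb
    have h1 := (h.mem_hull _).1 hp b (hFs hb)
    rw [AffineMap.apply_lineMap, AffineMap.lineMap_apply_ring,
      h.apply_of_ne b (hFs hb) a ha (by rintro rfl; exact haF hb), mul_zero, zero_add] at h1
    exact nonneg_of_mul_nonneg_right h1 h1t
  have hsum := h.sum_eq_one x
  have hsmul := h.sum_smul x
  rw [hsF, Finset.sum_insert haF, hlx] at hsum hsmul
  rw [zero_add] at hsum
  rw [zero_smul, zero_add] at hsmul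
  rw [← hsmul]
  exact (convex_convexHull ℝ _).sum_mem hlf hsum fun b hb => subset_convexHull ℝ _ hb

/-- A facet has at least the area of a disk with the radius of a ball in the simplex. -/
theorem le_measure_facet (h : IsBarycentric s lam) (hd : 1 ≤ d) (hs : s.card = d + 1)
    (hF : F.card = d) (hFs : F ⊆ s) (ha : a ∈ s) (haF : a ∉ F) {c : Pt d} {r : ℝ} (hr : 0 < r)
    (hball : Metric.closedBall c r ⊆ hull s) :
    r ^ (d - 1) * volume.real (Metric.ball (0 : Pt (d - 1)) 1) ≤
      (μHE[d - 1] : Measure (Pt d)).real (hull F) := by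
  obtain ⟨n, hn1, hn⟩ := h.exists_isNormalTo hd hF hFs ha haF
  have hn0 : n ≠ 0 := by rintro rfl; simp at hn1
  obtain ⟨c', hc'⟩ := h.exists_disk_subset_hull hd hs hF hFs ha haF hn hn0 hr hball
  obtain ⟨f, hf⟩ : F.Nonempty := Finset.card_pos.1 (by omega)
  have hfin : (μHE[d - 1] : Measure (Pt d)) (hull F) ≠ ⊤ := by
    obtain ⟨R, hR⟩ := (Mesh.isCompact_hull F).isBounded.subset_closedBall f
    have hsub : hull F ⊆ {x | ⟪n, x - f⟫ = 0 ∧ ‖x - f‖ ≤ R} := fun x hx =>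
      ⟨isNormalTo_mem_hull hn hx (subset_convexHull ℝ _ hf), mem_closedBall_iff_norm.1 (hR hx)⟩
    have hR0 : 0 ≤ R := by simpa using (hsub (subset_convexHull ℝ _ hf)).2
    refine measure_ne_top_of_subset hsub ?_
    rw [euclideanHausdorffMeasure_disk hd hn0 f hR0]
    exact ENNReal.ofReal_ne_top
  refine (ENNReal.ofReal_le_iff_le_toReal hfin).1 ?_
  rw [← euclideanHausdorffMeasure_disk hd hn0 c' hr.le]
  exact measure_mono hc'

end IsBarycentric

/-! ### Gradients, jumps and the stabilization -/

namespace Mesh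
variable {T : Mesh d} {ρh : Pt d → ℝ}

theorem gradientWithin_hull {s : Finset (Pt d)} (hs : s ∈ T.cells) {v : Pt d → ℝ} {g : Pt d} {b : ℝ}
    (hv : ∀ x ∈ hull s, v x = ⟪g, x⟫ + b) {x : Pt d} (hx : x ∈ hull s) :
    gradientWithin v (hull s) x = g := by
  have h1 : HasFDerivWithinAt (fun x => ⟪g, x⟫ + b) (innerSL ℝ g) (hull s) x :=
    ((innerSL ℝ g).hasFDerivAt.add_const b).hasFDerivWithinAt
  have h2 : HasFDerivWithinAt v (innerSL ℝ g) (hull s) x := h1.congr hv (hv x hx)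
  have h3 := h2.fderivWithin (uniqueDiffOn_convex (convex_convexHull ℝ _)
    (T.interior_hull_nonempty hs) x hx)
  rw [gradientWithin, h3]
  exact (InnerProductSpace.toDual ℝ (Pt d)).symm_apply_apply g

open scoped Classical in
theorem cutCells_subset : T.cutCells ρh ⊆ T.cells := Finset.filter_subset _ _

open scoped Classical in
theorem mem_cutCells_of_mem {s : Finset (Pt d)} (hs : s ∈ T.cells) {x : Pt d} (hx : x ∈ hull s)
    (hxS : x ∈ T.surface ρh) : s ∈ T.cutCells ρh :=
  Finset.mem_filter.2 ⟨hs, x, hx, hxS⟩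

/-- `v` is affine with gradient `g s` on each cut element `s`. -/
def IsPiecewiseAffine (T : Mesh d) (ρh v : Pt d → ℝ) (g : Finset (Pt d) → Pt d)
    (b : Finset (Pt d) → ℝ) : Prop :=
  ∀ s ∈ T.cutCells ρh, ∀ x ∈ hull s, v x = ⟪g s, x⟫ + b s

theorem exists_isPiecewiseAffine {v : Pt d → ℝ} (hv : v ∈ T.V ρh) :
    ∃ g b, T.IsPiecewiseAffine ρh v g b := by
  obtain ⟨⟨w, ⟨-, hw⟩, hvw⟩, -⟩ := hv
  choose! g b hgb using hw
  exact ⟨g, b, fun s hs x hx => by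
    rw [hvw (mem_iUnion₂.2 ⟨s, hs, hx⟩), hgb s (cutCells_subset hs) x hx]⟩

open scoped Classical in
/-- The ordered pairs of cut elements that share a facet. -/
def adjacentPairs (T : Mesh d) (ρh : Pt d → ℝ) : Finset (Finset (Pt d) × Finset (Pt d)) :=
  (T.cutCells ρh).offDiag.filter fun q => (q.1 ∩ q.2).card = d

open scoped Classical in
theorem mem_adjacentPairs {q : Finset (Pt d) × Finset (Pt d)} : q ∈ T.adjacentPairs ρh ↔
    q.1 ∈ T.cutCells ρh ∧ q.2 ∈ T.cutCells ρh ∧ q.1 ≠ q.2 ∧ (q.1 ∩ q.2).card = d := by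
  simp [adjacentPairs, and_assoc]

open scoped Classical in
/-- By continuity, the gradients on two elements differ by a vector normal to the common face. -/
theorem IsPiecewiseAffine.isNormalTo_sub {v : Pt d → ℝ} {g : Finset (Pt d) → Pt d}
    {b : Finset (Pt d) → ℝ} (hv : T.IsPiecewiseAffine ρh v g b) {s t : Finset (Pt d)}
    (hs : s ∈ T.cutCells ρh) (ht : t ∈ T.cutCells ρh) : IsNormalTo (s ∩ t) (g s - g t) := by
  intro x hx y hy
  have hx' := Finset.mem_inter.1 hx
  have hy' := Finset.mem_inter.1 hy
  have h1 := hv s hs x (subset_convexHull ℝ _ hx'.1)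
  have h2 := hv t ht x (subset_convexHull ℝ _ hx'.2)
  have h3 := hv s hs y (subset_convexHull ℝ _ hy'.1)
  have h4 := hv t ht y (subset_convexHull ℝ _ hy'.2)
  rw [inner_sub_right, inner_sub_left, inner_sub_left]
  linarith

open scoped Classical in
/-- The elements chosen on the two sides of an interface are the two elements that contain it. -/
theorem neighbours_eq (hd : 1 ≤ d) {q : Finset (Pt d) × Finset (Pt d)}
    (hq : q ∈ T.adjacentPairs ρh) : T.neighbours ρh (q.1 ∩ q.2) = q ∨
      T.neighbours ρh (q.1 ∩ q.2) = q.swap := by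
  obtain ⟨h1, h2, hne, hcard⟩ := mem_adjacentPairs.1 hq
  have hspec : T.neighbours ρh (q.1 ∩ q.2) ∈ (T.cutCells ρh).offDiag ∧
      (T.neighbours ρh (q.1 ∩ q.2)).1 ∩ (T.neighbours ρh (q.1 ∩ q.2)).2 = q.1 ∩ q.2 :=
    Classical.epsilon_spec (p := fun p => p ∈ (T.cutCells ρh).offDiag ∧ p.1 ∩ p.2 = q.1 ∩ q.2)
      ⟨q, Finset.mem_offDiag.2 ⟨h1, h2, hne⟩, rfl⟩
  generalize T.neighbours ρh (q.1 ∩ q.2) = p at hspec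
  obtain ⟨hp, hpF⟩ := hspec
  obtain ⟨p1, p2, hpne⟩ := Finset.mem_offDiag.1 hp
  have e1 := T.eq_or_eq_of_facet hd (cutCells_subset h1) (cutCells_subset h2) (cutCells_subset p1)
    hne hcard Finset.inter_subset_left Finset.inter_subset_right
    (by rw [← hpF]; exact Finset.inter_subset_left)
  have e2 := T.eq_or_eq_of_facet hd (cutCells_subset h1) (cutCells_subset h2) (cutCells_subset p2)
    hne hcard Finset.inter_subset_left Finset.inter_subset_right
    (by rw [← hpF]; exact Finset.inter_subset_right)
  obtain ⟨q1, q2⟩ := q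
  obtain ⟨p1', p2'⟩ := p
  simp only [Prod.mk.injEq, Prod.swap_prod_mk] at *
  rcases e1 with rfl | rfl <;> rcases e2 with rfl | rfl <;> simp_all

open scoped Classical in
/-- The jump of the normal derivative is the jump of the full gradient, since the latter is normal to
the facet. -/
theorem normalJump_sq_eq (hd : 1 ≤ d) {v : Pt d → ℝ} {g : Finset (Pt d) → Pt d}
    {b : Finset (Pt d) → ℝ} (hv : T.IsPiecewiseAffine ρh v g b)
    {q : Finset (Pt d) × Finset (Pt d)} (hq : q ∈ T.adjacentPairs ρh) {x : Pt d}
    (hx : x ∈ hull (q.1 ∩ q.2)) :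
    T.normalJump ρh v (q.1 ∩ q.2) x ^ 2 = ‖g q.1 - g q.2‖ ^ 2 := by
  obtain ⟨h1, h2, hne, hcard⟩ := mem_adjacentPairs.1 hq
  have hx1 : x ∈ hull q.1 := convexHull_mono (by simp) hx
  have hx2 : x ∈ hull q.2 := convexHull_mono (by simp) hx
  obtain ⟨lam, hlam⟩ := T.exists_isBarycentric (cutCells_subset h1)
  obtain ⟨a, ha, haF⟩ := T.exists_mem_notMem (cutCells_subset h1) hcard
  have hn : ‖faceNormal (q.1 ∩ q.2)‖ = 1 ∧ IsNormalTo (q.1 ∩ q.2) (faceNormal (q.1 ∩ q.2)) :=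
    Classical.epsilon_spec (p := fun ν => ‖ν‖ = 1 ∧ ∀ x ∈ q.1 ∩ q.2, ∀ y ∈ q.1 ∩ q.2, ⟪ν, x - y⟫ = 0)
      (hlam.exists_isNormalTo hd hcard Finset.inter_subset_left ha haF)
  have hn0 : faceNormal (q.1 ∩ q.2) ≠ 0 := fun h => by simpa [h] using hn.1
  obtain ⟨c, hc⟩ := hlam.exists_eq_smul hd (T.mem_cells.1 (cutCells_subset h1)).2 hcard
    Finset.inter_subset_left ha haF hn.2 hn0 (hv.isNormalTo_sub h1 h2)
  have hG : ⟪faceNormal (q.1 ∩ q.2), g q.1 - g q.2⟫ ^ 2 = ‖g q.1 - g q.2‖ ^ 2 := by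
    rw [hc, inner_smul_right, real_inner_self_eq_norm_sq, norm_smul, hn.1]
    simp
  rw [← hG, normalJump]
  rcases neighbours_eq hd hq with h | h <;> rw [h]
  · rw [gradientWithin_hull (cutCells_subset h1) (hv _ h1) hx1,
      gradientWithin_hull (cutCells_subset h2) (hv _ h2) hx2, inner_sub_right]
  · rw [Prod.fst_swap, Prod.snd_swap, gradientWithin_hull (cutCells_subset h1) (hv _ h1) hx1,
      gradientWithin_hull (cutCells_subset h2) (hv _ h2) hx2, inner_sub_right]
    ring

theorem stabilization_nonneg {τ₀ : ℝ} (hτ₀ : 0 < τ₀) (v : Pt d → ℝ) :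
    0 ≤ T.stabilization τ₀ ρh v :=
  Finset.sum_nonneg fun _ _ => integral_nonneg fun _ => by positivity

theorem IsQuasiUniform.pos {σ h : ℝ} (hT : T.IsQuasiUniform σ h) (hh : 0 < h) {s : Finset (Pt d)}
    (hs : s ∈ T.cells) : 0 < σ := by
  obtain ⟨-, h2, -⟩ := hT s hs
  by_contra! hσ
  nlinarith [Metric.diam_nonneg (s := hull s)]

theorem IsQuasiUniform.exists_closedBall_subset {σ h : ℝ} (hT : T.IsQuasiUniform σ h) (hh : 0 < h)
    {s : Finset (Pt d)} (hs : s ∈ T.cells) : ∃ c, Metric.closedBall c (h / σ ^ 2) ⊆ hull s := by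
  have hσ := hT.pos hh hs
  obtain ⟨-, h2, c, hc⟩ := hT s hs
  refine ⟨c, (Metric.closedBall_subset_closedBall ?_).trans hc⟩
  rw [div_le_div_iff₀ (by positivity) hσ]
  nlinarith

open scoped Classical in
/-- The stabilization controls the sum of the squared jumps of the full gradient. -/
theorem sum_jump_le_stabilization (hd : 1 ≤ d) {σ h τ₀ : ℝ} (hT : T.IsQuasiUniform σ h) (hh : 0 < h)
    (hτ₀ : 0 < τ₀) {v : Pt d → ℝ} {g : Finset (Pt d) → Pt d} {b : Finset (Pt d) → ℝ}
    (hv : T.IsPiecewiseAffine ρh v g b) :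
    τ₀ * ((h / σ ^ 2) ^ (d - 1) * volume.real (Metric.ball (0 : Pt (d - 1)) 1)) *
      ∑ q ∈ T.adjacentPairs ρh, ‖g q.1 - g q.2‖ ^ 2 ≤ 2 * T.stabilization τ₀ ρh v := by
  set κ := (h / σ ^ 2) ^ (d - 1) * volume.real (Metric.ball (0 : Pt (d - 1)) 1) with hκ
  have hmaps : ∀ q ∈ T.adjacentPairs ρh, q.1 ∩ q.2 ∈ T.interfaces ρh := by
    intro q hq
    obtain ⟨h1, h2, hne, hcard⟩ := mem_adjacentPairs.1 hq
    exact Finset.mem_filter.2 ⟨Finset.mem_image.2 ⟨q, Finset.mem_offDiag.2 ⟨h1, h2, hne⟩, rfl⟩, hcard⟩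
  rw [stabilization, ← Finset.sum_fiberwise_of_maps_to hmaps, Finset.mul_sum, Finset.mul_sum]
  refine Finset.sum_le_sum fun F hF => ?_
  obtain ⟨hF1, hFcard⟩ := Finset.mem_filter.1 hF
  obtain ⟨q, hq, rfl⟩ := Finset.mem_image.1 hF1
  obtain ⟨h1, h2, hne⟩ := Finset.mem_offDiag.1 hq
  have hqa : q ∈ T.adjacentPairs ρh := mem_adjacentPairs.2 ⟨h1, h2, hne, hFcard⟩
  have hint : ∫ x in hull (q.1 ∩ q.2), τ₀ * T.normalJump ρh v (q.1 ∩ q.2) x ^ 2 ∂μHE[d - 1] =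
      τ₀ * ‖g q.1 - g q.2‖ ^ 2 * (μHE[d - 1] : Measure (Pt d)).real (hull (q.1 ∩ q.2)) := by
    rw [setIntegral_congr_fun (g := fun _ => τ₀ * ‖g q.1 - g q.2‖ ^ 2)
      (isCompact_hull _).measurableSet
      (fun x hx => by simp only; rw [normalJump_sq_eq hd hv hqa hx])]
    rw [setIntegral_const, smul_eq_mul, mul_comm]
  rw [hint]
  obtain ⟨lam, hlam⟩ := T.exists_isBarycentric (cutCells_subset h1)
  obtain ⟨a, ha, haF⟩ := T.exists_mem_notMem (cutCells_subset h1) hFcard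
  obtain ⟨c, hc⟩ := hT.exists_closedBall_subset hh (cutCells_subset h1)
  have hσ := hT.pos hh (cutCells_subset h1)
  have hmeas := hlam.le_measure_facet hd (T.mem_cells.1 (cutCells_subset h1)).2 hFcard
    Finset.inter_subset_left ha haF (by positivity) hc
  have hfib : ∑ p ∈ T.adjacentPairs ρh with p.1 ∩ p.2 = q.1 ∩ q.2, ‖g p.1 - g p.2‖ ^ 2 ≤
      ∑ p ∈ {q, q.swap}, ‖g p.1 - g p.2‖ ^ 2 := by
    refine Finset.sum_le_sum_of_subset_of_nonneg (fun p hp => ?_) fun _ _ _ => by positivity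
    obtain ⟨hp, hpq⟩ := Finset.mem_filter.1 hp
    have e1 := neighbours_eq hd hp
    have e2 := neighbours_eq hd hqa
    rw [hpq] at e1
    rw [Finset.mem_insert, Finset.mem_singleton]
    rcases e1 with e1 | e1 <;> rcases e2 with e2 | e2 <;> rw [e1] at e2
    · exact Or.inl e2
    · exact Or.inr e2
    · right; rw [← e2, Prod.swap_swap]
    · left; exact Prod.swap_injective e2
  have hfib2 : ∑ p ∈ ({q, q.swap} : Finset _), ‖g p.1 - g p.2‖ ^ 2 ≤ 2 * ‖g q.1 - g q.2‖ ^ 2 := by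
    rw [Finset.sum_pair (fun h => hne (by have := congrArg Prod.fst h; simpa using this)),
      Prod.fst_swap, Prod.snd_swap, norm_sub_rev (g q.2)]
    linarith
  calc _ ≤ τ₀ * κ * (2 * ‖g q.1 - g q.2‖ ^ 2) := by
        gcongr
        exact hfib.trans hfib2
    _ = 2 * (τ₀ * ‖g q.1 - g q.2‖ ^ 2 * κ) := by ring
    _ ≤ _ := by gcongr

end Mesh

/-! ### Chains of elements -/

/-- In a graph, the difference of the values of a function at two connected vertices is at most the
sum of the differences over all edges, since a path uses each edge once. -/
theorem norm_sub_le_sum_of_reflTransGen {V E : Type*} [DecidableEq V] [SeminormedAddCommGroup E]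
    {r : V → V → Prop} (hr : ∀ a b, r a b → r b a) (hne : ∀ a b, r a b → a ≠ b) {P : Finset (V × V)}
    (hP : ∀ a b, r a b → (a, b) ∈ P) (Q : V → E) {s t : V} (hst : Relation.ReflTransGen r s t) :
    ‖Q s - Q t‖ ≤ ∑ q ∈ P, ‖Q q.1 - Q q.2‖ := by
  let G : SimpleGraph V := ⟨r, ⟨fun a b => hr a b⟩, ⟨fun a h => hne a a h rfl⟩⟩
  have hreach : G.Reachable s t := (SimpleGraph.reachable_iff_reflTransGen s t).2 hst
  obtain ⟨p, hp⟩ := hreach.exists_isPath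
  have h1 : ∀ {a b : V} (p : G.Walk a b),
      ‖Q a - Q b‖ ≤ (p.darts.map fun e => ‖Q e.fst - Q e.snd‖).sum := by
    intro a b p
    induction p with
    | nil => simp
    | @cons a c b hac p ih =>
      rw [SimpleGraph.Walk.darts_cons, List.map_cons, List.sum_cons]
      refine le_trans ?_ (add_le_add_right ih _)
      simpa using norm_sub_le_norm_sub_add_norm_sub (Q a) (Q c) (Q b)
  refine (h1 p).trans ?_
  have hnd : (p.darts.map fun e => e.toProd).Nodup :=
    (p.darts_nodup_of_support_nodup hp.support_nodup).map SimpleGraph.Dart.toProd_injective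
  have h2 : (p.darts.map fun e => ‖Q e.fst - Q e.snd‖) =
      (p.darts.map fun e => e.toProd).map fun q => ‖Q q.1 - Q q.2‖ := by
    rw [List.map_map]; rfl
  rw [h2, ← List.sum_toFinset _ hnd]
  refine Finset.sum_le_sum_of_subset_of_nonneg (fun q hq => ?_) fun _ _ _ => norm_nonneg _
  obtain ⟨e, -, rfl⟩ := List.mem_map.1 (List.mem_toFinset.1 hq)
  exact hP _ _ e.adj

namespace Mesh
variable {T : Mesh d} {ρh : Pt d → ℝ}

open scoped Classical in
/-- The cut elements that meet the ball of radius `R` around `z`. -/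
def nearCells (T : Mesh d) (ρh : Pt d → ℝ) (z : Pt d) (R : ℝ) : Finset (Finset (Pt d)) :=
  (T.cutCells ρh).filter fun s => (hull s ∩ Metric.closedBall z R).Nonempty

open scoped Classical in
/-- The adjacent pairs of cut elements that both meet the ball of radius `R` around `z`. -/
def nearPairs (T : Mesh d) (ρh : Pt d → ℝ) (z : Pt d) (R : ℝ) :
    Finset (Finset (Pt d) × Finset (Pt d)) :=
  (T.adjacentPairs ρh).filter fun q => q.1 ∈ T.nearCells ρh z R ∧ q.2 ∈ T.nearCells ρh z R

theorem mem_nearCells {z : Pt d} {R : ℝ} {s : Finset (Pt d)} : s ∈ T.nearCells ρh z R ↔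
    s ∈ T.cutCells ρh ∧ (hull s ∩ Metric.closedBall z R).Nonempty := by
  simp [nearCells]

theorem mem_nearPairs {z : Pt d} {R : ℝ} {q : Finset (Pt d) × Finset (Pt d)} :
    q ∈ T.nearPairs ρh z R ↔
    q ∈ T.adjacentPairs ρh ∧ q.1 ∈ T.nearCells ρh z R ∧ q.2 ∈ T.nearCells ρh z R := by
  simp [nearPairs]

theorem IsQuasiUniform.norm_sub_le {σ h : ℝ} (hT : T.IsQuasiUniform σ h) {s : Finset (Pt d)}
    (hs : s ∈ T.cells) {x y : Pt d} (hx : x ∈ hull s) (hy : y ∈ hull s) : ‖x - y‖ ≤ h := by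
  rw [← dist_eq_norm]
  exact (Metric.dist_le_diam_of_mem (isCompact_hull s).isBounded hx hy).trans (hT s hs).1

theorem hull_subset_of_mem_nearCells {σ h : ℝ} (hT : T.IsQuasiUniform σ h) {s : Finset (Pt d)}
    {z : Pt d} {R : ℝ} (hs : s ∈ T.nearCells ρh z R) : hull s ⊆ Metric.closedBall z (R + h) := by
  obtain ⟨h1, y, hy, hyz⟩ := mem_nearCells.1 hs
  intro x hx
  rw [mem_closedBall_iff_norm] at hyz ⊢
  have := hT.norm_sub_le (cutCells_subset h1) hx hy
  calc ‖x - z‖ ≤ ‖x - y‖ + ‖y - z‖ := norm_sub_le_norm_sub_add_norm_sub _ _ _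
    _ ≤ R + h := by linarith

/-- Elements in a ball: their interiors are disjoint, which bounds their number. -/
theorem card_mul_pow_le {σ h : ℝ} (hT : T.IsQuasiUniform σ h) (hh : 0 < h)
    {𝒞 : Finset (Finset (Pt d))} (h𝒞 : 𝒞 ⊆ T.cells) {z : Pt d} {R : ℝ} (hR : 0 ≤ R)
    (hsub : ∀ s ∈ 𝒞, hull s ⊆ Metric.closedBall z R) : 𝒞.card * (h / σ ^ 2) ^ d ≤ R ^ d := by
  classical
  have hdisj : Set.Pairwise (↑𝒞) (Function.onFun (AEDisjoint (volume : Measure (Pt d))) hull) := by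
    intro s hs t ht hst
    refine measure_mono_null (t := (affineSpan ℝ ((s ∩ t : Finset (Pt d)) : Set (Pt d)) : Set (Pt d)))
      ?_ (Measure.addHaar_affineSubspace _ _ (affineSpan_ne_top_of_card_le
        (T.card_inter_le (h𝒞 hs) (h𝒞 ht) hst)))
    rintro x ⟨hxs, hxt⟩
    exact convexHull_subset_affineSpan _ (T.mem_hull_inter (h𝒞 hs) (h𝒞 ht) hxs hxt)
  have h1 : ∑ s ∈ 𝒞, volume (hull s) ≤ volume (Metric.closedBall z R) := by
    rw [← measure_biUnion_finset₀ hdisj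
      fun s _ => (isCompact_hull s).measurableSet.nullMeasurableSet]
    exact measure_mono (iUnion₂_subset hsub)
  have h2 : ∀ s ∈ 𝒞, ENNReal.ofReal ((h / σ ^ 2) ^ d * volume.real (Metric.ball (0 : Pt d) 1)) ≤
      volume (hull s) := by
    intro s hs
    obtain ⟨c, hc⟩ := hT.exists_closedBall_subset hh (h𝒞 hs)
    rw [← volume_closedBall_eq c (by positivity)]
    exact measure_mono hc
  have h3 := (Finset.sum_le_sum h2).trans h1
  rw [Finset.sum_const, nsmul_eq_mul, volume_closedBall_eq z hR, ← ENNReal.ofReal_natCast,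
    ← ENNReal.ofReal_mul (by positivity), ENNReal.ofReal_le_ofReal_iff (by positivity),
    ← mul_assoc] at h3
  exact le_of_mul_le_mul_right h3 volume_real_unitBall_pos

/-- The number of cut elements within a multiple of `h` is bounded independently of `h`. -/
theorem card_nearCells_le {σ h : ℝ} (hT : T.IsQuasiUniform σ h) (hh : 0 < h) {k : ℝ} (hk : 0 ≤ k)
    (z : Pt d) : ((T.nearCells ρh z (k * h)).card : ℝ) ≤ ((k + 1) * σ ^ 2) ^ d := by
  have hsub : T.nearCells ρh z (k * h) ⊆ T.cells :=
    fun s hs => cutCells_subset (mem_nearCells.1 hs).1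
  rcases (T.nearCells ρh z (k * h)).eq_empty_or_nonempty with he | ⟨s, hs⟩
  · rw [he]; simp; positivity
  have hσ := hT.pos hh (hsub hs)
  have h1 := card_mul_pow_le hT hh hsub (z := z) (R := k * h + h) (by positivity)
    fun s hs => hull_subset_of_mem_nearCells hT hs
  rw [← le_div_iff₀ (by positivity), ← div_pow] at h1
  refine h1.trans_eq ?_
  congr 1
  field_simp

theorem card_nearPairs_le {σ h : ℝ} (hT : T.IsQuasiUniform σ h) (hh : 0 < h) {k : ℝ} (hk : 0 ≤ k)
    (z : Pt d) : ((T.nearPairs ρh z (k * h)).card : ℝ) ≤ (((k + 1) * σ ^ 2) ^ d) ^ 2 := by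
  have h1 : (T.nearPairs ρh z (k * h)).card ≤ (T.nearCells ρh z (k * h)).card ^ 2 := by
    rw [sq, ← Finset.card_product]
    exact Finset.card_le_card fun q hq => Finset.mem_product.2 (mem_nearPairs.1 hq).2
  calc ((T.nearPairs ρh z (k * h)).card : ℝ) ≤ ((T.nearCells ρh z (k * h)).card : ℝ) ^ 2 := by
        exact_mod_cast h1
    _ ≤ _ := by
        gcongr
        exact card_nearCells_le hT hh hk z

open scoped Classical in
/-- Two elements meeting a connected part of the discrete surface close to `z` are linked through
facets of cut elements close to `z`. -/
theorem reflTransGen_nearCells (hdom : ∀ x ∈ T.surface ρh, T.domain ∈ 𝓝 x) {Γ : Set (Pt d)}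
    (hΓ : IsPreconnected Γ) (hΓS : Γ ⊆ T.surface ρh) {z z' : Pt d} {R : ℝ}
    (hΓR : Γ ⊆ Metric.closedBall z R) (hz : z ∈ Γ) (hz' : z' ∈ Γ) {s t : Finset (Pt d)}
    (hs : s ∈ T.cells) (ht : t ∈ T.cells) (hzs : z ∈ hull s) (hzt : z' ∈ hull t) :
    Relation.ReflTransGen (fun a b => (a, b) ∈ T.nearPairs ρh z R) s t := by
  set r := fun a b : Finset (Pt d) => (a, b) ∈ T.nearPairs ρh z R with hr
  have hnear : ∀ x ∈ Γ, ∀ u ∈ T.cells, x ∈ hull u → u ∈ T.nearCells ρh z R := fun x hx u hu hxu =>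
    mem_nearCells.2 ⟨mem_cutCells_of_mem hu hxu (hΓS hx), x, hxu, hΓR hx⟩
  have hstar : ∀ x ∈ Γ, ∀ u ∈ T.cells, ∀ w ∈ T.cells, x ∈ hull u → x ∈ hull w →
      Relation.ReflTransGen r u w := by
    intro x hx u hu w hw hxu hxw
    have h := T.reflTransGen_adjacent (hdom x (hΓS hx)) hu hw hxu hxw
    have : Relation.ReflTransGen r u w ∧ w ∈ T.cells ∧ x ∈ hull w := by
      clear hw hxw
      induction h with
      | refl => exact ⟨.refl, hu, hxu⟩
      | @tail b c _ hbc ih =>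
        obtain ⟨⟨hc, hxc⟩, hne, hcard⟩ := hbc
        obtain ⟨h1, hb, hxb⟩ := ih
        have hbn := hnear x hx b hb hxb
        have hcn := hnear x hx c hc hxc
        exact ⟨h1.tail (mem_nearPairs.2 ⟨mem_adjacentPairs.2 ⟨(mem_nearCells.1 hbn).1,
          (mem_nearCells.1 hcn).1, hne, hcard⟩, hbn, hcn⟩), hc, hxc⟩
    exact this.1
  -- The elements linked to `s` and the others are closed sets covering `Γ`, so they meet on it.
  by_contra hcon
  set A := ⋃ u ∈ T.cells.filter (fun u => Relation.ReflTransGen r s u), hull u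
  set A' := ⋃ u ∈ T.cells.filter (fun u => ¬ Relation.ReflTransGen r s u), hull u
  have hA : IsClosed A :=
    Set.Finite.isClosed_biUnion (Finset.finite_toSet _) fun u _ => (isCompact_hull u).isClosed
  have hA' : IsClosed A' :=
    Set.Finite.isClosed_biUnion (Finset.finite_toSet _) fun u _ => (isCompact_hull u).isClosed
  obtain ⟨x, hx, hxA, hxA'⟩ := isPreconnected_closed_iff.1 hΓ A A' hA hA' (by
      intro x hx
      obtain ⟨u, hu, hxu⟩ := mem_iUnion₂.1 (hΓS hx).1
      by_cases h : Relation.ReflTransGen r s u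
      · exact Or.inl (mem_iUnion₂.2 ⟨u, Finset.mem_filter.2 ⟨hu, h⟩, hxu⟩)
      · exact Or.inr (mem_iUnion₂.2 ⟨u, Finset.mem_filter.2 ⟨hu, h⟩, hxu⟩))
    ⟨z, hz, mem_iUnion₂.2 ⟨s, Finset.mem_filter.2 ⟨hs, .refl⟩, hzs⟩⟩
    ⟨z', hz', mem_iUnion₂.2 ⟨t, Finset.mem_filter.2 ⟨ht, hcon⟩, hzt⟩⟩
  obtain ⟨u, hu, hxu⟩ := mem_iUnion₂.1 hxA
  obtain ⟨w, hw, hxw⟩ := mem_iUnion₂.1 hxA'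
  obtain ⟨hu, hsu⟩ := Finset.mem_filter.1 hu
  obtain ⟨hw, hsw⟩ := Finset.mem_filter.1 hw
  exact hsw (hsu.trans (hstar x hx u hu w hw hxu hxw))

/-- The sum of the squared jumps of the gradient close to `z`. -/
def localJump (T : Mesh d) (ρh : Pt d → ℝ) (g : Finset (Pt d) → Pt d) (z : Pt d) (R : ℝ) : ℝ :=
  ∑ q ∈ T.nearPairs ρh z R, ‖g q.1 - g q.2‖ ^ 2

theorem localJump_nonneg (g : Finset (Pt d) → Pt d) (z : Pt d) (R : ℝ) :
    0 ≤ T.localJump ρh g z R := Finset.sum_nonneg fun _ _ => by positivity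

open scoped Classical in
/-- The jumps close to `z` bound the difference of the gradients, and of the affine extensions, on
two elements linked close to `z`. -/
theorem sq_sub_le_localJump (hd : 1 ≤ d) {σ h : ℝ} (hT : T.IsQuasiUniform σ h) (hh : 0 < h) {k : ℝ}
    (hk : 0 ≤ k) {v : Pt d → ℝ} {g : Finset (Pt d) → Pt d} {b : Finset (Pt d) → ℝ}
    (hv : T.IsPiecewiseAffine ρh v g b) {z : Pt d} {s t : Finset (Pt d)}
    (hst : Relation.ReflTransGen (fun a b => (a, b) ∈ T.nearPairs ρh z (k * h)) s t) :
    ‖g s - g t‖ ^ 2 ≤ (((k + 1) * σ ^ 2) ^ d) ^ 2 * T.localJump ρh g z (k * h) ∧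
    ∀ x, ‖x - z‖ ≤ k * h → (⟪g s, x⟫ + b s - (⟪g t, x⟫ + b t)) ^ 2 ≤
      ((2 * k + 1) * h) ^ 2 * ((((k + 1) * σ ^ 2) ^ d) ^ 2 * T.localJump ρh g z (k * h)) := by
  have hsymm : ∀ a b, (a, b) ∈ T.nearPairs ρh z (k * h) → (b, a) ∈ T.nearPairs ρh z (k * h) := by
    intro a b hab
    obtain ⟨h1, h2, h3⟩ := mem_nearPairs.1 hab
    obtain ⟨h4, h5, h6, h7⟩ := mem_adjacentPairs.1 h1
    exact mem_nearPairs.2 ⟨mem_adjacentPairs.2 ⟨h5, h4, h6.symm, by rw [Finset.inter_comm]; exact h7⟩,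
      h3, h2⟩
  have hne : ∀ a b, (a, b) ∈ T.nearPairs ρh z (k * h) → a ≠ b := fun a b hab =>
    (mem_adjacentPairs.1 (mem_nearPairs.1 hab).1).2.2.1
  have hsq : (∑ q ∈ T.nearPairs ρh z (k * h), ‖g q.1 - g q.2‖) ^ 2 ≤
      (((k + 1) * σ ^ 2) ^ d) ^ 2 * T.localJump ρh g z (k * h) := by
    refine (sq_sum_le_card_mul_sum_sq).trans ?_
    rw [localJump]
    gcongr
    exact card_nearPairs_le hT hh hk z
  constructor
  · refine le_trans ?_ hsq
    gcongr
    exact norm_sub_le_sum_of_reflTransGen hsymm hne (fun _ _ h => h) g hst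
  · intro x hx
    have h1 := norm_sub_le_sum_of_reflTransGen hsymm hne (fun _ _ h => h)
      (fun s => ⟪g s, x⟫ + b s) hst
    have h2 : ∀ q ∈ T.nearPairs ρh z (k * h), ‖⟪g q.1, x⟫ + b q.1 - (⟪g q.2, x⟫ + b q.2)‖ ≤
        (2 * k + 1) * h * ‖g q.1 - g q.2‖ := by
      intro q hq
      obtain ⟨hq1, hq2, -⟩ := mem_nearPairs.1 hq
      obtain ⟨h4, h5, -, h7⟩ := mem_adjacentPairs.1 hq1
      obtain ⟨f, hf⟩ : (q.1 ∩ q.2).Nonempty := Finset.card_pos.1 (by omega)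
      obtain ⟨hf1, hf2⟩ := Finset.mem_inter.1 hf
      have e1 := hv _ h4 f (subset_convexHull ℝ _ hf1)
      have e2 := hv _ h5 f (subset_convexHull ℝ _ hf2)
      have e3 : ⟪g q.1, x⟫ + b q.1 - (⟪g q.2, x⟫ + b q.2) = ⟪g q.1 - g q.2, x - f⟫ := by
        rw [inner_sub_left, inner_sub_right, inner_sub_right]; linarith
      have e4 := mem_closedBall_iff_norm.1
        (hull_subset_of_mem_nearCells hT hq2 (subset_convexHull ℝ _ hf1))
      have e5 : ‖x - f‖ ≤ (2 * k + 1) * h := by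
        have := norm_sub_le_norm_sub_add_norm_sub x z f
        rw [norm_sub_rev z f] at this
        linarith
      rw [e3]
      refine (norm_inner_le_norm _ _).trans ?_
      rw [mul_comm]
      gcongr
    have h3 := h1.trans (Finset.sum_le_sum h2)
    rw [← Finset.mul_sum] at h3
    rw [← sq_abs, ← Real.norm_eq_abs]
    calc _ ≤ ((2 * k + 1) * h * ∑ q ∈ T.nearPairs ρh z (k * h), ‖g q.1 - g q.2‖) ^ 2 := by gcongr
      _ ≤ _ := by
        rw [mul_pow]
        gcongr

end Mesh

/-! ### The discrete surface over the smooth surface -/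

/-- The standing assumptions: a surface with a normal field, a reach `ε`, and a mesh and a discrete
surface with `h` small in terms of `ε` and `c₀`. -/
structure Setup (S : Set (Pt d)) (ν : Pt d → Pt d) (L ε δ₀ σ c₀ h : ℝ) (T : Mesh d)
    (ρh : Pt d → ℝ) (nh : Pt d → Pt d) : Prop where
  two_le : 2 ≤ d
  surface : IsClosedSurface S
  normal : NormalField S ν L
  reach_pos : 0 < ε
  reach : 4 * L * ε ≤ 1
  h_pos : 0 < h
  c₀_mul_h : 40 * (c₀ * h) ≤ 1
  h_le : 22 * h ≤ ε
  mesh : T.IsQuasiUniform σ h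
  domain : tube S δ₀ ⊆ T.domain
  approx : T.IsApproximation S δ₀ c₀ h ρh nh

/-- The point of the discrete surface over the nearest point of `x` on `S`. -/
def lift (S : Set (Pt d)) (T : Mesh d) (ρh : Pt d → ℝ) (x : Pt d) : Pt d :=
  Function.invFunOn (nearestPoint S) (T.surface ρh) (nearestPoint S x)

theorem tube_eq (S : Set (Pt d)) (δ : ℝ) : tube S δ = {x | Metric.infDist x S < δ} := by
  ext x; simp [tube, abs_signedDist]

theorem isOpen_tube (S : Set (Pt d)) (δ : ℝ) : IsOpen (tube S δ) := by
  rw [tube_eq]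
  exact isOpen_lt (Metric.continuous_infDist_pt S) continuous_const

namespace Setup
variable {S : Set (Pt d)} {ν : Pt d → Pt d} {L ε δ₀ σ c₀ h : ℝ} {T : Mesh d}
    {ρh : Pt d → ℝ} {nh : Pt d → Pt d}

section
variable (H : Setup S ν L ε δ₀ σ c₀ h T ρh nh)
include H

theorem one_le : 1 ≤ d := one_le_two.trans H.two_le

theorem nonempty : S.Nonempty := H.surface.isConnected.nonempty

theorem infDist_le {x : Pt d} (hx : x ∈ T.surface ρh) : Metric.infDist x S ≤ c₀ * h ^ 2 := by
  rw [← abs_signedDist]; exact H.approx.dist_le x hx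

theorem c₀_nonneg : 0 ≤ c₀ := by
  obtain ⟨y, hy⟩ := H.nonempty
  obtain ⟨x, hx, -⟩ := H.approx.bijOn.surjOn hy
  have h1 := H.infDist_le hx
  have h2 := Metric.infDist_nonneg (x := x) (s := S)
  have h3 : 0 < h ^ 2 := pow_pos H.h_pos 2
  by_contra! hc
  nlinarith

theorem c₀_mul_sq_le : c₀ * h ^ 2 ≤ h / 2 := by
  have := H.c₀_mul_h
  have := H.h_pos
  nlinarith

theorem infDist_le_reach {x : Pt d} (hx : x ∈ T.surface ρh) : Metric.infDist x S ≤ ε := by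
  have h1 := H.infDist_le hx
  have h2 := H.c₀_mul_sq_le
  have h3 := H.h_le
  have h4 := H.h_pos
  linarith

theorem domain_mem_nhds {x : Pt d} (hx : x ∈ T.surface ρh) : T.domain ∈ 𝓝 x :=
  Filter.mem_of_superset ((isOpen_tube S δ₀).mem_nhds (H.approx.subset_tube hx)) H.domain

theorem isCompact_surface : IsCompact (T.surface ρh) := by
  refine T.isCompact_domain.of_isClosed_subset ?_ (sep_subset _ _)
  exact H.approx.mem_V₀.1.preimage_isClosed_of_isClosed T.isCompact_domain.isClosed
    (isClosed_singleton (x := (0 : ℝ)))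

theorem exists_mem_nearestPoint_eq (x : Pt d) :
    ∃ z ∈ T.surface ρh, nearestPoint S z = nearestPoint S x :=
  H.approx.bijOn.surjOn (nearestPoint_mem H.surface.isCompact H.nonempty x)

theorem lift_mem (x : Pt d) : lift S T ρh x ∈ T.surface ρh :=
  Function.invFunOn_mem (H.exists_mem_nearestPoint_eq x)

theorem nearestPoint_lift (x : Pt d) : nearestPoint S (lift S T ρh x) = nearestPoint S x :=
  Function.invFunOn_eq (H.exists_mem_nearestPoint_eq x)

theorem lift_eq_of_nearestPoint_eq {x z : Pt d} (hz : z ∈ T.surface ρh)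
    (hxz : nearestPoint S x = nearestPoint S z) : lift S T ρh x = z :=
  H.approx.bijOn.injOn (H.lift_mem x) hz ((H.nearestPoint_lift x).trans hxz)

theorem lift_nearestPoint {z : Pt d} (hz : z ∈ T.surface ρh) :
    lift S T ρh (nearestPoint S z) = z :=
  H.lift_eq_of_nearestPoint_eq hz (nearestPoint_of_mem H.surface.isCompact
    (nearestPoint_mem H.surface.isCompact H.nonempty z))

/-- On `S`, the lift is the inverse of a continuous bijection from a compact set. -/
theorem continuousOn_lift : ContinuousOn (lift S T ρh) {x | Metric.infDist x S ≤ ε} := by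
  have hp := H.normal.continuousOn_nearestPoint H.surface.isCompact H.nonempty H.reach
  have hS : ContinuousOn (lift S T ρh) S := by
    rw [continuousOn_iff_isClosed]
    intro C hC
    refine ⟨nearestPoint S '' (C ∩ T.surface ρh), ?_, ?_⟩
    · refine IsCompact.isClosed ?_
      exact (H.isCompact_surface.inter_left hC).image_of_continuousOn
        (hp.mono fun x hx => H.infDist_le_reach hx.2)
    · ext y
      constructor
      · rintro ⟨hyC, hy⟩
        refine ⟨⟨_, ⟨hyC, H.lift_mem y⟩, ?_⟩, hy⟩
        rw [H.nearestPoint_lift, nearestPoint_of_mem H.surface.isCompact hy]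
      · rintro ⟨⟨z, ⟨hzC, hz⟩, rfl⟩, hy⟩
        refine ⟨?_, hy⟩
        rw [mem_preimage, H.lift_nearestPoint hz]
        exact hzC
  have hcomp := hS.comp hp fun x _ => nearestPoint_mem H.surface.isCompact H.nonempty x
  refine hcomp.congr fun x _ => ?_
  refine H.lift_eq_of_nearestPoint_eq (H.lift_mem _) ?_
  rw [Function.comp_apply, H.nearestPoint_lift, nearestPoint_of_mem H.surface.isCompact
    (nearestPoint_mem H.surface.isCompact H.nonempty x)]

theorem norm_surface_sub_nearestPoint_le {z : Pt d} (hz : z ∈ T.surface ρh) :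
    ‖z - nearestPoint S z‖ ≤ c₀ * h ^ 2 := by
  rw [norm_sub_nearestPoint H.surface.isCompact H.nonempty]
  exact H.infDist_le hz

/-- The discrete surface deviates from its projection by much less than `h`. -/
theorem norm_sub_le_of_mem {z z' : Pt d} (hz : z ∈ T.surface ρh) (hz' : z' ∈ T.surface ρh) :
    ‖z - z'‖ ≤ ‖nearestPoint S z - nearestPoint S z'‖ + h := by
  have h1 := H.norm_surface_sub_nearestPoint_le hz
  have h2 := H.norm_surface_sub_nearestPoint_le hz'
  have h3 := H.c₀_mul_sq_le
  have : z - z' = (z - nearestPoint S z) + (nearestPoint S z - nearestPoint S z') -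
    (z' - nearestPoint S z') := by abel
  rw [this]
  refine (norm_sub_le _ _).trans ?_
  have := norm_add_le (z - nearestPoint S z) (nearestPoint S z - nearestPoint S z')
  linarith

theorem norm_nearestPoint_sub_le_of_mem {z z' : Pt d} (hz : z ∈ T.surface ρh)
    (hz' : z' ∈ T.surface ρh) : ‖nearestPoint S z - nearestPoint S z'‖ ≤ 2 * ‖z - z'‖ :=
  H.normal.norm_nearestPoint_sub_le H.surface.isCompact H.nonempty (H.infDist_le_reach hz)
    (H.infDist_le_reach hz') H.reach

open scoped Classical in
/-- Elements at nearby points of the discrete surface are linked through facets of nearby cut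
elements: the segment between the nearest points is projected to `S` and lifted. -/
theorem reflTransGen_nearPairs {z z' : Pt d} (hz : z ∈ T.surface ρh) (hz' : z' ∈ T.surface ρh)
    (hzz' : ‖nearestPoint S z - nearestPoint S z'‖ ≤ 2 * h) {s t : Finset (Pt d)}
    (hs : s ∈ T.cells) (ht : t ∈ T.cells) (hzs : z ∈ hull s) (hzt : z' ∈ hull t) :
    Relation.ReflTransGen (fun a b => (a, b) ∈ T.nearPairs ρh z (5 * h)) s t := by
  have hK := H.surface.isCompact
  set p := nearestPoint S with hp
  have hpz : p z ∈ S := nearestPoint_mem hK H.nonempty z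
  have hseg : ∀ w ∈ segment ℝ (p z) (p z'), ‖w - p z‖ ≤ 2 * h := by
    intro w hw
    have h1 : segment ℝ (p z) (p z') ⊆ Metric.closedBall (p z) (2 * h) := by
      refine (convex_closedBall _ _).segment_subset ?_ ?_
      · exact Metric.mem_closedBall_self (by linarith [H.h_pos])
      · rwa [mem_closedBall_iff_norm, norm_sub_rev]
    exact mem_closedBall_iff_norm.1 (h1 hw)
  have hsegε : ∀ w ∈ segment ℝ (p z) (p z'), Metric.infDist w S ≤ ε := by
    intro w hw
    refine (Metric.infDist_le_dist_of_mem hpz).trans ?_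
    rw [dist_eq_norm]
    have := hseg w hw
    linarith [H.h_le, H.h_pos]
  refine Mesh.reflTransGen_nearCells (fun x hx => H.domain_mem_nhds hx)
    (Γ := lift S T ρh '' segment ℝ (p z) (p z'))
    ((convex_segment _ _).isPreconnected.image _ (H.continuousOn_lift.mono hsegε)) ?_ ?_ ?_ ?_
    hs ht hzs hzt
  · rintro _ ⟨w, -, rfl⟩
    exact H.lift_mem w
  · rintro _ ⟨w, hw, rfl⟩
    rw [mem_closedBall_iff_norm]
    have h1 := H.norm_sub_le_of_mem (H.lift_mem w) hz
    rw [H.nearestPoint_lift] at h1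
    have h2 := H.normal.norm_nearestPoint_sub_le hK H.nonempty (x := w) (x' := p z) (hsegε w hw)
      (hsegε _ (left_mem_segment ℝ _ _)) H.reach
    rw [nearestPoint_of_mem hK hpz] at h2
    have h3 := hseg w hw
    linarith
  · exact ⟨_, left_mem_segment ℝ _ _, H.lift_nearestPoint hz⟩
  · exact ⟨_, right_mem_segment ℝ _ _, H.lift_nearestPoint hz'⟩

end

/-- The constant in the bound of the volume over a piece of the discrete surface. -/
def volConst (d : ℕ) (ε : ℝ) : ℝ :=
  4 * ε * 3 ^ d * volume.real (Metric.ball (0 : Pt d) 1) * 2 ^ (d - 1)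

theorem volConst_pos (d : ℕ) {ε : ℝ} (hε : 0 < ε) : 0 < volConst d ε := by
  have := volume_real_unitBall_pos (d := d)
  unfold volConst
  positivity

section
variable (H : Setup S ν L ε δ₀ σ c₀ h T ρh nh)
include H

/-- The volume over a piece of diameter `s` of the discrete surface. -/
theorem volume_lift_mem_le {s : ℝ} (hs : 0 < s) (hsε : 2 * s ≤ ε) {E : Set (Pt d)}
    (hE : ∀ a ∈ E, ∀ b ∈ E, ‖a - b‖ ≤ s) :
    volume {x | Metric.infDist x S ≤ ε ∧ lift S T ρh x ∈ E} ≤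
      ENNReal.ofReal (volConst d ε * s ^ (d - 1)) := by
  have h1 := H.normal.volume_nearestPoint_mem_le H.surface.isCompact H.one_le H.reach_pos H.reach
    (s := 2 * s) (by positivity) hsε (E := nearestPoint S '' (E ∩ T.surface ρh)) (by
      rintro _ ⟨a, ⟨haE, ha⟩, rfl⟩ _ ⟨b, ⟨hbE, hb⟩, rfl⟩
      have := H.norm_nearestPoint_sub_le_of_mem ha hb
      linarith [hE a haE b hbE])
  refine (measure_mono ?_).trans (h1.trans_eq ?_)
  · rintro x ⟨hx, hxE⟩
    exact ⟨hx, ⟨_, ⟨hxE, H.lift_mem x⟩, H.nearestPoint_lift x⟩,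
      nearestPoint_mem H.surface.isCompact H.nonempty x⟩
  · congr 1
    rw [volConst, mul_pow]; ring

theorem aemeasurable_lift {U : Set (Pt d)} (hU : MeasurableSet U)
    (hUε : U ⊆ {x | Metric.infDist x S ≤ ε}) : AEMeasurable (lift S T ρh) (volume.restrict U) :=
  (H.continuousOn_lift.mono hUε).aemeasurable hU

/-- The volume over a piece of the discrete surface is bounded by its Hausdorff measure. -/
theorem map_lift_le_hausdorffMeasure {U : Set (Pt d)} (hU : MeasurableSet U)
    (hUε : U ⊆ {x | Metric.infDist x S ≤ ε}) :
    (volume.restrict U).map (lift S T ρh) ≤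
      ENNReal.ofReal (volConst d ε) • (μH[((d - 1 : ℕ) : ℝ)] : Measure (Pt d)) := by
  set W := (volume.restrict U).map (lift S T ρh) with hW
  have hC := volConst_pos d H.reach_pos
  have hC0 : ENNReal.ofReal (volConst d ε) ≠ 0 := by simpa using hC
  have hWE : ∀ E : Set (Pt d), ∀ s : ℝ, 0 < s → 2 * s ≤ ε → Metric.ediam E ≤ ENNReal.ofReal s →
      W E ≤ ENNReal.ofReal (volConst d ε * s ^ (d - 1)) := by
    intro E s hs hsε hE
    -- `E` need not be measurable; its closure is, and has the same diameter.
    calc W E ≤ W (closure E) := measure_mono subset_closure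
      _ = volume (lift S T ρh ⁻¹' closure E ∩ U) := by
        rw [hW, Measure.map_apply_of_aemeasurable (H.aemeasurable_lift hU hUε)
          isClosed_closure.measurableSet, Measure.restrict_apply' hU]
      _ ≤ volume {x | Metric.infDist x S ≤ ε ∧ lift S T ρh x ∈ closure E} :=
        measure_mono fun x hx => ⟨hUε hx.2, hx.1⟩
      _ ≤ _ := by
        refine H.volume_lift_mem_le hs hsε fun a ha b hb => ?_
        have h1 := (Metric.edist_le_ediam_of_mem ha hb).trans
          ((Metric.ediam_closure E).le.trans hE)
        rw [edist_dist, ENNReal.ofReal_le_ofReal_iff hs.le, dist_eq_norm] at h1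
        exact h1
  have hle : (ENNReal.ofReal (volConst d ε))⁻¹ • W ≤ (μH[((d - 1 : ℕ) : ℝ)] : Measure (Pt d)) := by
    refine Measure.le_hausdorffMeasure _ _ (ENNReal.ofReal (ε / 4))
      (by simpa using div_pos H.reach_pos four_pos) fun E hE => ?_
    rw [Measure.smul_apply, smul_eq_mul, mul_comm, ← div_eq_mul_inv,
      ENNReal.div_le_iff hC0 ENNReal.ofReal_ne_top, ENNReal.rpow_natCast]
    have hfin : Metric.ediam E ≠ ⊤ := ne_top_of_le_ne_top ENNReal.ofReal_ne_top hE
    set r := (Metric.ediam E).toReal with hr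
    have hEr : Metric.ediam E = ENNReal.ofReal r := (ENNReal.ofReal_toReal hfin).symm
    have hr0 : 0 ≤ r := ENNReal.toReal_nonneg
    have hrε : r ≤ ε / 4 := by
      rwa [hEr, ENNReal.ofReal_le_ofReal_iff (by linarith [H.reach_pos])] at hE
    -- Sets of diameter zero are covered by letting `s` decrease to the diameter.
    have hlim : Filter.Tendsto (fun s : ℝ => ENNReal.ofReal (volConst d ε * s ^ (d - 1)))
        (𝓝[>] r) (𝓝 (ENNReal.ofReal (volConst d ε * r ^ (d - 1)))) := by
      have : Continuous fun s : ℝ => ENNReal.ofReal (volConst d ε * s ^ (d - 1)) :=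
        ENNReal.continuous_ofReal.comp (by fun_prop)
      exact (this.tendsto r).mono_left nhdsWithin_le_nhds
    have h1 : W E ≤ ENNReal.ofReal (volConst d ε * r ^ (d - 1)) := by
      refine ge_of_tendsto hlim ?_
      filter_upwards [Ioo_mem_nhdsGT (show r < ε / 2 by linarith [H.reach_pos])] with s hs
      refine hWE E s (hr0.trans_lt hs.1) (by linarith [hs.2]) ?_
      rw [hEr]
      exact ENNReal.ofReal_le_ofReal hs.1.le
    refine h1.trans_eq ?_
    rw [hEr, ENNReal.ofReal_mul hC.le, ENNReal.ofReal_pow hr0, mul_comm]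
  calc W = ENNReal.ofReal (volConst d ε) • (ENNReal.ofReal (volConst d ε))⁻¹ • W := by
        rw [smul_smul, ENNReal.mul_inv_cancel hC0 ENNReal.ofReal_ne_top, one_smul]
    _ ≤ _ := by
        intro E
        rw [Measure.smul_apply, Measure.smul_apply (μ := μH[((d - 1 : ℕ) : ℝ)]), smul_eq_mul, smul_eq_mul]
        gcongr

end

open scoped ENNReal in
/-- The constant comparing volumes over pieces of the discrete surface with their areas. -/
def areaConst (d : ℕ) (ε : ℝ) : ℝ≥0∞ :=
  ENNReal.ofReal (volConst d ε) * (Measure.addHaarScalarFactor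
    (volume : Measure (EuclideanSpace ℝ (Fin (d - 1)))) μH[((d - 1 : ℕ) : ℝ)] : ℝ≥0∞)⁻¹

theorem areaConst_ne_top (d : ℕ) (ε : ℝ) : areaConst d ε ≠ ⊤ :=
  ENNReal.mul_ne_top ENNReal.ofReal_ne_top (ENNReal.inv_ne_top.2
    (by exact_mod_cast Measure.addHaarScalarFactor_volume_hausdorffMeasure_ne_zero (d - 1)))

section
variable (H : Setup S ν L ε δ₀ σ c₀ h T ρh nh)
include H

/-- The Lebesgue measure on `U` is carried by the lift to a measure that is dominated by the area
measure of the discrete surface. -/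
theorem map_lift_le {U : Set (Pt d)} (hU : MeasurableSet U)
    (hUε : U ⊆ {x | Metric.infDist x S ≤ ε}) :
    (volume.restrict U).map (lift S T ρh) ≤
      areaConst d ε • (μHE[d - 1] : Measure (Pt d)).restrict (T.surface ρh) := by
  have hκ := Measure.addHaarScalarFactor_volume_hausdorffMeasure_ne_zero (d - 1)
  have hm := H.isCompact_surface.measurableSet
  have hall : (volume.restrict U).map (lift S T ρh) ≤ areaConst d ε • (μHE[d - 1] : Measure (Pt d)) := by
    refine (H.map_lift_le_hausdorffMeasure hU hUε).trans_eq ?_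
    rw [Measure.euclideanHausdorffMeasure_def, areaConst, mul_smul, ENNReal.smul_def, smul_smul (_⁻¹),
      ENNReal.inv_mul_cancel (by exact_mod_cast hκ) ENNReal.coe_ne_top, one_smul]
  have hc : (volume.restrict U).map (lift S T ρh) =
      ((volume.restrict U).map (lift S T ρh)).restrict (T.surface ρh) := by
    refine (Measure.restrict_eq_self_of_ae_mem ?_).symm
    refine (ae_map_iff (p := fun x => x ∈ T.surface ρh) (H.aemeasurable_lift hU hUε) hm).2 ?_
    exact Filter.Eventually.of_forall fun x => H.lift_mem x
  rw [hc, ← Measure.restrict_smul]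
  exact Measure.restrict_mono le_rfl hall

open scoped ENNReal in
theorem lintegral_lift_le {U : Set (Pt d)} (hU : MeasurableSet U)
    (hUε : U ⊆ {x | Metric.infDist x S ≤ ε}) {f : Pt d → ℝ≥0∞}
    (hf : AEMeasurable f ((μHE[d - 1] : Measure (Pt d)).restrict (T.surface ρh))) :
    ∫⁻ x in U, f (lift S T ρh x) ≤ areaConst d ε * ∫⁻ z in T.surface ρh, f z ∂μHE[d - 1] := by
  have hle := H.map_lift_le hU hUε
  have hac : (volume.restrict U).map (lift S T ρh) ≪
      (μHE[d - 1] : Measure (Pt d)).restrict (T.surface ρh) :=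
    (Measure.absolutelyContinuous_of_le hle).trans Measure.smul_absolutelyContinuous
  rw [← lintegral_map' (hf.mono_ac hac) (H.aemeasurable_lift hU hUε), ← smul_eq_mul,
    ← lintegral_smul_measure]
  exact lintegral_mono' hle le_rfl

theorem ae_lift {U : Set (Pt d)} (hU : MeasurableSet U) (hUε : U ⊆ {x | Metric.infDist x S ≤ ε})
    {P : Pt d → Prop} (hP : ∀ᵐ z ∂(μHE[d - 1] : Measure (Pt d)).restrict (T.surface ρh), P z) :
    ∀ᵐ x ∂volume.restrict U, P (lift S T ρh x) := by
  have hac : (volume.restrict U).map (lift S T ρh) ≪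
      (μHE[d - 1] : Measure (Pt d)).restrict (T.surface ρh) :=
    (Measure.absolutelyContinuous_of_le (H.map_lift_le hU hUε)).trans
      Measure.smul_absolutelyContinuous
  exact ae_of_ae_map (H.aemeasurable_lift hU hUε) (hac.ae_le hP)

/-! ### The area of the discrete surface -/

theorem measure_open_ne_zero {O : Set (Pt d)} (hO : IsOpen O) (hne : O.Nonempty) :
    (μHE[d - 1] : Measure (Pt d)) O ≠ 0 := by
  have hlt : d - 1 < d := by have := H.two_le; omega
  rcases Measure.euclideanHausdorffMeasure_zero_or_top hlt O with h0 | h0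
  · rw [EuclideanSpace.euclideanHausdorffMeasure_eq_volume] at h0
    exact absurd h0 (hO.measure_pos volume hne).ne'
  · rw [h0]; exact ENNReal.top_ne_zero

/-- On no element does the discrete level set function vanish identically, because interior points
of such an element would have no normal. -/
theorem not_hull_subset_surface {s : Finset (Pt d)} (hs : s ∈ T.cells) :
    ¬ hull s ⊆ T.surface ρh := by
  intro hsub
  set O := interior (hull s) with hO
  have hOS : O ⊆ T.surface ρh := interior_subset.trans hsub
  have h0 := ae_iff.1 H.approx.normal
  obtain ⟨x, hxO, hx⟩ : ∃ x ∈ O, IsExteriorUnitNormal (T.surface ρh) x (nh x) := by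
    by_contra! hcon
    have h1 : (μHE[d - 1] : Measure (Pt d)).restrict (T.surface ρh) O = 0 :=
      measure_mono_null (fun x hx => hcon x hx) h0
    rw [Measure.restrict_apply isOpen_interior.measurableSet, inter_eq_left.2 hOS] at h1
    exact H.measure_open_ne_zero isOpen_interior (T.interior_hull_nonempty hs) h1
  obtain ⟨hn, r, hr, hball⟩ := hx
  obtain ⟨r', hr', hball'⟩ := Metric.isOpen_iff.1 isOpen_interior x hxO
  have ht : 0 < min r r' / 2 := half_pos (lt_min hr hr')
  have hdist : ‖x + (min r r' / 2) • nh x - x‖ = min r r' / 2 := by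
    rw [add_sub_cancel_left, norm_smul, hn, mul_one, Real.norm_of_nonneg ht.le]
  have hy : x + (min r r' / 2) • nh x ∈ T.surface ρh := by
    refine hOS (hball' ?_)
    rw [mem_ball_iff_norm, hdist]
    linarith [min_le_right r r']
  have := (hball _ (by rw [mem_ball_iff_norm, hdist]; linarith [min_le_left r r'])).1.1 hy
  rw [add_sub_cancel_left, inner_smul_right, real_inner_self_eq_norm_sq, hn] at this
  linarith

/-- On an element, the discrete surface is part of a disk of radius `h` in a hyperplane. -/
theorem measure_hull_inter_surface_le {s : Finset (Pt d)} (hs : s ∈ T.cells) :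
    (μHE[d - 1] : Measure (Pt d)) (hull s ∩ T.surface ρh) ≤
      ENNReal.ofReal (h ^ (d - 1) * volume.real (Metric.ball (0 : Pt (d - 1)) 1)) := by
  rcases (hull s ∩ T.surface ρh).eq_empty_or_nonempty with he | ⟨x₀, hx₀, hx₀S⟩
  · rw [he, measure_empty]; exact zero_le
  obtain ⟨a, b, hab⟩ := H.approx.mem_V₀.2 s hs
  have ha : a ≠ 0 := by
    rintro rfl
    have h1 := hab x₀ hx₀
    rw [hx₀S.2, inner_zero_left, zero_add] at h1
    refine H.not_hull_subset_surface hs fun x hx => ⟨mem_iUnion₂.2 ⟨s, hs, hx⟩, ?_⟩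
    rw [hab x hx, inner_zero_left, ← h1, add_zero]
  rw [← euclideanHausdorffMeasure_disk H.one_le ha x₀ H.h_pos.le]
  refine measure_mono ?_
  rintro x ⟨hx, hxS⟩
  refine ⟨?_, H.mesh.norm_sub_le hs hx hx₀⟩
  have h1 := hab x₀ hx₀
  have h2 := hab x hx
  rw [hx₀S.2] at h1
  rw [hxS.2] at h2
  rw [inner_sub_right]
  linarith

theorem measure_surface_lt_top : (μHE[d - 1] : Measure (Pt d)) (T.surface ρh) < ⊤ := by
  have hsub : T.surface ρh ⊆ ⋃ s ∈ T.cells, (hull s ∩ T.surface ρh) := by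
    intro x hx
    obtain ⟨s, hs, hxs⟩ := mem_iUnion₂.1 hx.1
    exact mem_iUnion₂.2 ⟨s, hs, hxs, hx⟩
  refine (measure_mono hsub).trans_lt ((measure_biUnion_finset_le _ _).trans_lt ?_)
  exact ENNReal.sum_lt_top.2 fun s hs =>
    (H.measure_hull_inter_surface_le hs).trans_lt ENNReal.ofReal_lt_top

theorem measure_surface_inter_closedBall_le {k : ℝ} (hk : 0 ≤ k) (z : Pt d) :
    (μHE[d - 1] : Measure (Pt d)) (T.surface ρh ∩ Metric.closedBall z (k * h)) ≤
      ENNReal.ofReal (((k + 1) * σ ^ 2) ^ d * (h ^ (d - 1) *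
        volume.real (Metric.ball (0 : Pt (d - 1)) 1))) := by
  have hh := H.h_pos
  have hsub : T.surface ρh ∩ Metric.closedBall z (k * h) ⊆
      ⋃ s ∈ T.nearCells ρh z (k * h), (hull s ∩ T.surface ρh) := by
    rintro x ⟨hx, hxz⟩
    obtain ⟨s, hs, hxs⟩ := mem_iUnion₂.1 hx.1
    exact mem_iUnion₂.2 ⟨s, Mesh.mem_nearCells.2
      ⟨Mesh.mem_cutCells_of_mem hs hxs hx, x, hxs, hxz⟩, hxs, hx⟩
  refine (measure_mono hsub).trans ((measure_biUnion_finset_le _ _).trans ?_)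
  refine (Finset.sum_le_card_nsmul _ _ _ fun s hs => H.measure_hull_inter_surface_le
    (Mesh.cutCells_subset (Mesh.mem_nearCells.1 hs).1)).trans ?_
  rw [nsmul_eq_mul, ← ENNReal.ofReal_natCast, ← ENNReal.ofReal_mul (by positivity)]
  apply ENNReal.ofReal_le_ofReal
  gcongr
  exact Mesh.card_nearCells_le H.mesh hh hk z

end
end Setup

/-! ### The discrete normal and the chosen elements are measurable -/

theorem IsExteriorUnitNormal.mem {Γ : Set (Pt d)} {x ν : Pt d} (h : IsExteriorUnitNormal Γ x ν) :
    x ∈ Γ := by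
  obtain ⟨-, r, hr, hball⟩ := h
  exact (hball x (Metric.mem_ball_self hr)).1.2 (by rw [sub_self, inner_zero_right])

theorem IsExteriorUnitNormal.unique {Γ : Set (Pt d)} {x ν ν' : Pt d}
    (h : IsExteriorUnitNormal Γ x ν) (h' : IsExteriorUnitNormal Γ x ν') : ν = ν' := by
  obtain ⟨h1, r, hr, hball⟩ := h
  obtain ⟨h1', r', hr', hball'⟩ := h'
  by_contra hne
  -- otherwise `ν - ν'` would point to the exterior according to `ν`, but not according to `ν'`
  have hc : ⟪ν, ν'⟫ < 1 := inner_lt_one_iff_real_of_norm_eq_one h1 h1' |>.2 hne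
  have hw : 0 < ‖ν - ν'‖ := norm_pos_iff.2 (sub_ne_zero.2 hne)
  set t := min r r' / (2 * ‖ν - ν'‖) with ht
  have ht0 : 0 < t := div_pos (lt_min hr hr') (by positivity)
  have hn : ‖x + t • (ν - ν') - x‖ < min r r' := by
    rw [add_sub_cancel_left, norm_smul, Real.norm_of_nonneg ht0.le, ht]
    have := lt_min hr hr'
    field_simp
    linarith
  have e1 := (hball _ (mem_ball_iff_norm.2 (hn.trans_le (min_le_left _ _)))).2
  have e2 := (hball' _ (mem_ball_iff_norm.2 (hn.trans_le (min_le_right _ _)))).2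
  have e3 := e1.symm.trans e2
  rw [add_sub_cancel_left, inner_smul_right, inner_smul_right, mul_pos_iff_of_pos_left ht0,
    mul_pos_iff_of_pos_left ht0, inner_sub_right, inner_sub_right, real_inner_self_eq_norm_sq,
    real_inner_self_eq_norm_sq, h1, h1', real_inner_comm] at e3
  have := e3.1 (by rw [real_inner_comm]; linarith)
  rw [real_inner_comm] at hc
  linarith

/-- The surface is a hyperplane near `x`, so that the exterior normal at `x` serves all points of the
surface nearby. -/
theorem IsExteriorUnitNormal.of_mem_ball {Γ : Set (Pt d)} {x ν : Pt d}
    (h : IsExteriorUnitNormal Γ x ν) :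
    ∃ r > 0, ∀ y ∈ Γ ∩ Metric.ball x r, IsExteriorUnitNormal Γ y ν := by
  obtain ⟨h1, r, hr, hball⟩ := h
  refine ⟨r / 2, by positivity, fun y hy => ⟨h1, r / 2, by positivity, fun z hz => ?_⟩⟩
  have hy2 := hy.2
  rw [Metric.mem_ball] at hy2 hz
  have hyr : ⟪ν, y - x⟫ = 0 := (hball y (by rw [Metric.mem_ball]; linarith)).1.1 hy.1
  have hzr := hball z (by rw [Metric.mem_ball]; linarith [dist_triangle z y x])
  have : ⟪ν, z - y⟫ = ⟪ν, z - x⟫ := by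
    rw [← sub_sub_sub_cancel_right z y x, inner_sub_right, hyr, sub_zero]
  rw [this]
  exact hzr

namespace Mesh
variable {T : Mesh d} {ρh : Pt d → ℝ}

theorem cellAt_spec {x : Pt d} (hx : x ∈ T.domain) : T.cellAt x ∈ T.cells ∧ x ∈ hull (T.cellAt x) := by
  obtain ⟨s, hs, hxs⟩ := mem_iUnion₂.1 hx
  exact Classical.epsilon_spec (p := fun s => s ∈ T.cells ∧ x ∈ hull s) ⟨s, hs, hxs⟩

theorem cellAt_mem_cutCells {z : Pt d} (hz : z ∈ T.surface ρh) : T.cellAt z ∈ T.cutCells ρh :=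
  mem_cutCells_of_mem (cellAt_spec hz.1).1 (cellAt_spec hz.1).2 hz

/-- The element chosen at `z` depends only on which elements contain `z`. -/
theorem measurable_comp_cellAt {E : Type*} [MeasurableSpace E] (f : Finset (Pt d) → E) :
    Measurable fun z => f (T.cellAt z) := by
  let ind : Pt d → (T.cells → Prop) := fun z s => z ∈ hull (s : Finset (Pt d))
  have hind : Measurable ind := measurable_pi_iff.2 fun s =>
    measurableSet_setOfPred.1 (isCompact_hull (s : Finset (Pt d))).measurableSet
  have heq : (fun z => f (T.cellAt z)) = (fun P : T.cells → Prop =>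
      f (Classical.epsilon fun s => ∃ hs : s ∈ T.cells, P ⟨s, hs⟩)) ∘ ind := by
    ext z
    simp [ind, cellAt]
  rw [heq]
  exact Measurable.of_discrete.comp hind

theorem measurableSet_hull_inter_closedBall_nonempty (s : Finset (Pt d)) (R : ℝ) :
    MeasurableSet {z | (hull s ∩ Metric.closedBall z R).Nonempty} := by
  rcases (hull s).eq_empty_or_nonempty with he | hne
  · simp [he]
  · have : {z | (hull s ∩ Metric.closedBall z R).Nonempty} = {z | Metric.infDist z (hull s) ≤ R} := by
      ext z
      constructor
      · rintro ⟨y, hy, hyz⟩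
        refine (Metric.infDist_le_dist_of_mem hy).trans ?_
        rw [dist_comm]; exact hyz
      · intro hz
        obtain ⟨y, hy, hyz⟩ := (isCompact_hull s).exists_infDist_eq_dist hne z
        refine ⟨y, hy, ?_⟩
        rw [Metric.mem_closedBall, dist_comm, ← hyz]; exact hz
    rw [this]
    exact measurableSet_le (by fun_prop) measurable_const

theorem measurable_localJump (g : Finset (Pt d) → Pt d) (R : ℝ) :
    Measurable fun z => T.localJump ρh g z R := by
  classical
  have : (fun z => T.localJump ρh g z R) = fun z => ∑ q ∈ T.adjacentPairs ρh,
      if q.1 ∈ T.nearCells ρh z R ∧ q.2 ∈ T.nearCells ρh z R then ‖g q.1 - g q.2‖ ^ 2 else 0 := by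
    ext z
    rw [localJump, nearPairs, Finset.sum_filter]
  rw [this]
  refine Finset.measurable_sum _ fun q _ => Measurable.ite ?_ measurable_const measurable_const
  have hs : ∀ s, MeasurableSet {z | s ∈ T.nearCells ρh z R} := by
    intro s
    simp_rw [mem_nearCells, ofPred_and]
    exact (MeasurableSet.const _).inter (measurableSet_hull_inter_closedBall_nonempty s R)
  exact (hs q.1).inter (hs q.2)

end Mesh

/-- Where it exists, the exterior normal of a piecewise flat surface is locally constant. Hence it
is measurable. -/
theorem aemeasurable_of_isExteriorUnitNormal {Γ : Set (Pt d)} (hΓ : MeasurableSet Γ)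
    {μ : Measure (Pt d)} {n : Pt d → Pt d}
    (hn : ∀ᵐ x ∂μ.restrict Γ, IsExteriorUnitNormal Γ x (n x)) : AEMeasurable n (μ.restrict Γ) := by
  set Fl : Set (Pt d) := {x | ∃ ν, IsExteriorUnitNormal Γ x ν} with hFl
  choose! n' hn' using fun x (hx : x ∈ Fl) => hx
  choose! r hr hball using fun x (hx : x ∈ Fl) => (hn' x hx).of_mem_ball
  have hFlΓ : Fl = Γ ∩ ⋃ x ∈ Fl, Metric.ball x (r x) := by
    ext y
    constructor
    · intro hy
      exact ⟨(hn' y hy).mem, mem_iUnion₂.2 ⟨y, hy, Metric.mem_ball_self (hr y hy)⟩⟩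
    · rintro ⟨hy, hyU⟩
      obtain ⟨x, hx, hyx⟩ := mem_iUnion₂.1 hyU
      exact ⟨n' x, hball x hx y ⟨hy, hyx⟩⟩
  have hm : MeasurableSet Fl := by
    rw [hFlΓ]
    exact hΓ.inter (isOpen_biUnion fun _ _ => Metric.isOpen_ball).measurableSet
  have hcont : ContinuousOn n' Fl := by
    intro x hx
    refine (continuousWithinAt_const (b := n' x)).congr_of_eventuallyEq ?_ rfl
    filter_upwards [self_mem_nhdsWithin,
      mem_nhdsWithin_of_mem_nhds (Metric.ball_mem_nhds x (hr x hx))] with y hy hyx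
    exact (hn' y hy).unique (hball x hx y ⟨(hn' y hy).mem, hyx⟩)
  have hae : ∀ᵐ x ∂μ.restrict Γ, x ∈ Fl := hn.mono fun x hx => ⟨_, hx⟩
  have h1 : AEMeasurable n' (μ.restrict Γ) := by
    rw [← Measure.restrict_eq_self_of_ae_mem hae]
    have := (hcont.aemeasurable (μ := μ.restrict Γ) hm)
    exact this
  refine h1.congr ?_
  filter_upwards [hn] with x hx
  exact (hn' x ⟨_, hx⟩).unique hx

/-- A measurable unit field that is almost everywhere the discrete normal. -/
theorem Setup.exists_measurable_normal {S : Set (Pt d)} {ν : Pt d → Pt d} {L ε δ₀ σ c₀ h : ℝ}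
    {T : Mesh d} {ρh : Pt d → ℝ} {nh : Pt d → Pt d} (H : Setup S ν L ε δ₀ σ c₀ h T ρh nh) :
    ∃ N : Pt d → Pt d, Measurable N ∧ ∀ᵐ z ∂(μHE[d - 1] : Measure (Pt d)).restrict (T.surface ρh),
      nh z = N z ∧ ‖N z‖ = 1 ∧ ‖unitNormal S (nearestPoint S z) - N z‖ ≤ c₀ * h := by
  have hm := aemeasurable_of_isExteriorUnitNormal H.isCompact_surface.measurableSet H.approx.normal
  refine ⟨hm.mk _, hm.measurable_mk, ?_⟩
  filter_upwards [hm.ae_eq_mk, H.approx.normal, H.approx.normal_le] with z h1 h2 h3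
  rw [← h1]
  exact ⟨rfl, h2.1, h3⟩

/-! ### Pointwise bounds on the discrete surface -/

/-- The component of `w` orthogonal to the unit vector `n`. -/
def tang (n w : Pt d) : Pt d := w - ⟪n, w⟫ • n

theorem norm_tang_sq {n : Pt d} (hn : ‖n‖ = 1) (w : Pt d) :
    ‖tang n w‖ ^ 2 = ‖w‖ ^ 2 - ⟪n, w⟫ ^ 2 := by
  rw [tang, norm_sub_sq_real, norm_smul, hn, inner_smul_right, real_inner_comm, mul_one, Real.norm_eq_abs,
    sq_abs]
  ring

theorem tang_sub (n w w' : Pt d) : tang n (w - w') = tang n w - tang n w' := by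
  simp only [tang, inner_sub_right, sub_smul]; abel

/-- Two directions at an angle: a vector is bounded by its components orthogonal to them. -/
theorem norm_sq_le_tang {n₁ n₂ : Pt d} (h₁ : ‖n₁‖ = 1) (h₂ : ‖n₂‖ = 1) (hc : |⟪n₁, n₂⟫| ≤ 1 / 2)
    (w : Pt d) : ‖w‖ ^ 2 ≤ 2 * (‖tang n₁ w‖ ^ 2 + ‖tang n₂ w‖ ^ 2) := by
  rw [norm_tang_sq h₁, norm_tang_sq h₂]
  set a := ⟪n₁, w⟫
  set b := ⟪n₂, w⟫
  have h3 : ⟪a • n₁ + b • n₂, w⟫ = a ^ 2 + b ^ 2 := by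
    rw [inner_add_left, real_inner_smul_left, real_inner_smul_left]; ring
  have h4 : ‖a • n₁ + b • n₂‖ ^ 2 ≤ 3 / 2 * (a ^ 2 + b ^ 2) := by
    rw [norm_add_sq_real, norm_smul, norm_smul, h₁, h₂, real_inner_smul_left, real_inner_smul_right]
    simp only [mul_one, Real.norm_eq_abs, sq_abs]
    have h5 : a * (b * ⟪n₁, n₂⟫) ≤ |a| * |b| * (1 / 2) := by
      refine (le_abs_self _).trans ?_
      rw [abs_mul, abs_mul, ← mul_assoc]
      gcongr
    nlinarith [sq_nonneg (|a| - |b|), sq_abs a, sq_abs b]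
  have h6 : (a ^ 2 + b ^ 2) ^ 2 ≤ 3 / 2 * (a ^ 2 + b ^ 2) * ‖w‖ ^ 2 := by
    rw [← h3]
    calc ⟪a • n₁ + b • n₂, w⟫ ^ 2 ≤ (‖a • n₁ + b • n₂‖ * ‖w‖) ^ 2 := by
          rw [← sq_abs]
          gcongr
          exact abs_real_inner_le_norm _ _
      _ = ‖a • n₁ + b • n₂‖ ^ 2 * ‖w‖ ^ 2 := by ring
      _ ≤ _ := by rw [h3]; gcongr
  have h7 : a ^ 2 + b ^ 2 ≤ 3 / 2 * ‖w‖ ^ 2 := by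
    rcases (by positivity : 0 ≤ a ^ 2 + b ^ 2).eq_or_lt with h0 | h0
    · rw [← h0]; positivity
    · nlinarith
  linarith

/-- A vector is bounded by tangential components of two other vectors and the differences from
them. -/
theorem norm_sq_le_of_two_normals {n₁ n₂ : Pt d} (h₁ : ‖n₁‖ = 1) (h₂ : ‖n₂‖ = 1)
    (hc : |⟪n₁, n₂⟫| ≤ 1 / 2) (w w₁ w₂ : Pt d) : ‖w‖ ^ 2 ≤
      4 * ((‖w - w₁‖ ^ 2 + ‖tang n₁ w₁‖ ^ 2) + (‖w - w₂‖ ^ 2 + ‖tang n₂ w₂‖ ^ 2)) := by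
  have h : ∀ n w' : Pt d, ‖n‖ = 1 → ‖tang n w‖ ^ 2 ≤ 2 * (‖w - w'‖ ^ 2 + ‖tang n w'‖ ^ 2) := by
    intro n w' hn
    have h1 : tang n w = tang n (w - w') + tang n w' := by rw [tang_sub, sub_add_cancel]
    have h2 : ‖tang n (w - w')‖ ^ 2 ≤ ‖w - w'‖ ^ 2 := by
      rw [norm_tang_sq hn]; linarith [sq_nonneg ⟪n, w - w'⟫]
    have h3 := norm_add_le (tang n (w - w')) (tang n w')
    rw [h1]
    calc _ ≤ (‖tang n (w - w')‖ + ‖tang n w'‖) ^ 2 := by gcongr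
      _ ≤ 2 * (‖tang n (w - w')‖ ^ 2 + ‖tang n w'‖ ^ 2) := by
        nlinarith [sq_nonneg (‖tang n (w - w')‖ - ‖tang n w'‖)]
      _ ≤ _ := by linarith
  have := norm_sq_le_tang h₁ h₂ hc w
  linarith [h n₁ w₁ h₁, h n₂ w₂ h₂]

/-- On a closed surface there are points with orthogonal normals. -/
theorem NormalField.exists_inner_eq_zero {S : Set (Pt d)} {ν : Pt d → Pt d} {L : ℝ}
    (hν : NormalField S ν L) (hd : 2 ≤ d) (hS : IsCompact S) (hne : S.Nonempty) :
    ∃ y₁ ∈ S, ∃ y₂ ∈ S, ⟪ν y₁, ν y₂⟫ = 0 := by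
  have h0 : (⟨0, by omega⟩ : Fin d) ≠ ⟨1, by omega⟩ := by simp
  have horth : ⟪EuclideanSpace.single (⟨0, by omega⟩ : Fin d) (1 : ℝ),
      EuclideanSpace.single (⟨1, by omega⟩ : Fin d) (1 : ℝ)⟫ = 0 := by
    rw [EuclideanSpace.inner_single_left, PiLp.single_apply, if_neg h0, mul_zero]
  obtain ⟨y₁, hy₁, h1⟩ := exists_unitNormal_eq hS hne hν.normal
    (e := EuclideanSpace.single (⟨0, by omega⟩ : Fin d) (1 : ℝ)) (by simp)
  obtain ⟨y₂, hy₂, h2⟩ := exists_unitNormal_eq hS hne hν.normal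
    (e := EuclideanSpace.single (⟨1, by omega⟩ : Fin d) (1 : ℝ)) (by simp)
  refine ⟨y₁, hy₁, y₂, hy₂, ?_⟩
  rcases h1 with h1 | h1 <;> rcases h2 with h2 | h2 <;> rw [h1, h2] at horth <;> simpa using horth

/-- A bound on the square of the number of links in the chains of elements near a point. -/
def chainConst (d : ℕ) (σ : ℝ) : ℝ := (((5 + 1) * σ ^ 2) ^ d) ^ 2

theorem chainConst_nonneg (d : ℕ) (σ : ℝ) : 0 ≤ chainConst d σ := by unfold chainConst; positivity

namespace Setup
variable {S : Set (Pt d)} {ν : Pt d → Pt d} {L ε δ₀ σ c₀ h : ℝ} {T : Mesh d}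
    {ρh : Pt d → ℝ} {nh : Pt d → Pt d} (H : Setup S ν L ε δ₀ σ c₀ h T ρh nh)
    {v : Pt d → ℝ} {g : Finset (Pt d) → Pt d} {b : Finset (Pt d) → ℝ}
include H

/-- A vector close to the gradient of the signed distance is, up to sign, close to the normal. -/
theorem norm_sub_normal_le {y n : Pt d} (hy : y ∈ S) (hn : ‖n‖ = 1)
    (hny : ‖unitNormal S y - n‖ ≤ c₀ * h) :
    ‖n - ν y‖ ≤ 2 * (c₀ * h) ∨ ‖n + ν y‖ ≤ 2 * (c₀ * h) := by
  have hν := H.normal.normal y hy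
  obtain ⟨t, ht⟩ := hν.exists_unitNormal_eq_smul hy
  rw [ht] at hny
  have h1 : |(|t| - 1)| ≤ c₀ * h := by
    have := abs_norm_sub_norm_le (t • ν y) n
    rw [norm_smul, hν.1, hn, mul_one, Real.norm_eq_abs] at this
    exact this.trans hny
  rcases le_total 0 t with h0 | h0
  · left
    rw [abs_of_nonneg h0] at h1
    have : n - ν y = -(t • ν y - n) + (t - 1) • ν y := by rw [sub_smul, one_smul]; abel
    rw [this]
    refine (norm_add_le _ _).trans ?_
    rw [norm_neg, norm_smul, hν.1, mul_one, Real.norm_eq_abs]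
    linarith
  · right
    rw [abs_of_nonpos h0] at h1
    have : n + ν y = -(t • ν y - n) + (-(-t - 1)) • ν y := by module
    rw [this]
    refine (norm_add_le _ _).trans ?_
    rw [norm_neg, norm_smul, hν.1, mul_one, Real.norm_eq_abs, abs_neg]
    linarith

/-- The discrete normals over two points near which the normals of `S` are orthogonal. -/
theorem abs_inner_normal_le {y₁ y₂ q₁ q₂ n₁ n₂ : Pt d} (hy₁ : y₁ ∈ S) (hy₂ : y₂ ∈ S) (hq₁ : q₁ ∈ S)
    (hq₂ : q₂ ∈ S) (horth : ⟪ν y₁, ν y₂⟫ = 0) (h₁ : ‖n₁‖ = 1) (h₂ : ‖n₂‖ = 1)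
    (hn₁ : ‖unitNormal S q₁ - n₁‖ ≤ c₀ * h) (hn₂ : ‖unitNormal S q₂ - n₂‖ ≤ c₀ * h)
    (hqy₁ : L * ‖q₁ - y₁‖ ≤ 1 / 20) (hqy₂ : L * ‖q₂ - y₂‖ ≤ 1 / 20) : |⟪n₁, n₂⟫| ≤ 1 / 2 := by
  have hc := H.c₀_mul_h
  have key : ∀ y q n, y ∈ S → q ∈ S → ‖n‖ = 1 → ‖unitNormal S q - n‖ ≤ c₀ * h →
      L * ‖q - y‖ ≤ 1 / 20 → ∃ m : Pt d, (m = ν y ∨ m = -ν y) ∧ ‖n - m‖ ≤ 1 / 10 := by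
    intro y q n hy hq hn hnq hqy
    have hmain : ∀ a c : Pt d, ‖n - a‖ ≤ 2 * (c₀ * h) → ‖a - c‖ ≤ L * ‖q - y‖ → ‖n - c‖ ≤ 1 / 10 :=
      fun a c h1 h2 => (norm_sub_le_norm_sub_add_norm_sub n a c).trans (by linarith)
    rcases H.norm_sub_normal_le hq hn hnq with h1 | h1 <;> rcases H.normal.lip y hy q hq with h2 | h2
    · exact ⟨_, Or.inl rfl, hmain (ν q) _ h1 h2⟩
    · exact ⟨_, Or.inr rfl, hmain (ν q) _ h1 (by rwa [sub_neg_eq_add])⟩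
    · refine ⟨_, Or.inr rfl, hmain (-ν q) _ (by rwa [sub_neg_eq_add]) ?_⟩
      rwa [← neg_sub', norm_neg]
    · refine ⟨_, Or.inl rfl, hmain (-ν q) _ (by rwa [sub_neg_eq_add]) ?_⟩
      rwa [← neg_add', norm_neg]
  obtain ⟨m₁, hm₁, hnm₁⟩ := key y₁ q₁ n₁ hy₁ hq₁ h₁ hn₁ hqy₁
  obtain ⟨m₂, hm₂, hnm₂⟩ := key y₂ q₂ n₂ hy₂ hq₂ h₂ hn₂ hqy₂
  have hmm : ⟪m₁, m₂⟫ = 0 := by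
    rcases hm₁ with rfl | rfl <;> rcases hm₂ with rfl | rfl <;> simpa using horth
  have hm₁n : ‖m₁‖ = 1 := by
    rcases hm₁ with rfl | rfl <;> simp [(H.normal.normal y₁ hy₁).1]
  have : ⟪n₁, n₂⟫ = ⟪n₁ - m₁, n₂⟫ + ⟪m₁, n₂ - m₂⟫ := by
    rw [inner_sub_left, inner_sub_right, hmm]; ring
  rw [this]
  refine (abs_add_le _ _).trans ?_
  have e1 := abs_real_inner_le_norm (n₁ - m₁) n₂
  have e2 := abs_real_inner_le_norm m₁ (n₂ - m₂)
  rw [h₂, mul_one] at e1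
  rw [hm₁n, one_mul] at e2
  linarith

section
variable (hv : T.IsPiecewiseAffine ρh v g b)
include hv

/-- Two elements at nearby points of the discrete surface carry gradients, and affine functions, whose
difference is bounded by the jumps nearby. -/
theorem link {z z' : Pt d} (hz : z ∈ T.surface ρh) (hz' : z' ∈ T.surface ρh)
    (hzz' : ‖nearestPoint S z - nearestPoint S z'‖ ≤ 2 * h) {t : Finset (Pt d)} (ht : t ∈ T.cells)
    (hzt : z' ∈ hull t) :
    ‖g (T.cellAt z) - g t‖ ^ 2 ≤ chainConst d σ * T.localJump ρh g z (5 * h) ∧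
    ∀ x, ‖x - z‖ ≤ 5 * h → (⟪g (T.cellAt z), x⟫ + b (T.cellAt z) - (⟪g t, x⟫ + b t)) ^ 2 ≤
      (11 * h) ^ 2 * (chainConst d σ * T.localJump ρh g z (5 * h)) := by
  have hc := Mesh.cellAt_spec hz.1
  have := Mesh.sq_sub_le_localJump H.one_le H.mesh H.h_pos (by norm_num : (0 : ℝ) ≤ 5) hv
    (H.reflTransGen_nearPairs hz hz' hzz' hc.1 ht hc.2 hzt)
  norm_num at this
  norm_num [chainConst]
  exact this

theorem grad_sub_sq_le {z z' : Pt d} (hz : z ∈ T.surface ρh) (hz' : z' ∈ T.surface ρh)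
    (hzz' : ‖nearestPoint S z - nearestPoint S z'‖ ≤ 2 * h) :
    ‖g (T.cellAt z) - g (T.cellAt z')‖ ^ 2 ≤
      chainConst d σ * T.localJump ρh g z (5 * h) :=
  (H.link hv hz hz' hzz' (Mesh.cellAt_spec hz'.1).1 (Mesh.cellAt_spec hz'.1).2).1

omit H in
theorem value_eq {z : Pt d} (hz : z ∈ T.surface ρh) :
    v z = ⟪g (T.cellAt z), z⟫ + b (T.cellAt z) :=
  hv _ (Mesh.cellAt_mem_cutCells hz) z (Mesh.cellAt_spec hz.1).2

/-- The difference of two values of `v` involves the tangential gradient only, up to terms of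
higher order: the discrete surface is almost tangential to itself. -/
theorem value_sub_sq_le {z z' n : Pt d} (hz : z ∈ T.surface ρh) (hz' : z' ∈ T.surface ρh)
    (hzz' : ‖nearestPoint S z - nearestPoint S z'‖ ≤ 2 * h) (hn : ‖n‖ = 1)
    (hnz : ‖unitNormal S (nearestPoint S z) - n‖ ≤ c₀ * h) :
    (v z' - v z) ^ 2 ≤ h ^ 2 * (27 * ‖tang n (g (T.cellAt z))‖ ^ 2 +
      3 * (8 * c₀ + 4 * L) ^ 2 * (h ^ 2 * ‖g (T.cellAt z)‖ ^ 2) +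
      363 * (chainConst d σ * T.localJump ρh g z (5 * h))) := by
  have hh := H.h_pos
  have hcn := H.c₀_nonneg
  have hL := H.normal.pos
  have hK := H.surface.isCompact
  have hp := nearestPoint_mem hK H.nonempty z
  have hp' := nearestPoint_mem hK H.nonempty z'
  have h3 : ‖z' - z‖ ≤ 3 * h := by
    rw [norm_sub_rev]
    exact (H.norm_sub_le_of_mem hz hz').trans (by linarith)
  have hlink := (H.link hv hz hz' hzz' (Mesh.cellAt_spec hz'.1).1 (Mesh.cellAt_spec hz'.1).2).2 z'
    (h3.trans (by linarith))
  rw [value_eq hv hz, value_eq hv hz']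
  set G := g (T.cellAt z)
  set δ := z' - z with hδ
  -- The chord `δ` is tangential up to second order: its end points are within `c₀ * h ^ 2` of `S`,
  -- `S` deviates quadratically from its tangent plane, and `n` is within `2 * c₀ * h` of the normal.
  have hnδ : |⟪n, δ⟫| ≤ (8 * c₀ + 4 * L) * h ^ 2 := by
    have hd1 := H.norm_surface_sub_nearestPoint_le hz
    have hd2 := H.norm_surface_sub_nearestPoint_le hz'
    have hν1 := (H.normal.normal _ hp).1
    have hνδ : |⟪ν (nearestPoint S z), δ⟫| ≤ (2 * c₀ + 4 * L) * h ^ 2 := by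
      have hsplit : δ = (nearestPoint S z' - nearestPoint S z) +
          ((z' - nearestPoint S z') - (z - nearestPoint S z)) := by rw [hδ]; abel
      rw [hsplit, inner_add_right]
      have e1 := H.normal.taylor _ hp _ hp'
      have e2 : ‖nearestPoint S z' - nearestPoint S z‖ ^ 2 ≤ (2 * h) ^ 2 := by
        rw [norm_sub_rev]; gcongr
      have e3 := abs_real_inner_le_norm (ν (nearestPoint S z))
        ((z' - nearestPoint S z') - (z - nearestPoint S z))
      rw [hν1, one_mul] at e3
      have e4 := norm_sub_le (z' - nearestPoint S z') (z - nearestPoint S z)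
      have e5 := mul_le_mul_of_nonneg_left e2 hL.le
      refine (abs_add_le _ _).trans ?_
      nlinarith
    have hmain : ∀ m : Pt d, |⟪m, δ⟫| ≤ (2 * c₀ + 4 * L) * h ^ 2 → ‖n - m‖ ≤ 2 * (c₀ * h) →
        |⟪n, δ⟫| ≤ (8 * c₀ + 4 * L) * h ^ 2 := by
      intro m hm hnm
      have e1 : ⟪n, δ⟫ = ⟪n - m, δ⟫ + ⟪m, δ⟫ := by rw [inner_sub_left]; ring
      have e2 : |⟪n - m, δ⟫| ≤ 2 * (c₀ * h) * (3 * h) :=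
        (abs_real_inner_le_norm _ _).trans (by gcongr)
      rw [e1]
      refine (abs_add_le _ _).trans ?_
      nlinarith
    rcases H.norm_sub_normal_le hp hn hnz with h4 | h4
    · exact hmain _ hνδ h4
    · refine hmain (-ν (nearestPoint S z)) ?_ (by rwa [sub_neg_eq_add])
      rwa [inner_neg_left, abs_neg]
  have htang : ⟪G, δ⟫ = ⟪tang n G, δ⟫ + ⟪n, G⟫ * ⟪n, δ⟫ := by
    rw [tang, inner_sub_left, real_inner_smul_left]; ring
  have s1 : ⟪tang n G, δ⟫ ^ 2 ≤ (‖tang n G‖ * (3 * h)) ^ 2 := by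
    rw [← sq_abs]
    gcongr
    exact (abs_real_inner_le_norm _ _).trans (by gcongr)
  have s2 : (⟪n, G⟫ * ⟪n, δ⟫) ^ 2 ≤ (‖G‖ * ((8 * c₀ + 4 * L) * h ^ 2)) ^ 2 := by
    rw [← sq_abs, abs_mul]
    gcongr
    have := abs_real_inner_le_norm n G
    rwa [hn, one_mul] at this
  have heq : ⟪g (T.cellAt z'), z'⟫ + b (T.cellAt z') - (⟪G, z⟫ + b (T.cellAt z)) =
      ⟪tang n G, δ⟫ + ⟪n, G⟫ * ⟪n, δ⟫ -
        (⟪G, z'⟫ + b (T.cellAt z) - (⟪g (T.cellAt z'), z'⟫ + b (T.cellAt z'))) := by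
    rw [← htang, hδ, inner_sub_right]; ring
  rw [heq]
  set X := ⟪tang n G, δ⟫
  set Y := ⟪n, G⟫ * ⟪n, δ⟫
  set Z := ⟪G, z'⟫ + b (T.cellAt z) - (⟪g (T.cellAt z'), z'⟫ + b (T.cellAt z'))
  have s3 : (X + Y - Z) ^ 2 ≤ 3 * (X ^ 2 + Y ^ 2 + Z ^ 2) := by
    nlinarith [sq_nonneg (X - Y), sq_nonneg (X + Z), sq_nonneg (Y + Z)]
  calc _ ≤ _ := s3
    _ ≤ 3 * ((‖tang n G‖ * (3 * h)) ^ 2 + (‖G‖ * ((8 * c₀ + 4 * L) * h ^ 2)) ^ 2 +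
      (11 * h) ^ 2 * (chainConst d σ * T.localJump ρh g z (5 * h))) := by gcongr
    _ = _ := by ring

/-- Values in the cut domain compared with values at the points of the discrete surface nearby. -/
theorem exists_value_sub_sq_le {x : Pt d} (hx : x ∈ T.cutDomain ρh) :
    ∃ z₀ ∈ S, ∀ z ∈ T.surface ρh, ‖nearestPoint S z - z₀‖ < h → ‖x - z‖ ≤ 5 * h ∧
      ∀ m, (v x - m) ^ 2 ≤ 3 * (v z - m) ^ 2 + 27 * (h ^ 2 * ‖g (T.cellAt z)‖ ^ 2) +
        363 * (h ^ 2 * (chainConst d σ * T.localJump ρh g z (5 * h))) := by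
  have hh := H.h_pos
  obtain ⟨s, hs, hxs⟩ := mem_iUnion₂.1 hx
  obtain ⟨z', hz's, hz'⟩ : (hull s ∩ T.surface ρh).Nonempty := by
    classical exact (Finset.mem_filter.1 hs).2
  refine ⟨nearestPoint S z', nearestPoint_mem H.surface.isCompact H.nonempty _,
    fun z hz hzz' => ?_⟩
  have h1 := H.norm_sub_le_of_mem hz hz'
  have h2 := H.mesh.norm_sub_le (Mesh.cutCells_subset hs) hxs hz's
  have h3 : ‖x - z‖ ≤ 3 * h := by
    have := norm_sub_le_norm_sub_add_norm_sub x z' z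
    rw [norm_sub_rev z' z] at this
    linarith
  refine ⟨h3.trans (by linarith), fun m => ?_⟩
  have hlink := (H.link hv hz hz' (hzz'.le.trans (by linarith)) (Mesh.cutCells_subset hs) hz's).2 x
    (h3.trans (by linarith))
  rw [hv s hs x hxs, value_eq hv hz]
  set G := g (T.cellAt z)
  have s1 : ⟪G, x - z⟫ ^ 2 ≤ (‖G‖ * (3 * h)) ^ 2 := by
    rw [← sq_abs]
    gcongr
    exact (abs_real_inner_le_norm _ _).trans (by gcongr)
  have heq : ⟪g s, x⟫ + b s - m = (⟪G, z⟫ + b (T.cellAt z) - m) + ⟪G, x - z⟫ -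
      (⟪G, x⟫ + b (T.cellAt z) - (⟪g s, x⟫ + b s)) := by
    rw [inner_sub_right]; ring
  rw [heq]
  set X := ⟪G, z⟫ + b (T.cellAt z) - m
  set Y := ⟪G, x - z⟫
  set Z := ⟪G, x⟫ + b (T.cellAt z) - (⟪g s, x⟫ + b s)
  have s3 : (X + Y - Z) ^ 2 ≤ 3 * (X ^ 2 + Y ^ 2 + Z ^ 2) := by
    nlinarith [sq_nonneg (X - Y), sq_nonneg (X + Z), sq_nonneg (Y + Z)]
  calc _ ≤ _ := s3
    _ ≤ 3 * (X ^ 2 + (‖G‖ * (3 * h)) ^ 2 +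
      (11 * h) ^ 2 * (chainConst d σ * T.localJump ρh g z (5 * h))) := by gcongr
    _ = _ := by ring

end
end Setup

/-! ### Energies over a fixed neighborhood of the surface -/

section
open scoped ENNReal

/-- A function is at most equal to its average at some point, which can be chosen outside a given
null set. -/
theorem exists_mul_measure_le_lintegral {α : Type*} [MeasurableSpace α] {μ : Measure α} {B : Set α}
    (hB : MeasurableSet B) (hB0 : μ B ≠ 0) {P : α → Prop} (hP : ∀ᵐ x ∂μ.restrict B, P x)
    {f : α → ℝ≥0∞} (hf : Measurable f) (hBt : μ B ≠ ⊤) :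
    ∃ x ∈ B, P x ∧ f x * μ B ≤ ∫⁻ x in B, f x ∂μ := by
  have h0 : μ.restrict B ≠ 0 := by rwa [Ne, Measure.restrict_eq_zero]
  have : IsFiniteMeasure (μ.restrict B) := ⟨by rw [Measure.restrict_apply_univ]; exact hBt.lt_top⟩
  have hae : ∀ᵐ x ∂μ.restrict B, x ∈ B ∧ P x := (ae_restrict_mem hB).and hP
  obtain ⟨x, hx, hfx⟩ := exists_notMem_null_le_laverage h0 hf.aemeasurable (ae_iff.1 hae)
  obtain ⟨hxB, hxP⟩ := not_not.1 hx
  refine ⟨x, hxB, hxP, ?_⟩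
  rw [setLAverage_eq] at hfx
  rwa [ENNReal.le_div_iff_mul_le (Or.inl hB0) (Or.inl hBt)] at hfx

theorem isSqKernel_norm_sub_sq {E : Type*} [NormedAddCommGroup E] [MeasurableSpace E] [BorelSpace E]
    [SecondCountableTopology E] {φ : Pt d → E} (hφ : Measurable φ) :
    IsSqKernel fun x y => ENNReal.ofReal (‖φ x - φ y‖ ^ 2) where
  measurable := by
    refine ENNReal.measurable_ofReal.comp ?_
    exact (((hφ.comp measurable_fst).sub (hφ.comp measurable_snd)).norm).pow_const 2
  le x y z := by
    rw [← ENNReal.ofReal_add (by positivity) (by positivity),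
      show (2 : ℝ≥0∞) = ENNReal.ofReal 2 by norm_num, ← ENNReal.ofReal_mul (by norm_num)]
    apply ENNReal.ofReal_le_ofReal
    have h1 := norm_sub_le_norm_sub_add_norm_sub (φ x) (φ y) (φ z)
    calc ‖φ x - φ z‖ ^ 2 ≤ (‖φ x - φ y‖ + ‖φ y - φ z‖) ^ 2 := by gcongr
      _ ≤ _ := by nlinarith [sq_nonneg (‖φ x - φ y‖ - ‖φ y - φ z‖)]

/-- An open neighborhood `U` of `S` on which the nonlocal Poincaré inequality holds, with constant
`K`, at all scales up to `ρ`. It contains all points at distance less than `η` from `S`, and the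
normal varies little at the scale `η`. -/
structure Region (S : Set (Pt d)) (L ε : ℝ) (U : Set (Pt d)) (ρ η : ℝ) (K : ℝ≥0∞) : Prop where
  isOpen : IsOpen U
  subset_reach : U ⊆ {x | Metric.infDist x S ≤ ε}
  volume_ne_zero : volume U ≠ 0
  volume_ne_top : volume U ≠ ⊤
  η_pos : 0 < η
  η_le : η ≤ ε
  L_mul_η : 40 * L * η ≤ 1
  thick : {x | Metric.infDist x S < η} ⊆ U
  ρ_pos : 0 < ρ
  K_ne_top : K ≠ ⊤
  poincare : ∀ (D : Pt d → Pt d → ℝ≥0∞) (r : ℝ), IsSqKernel D → 0 < r → r ≤ ρ →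
    ENNReal.ofReal (r ^ (d + 2)) * ∫⁻ x in U, ∫⁻ y in U, D x y ≤ K * nearEnergy U r D

/-- Finitely many balls of radius `ε` around points of `S` that cover `S` form such a neighborhood. -/
theorem exists_region {S : Set (Pt d)} (hS : IsClosedSurface S) {L ε : ℝ} (hL : 0 < L) (hε : 0 < ε) :
    ∃ U ρ η K, Region S L ε U ρ η K := by
  obtain ⟨t, htS, htf, hcov⟩ := hS.isCompact.finite_cover_balls hε
  lift t to Finset (Pt d) using htf
  obtain ⟨K, hK, hP⟩ := exists_lintegral_le_nearEnergy hS.isConnected.isPreconnected t hε htS hcov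
  set U := ⋃ y ∈ t, Metric.ball y ε with hU
  have hUo : IsOpen U := isOpen_biUnion fun _ _ => Metric.isOpen_ball
  obtain ⟨η, hη, hηU⟩ := hS.isCompact.exists_thickening_subset_open hUo hcov
  refine ⟨U, ε, min η (min ε (1 / (40 * L))), K, hUo, ?_, ?_, ?_, ?_, ?_, ?_, ?_, hε, hK, hP⟩
  · intro x hx
    obtain ⟨y, hy, hxy⟩ := mem_iUnion₂.1 hx
    exact (Metric.infDist_le_dist_of_mem (htS hy)).trans (Metric.mem_ball.1 hxy).le
  · exact (hUo.measure_pos volume (hS.isConnected.nonempty.mono hcov)).ne'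
  · exact ((measure_biUnion_finset_le _ _).trans_lt
      (ENNReal.sum_lt_top.2 fun y _ => measure_ball_lt_top)).ne
  · positivity
  · exact (min_le_right _ _).trans (min_le_left _ _)
  · have : min η (min ε (1 / (40 * L))) ≤ 1 / (40 * L) := (min_le_right _ _).trans (min_le_right _ _)
    rwa [le_div_iff₀ (by positivity), mul_comm] at this
  · intro x hx
    exact hηU ((Metric.mem_thickening_iff_infDist_lt hS.isConnected.nonempty).2
      (lt_of_lt_of_le hx (min_le_left _ _)))

/-- The form of the nonlocal Poincaré inequality that is used: differences at distance less than `h`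
are controlled by the first point. -/
theorem Region.lintegral_norm_sub_sq_le {S U : Set (Pt d)} {L ε ρ η : ℝ} {K : ℝ≥0∞}
    (R : Region S L ε U ρ η K) {E : Type*} [NormedAddCommGroup E] [MeasurableSpace E] [BorelSpace E]
    [SecondCountableTopology E] {φ : Pt d → E} (hφ : Measurable φ) {h : ℝ} (hh : 0 < h)
    (hρ : h ≤ ρ) {w : Pt d → ℝ≥0∞} (hw : ∀ᵐ x ∂volume.restrict U, ∀ y ∈ U, ‖x - y‖ < h →
      ENNReal.ofReal (‖φ x - φ y‖ ^ 2) ≤ ENNReal.ofReal (h ^ 2) * w x) :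
    ∫⁻ x in U, ∫⁻ y in U, ENNReal.ofReal (‖φ x - φ y‖ ^ 2) ≤
      K * volume (Metric.ball (0 : Pt d) 1) * ∫⁻ x in U, w x := by
  have hUm := R.isOpen.measurableSet
  have h1 := R.poincare _ h (isSqKernel_norm_sub_sq hφ) hh hρ
  have hvol : ∀ x : Pt d, volume (Metric.ball x h) =
      ENNReal.ofReal (h ^ d) * volume (Metric.ball (0 : Pt d) 1) := by
    intro x
    rw [Measure.addHaar_ball_of_pos volume x hh, finrank_euclideanSpace_fin]
  have h2 : nearEnergy U h (fun x y => ENNReal.ofReal (‖φ x - φ y‖ ^ 2)) ≤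
      ENNReal.ofReal (h ^ (d + 2)) * volume (Metric.ball (0 : Pt d) 1) * ∫⁻ x in U, w x := by
    have hfin : ENNReal.ofReal (h ^ (d + 2)) * volume (Metric.ball (0 : Pt d) 1) ≠ ⊤ :=
      ENNReal.mul_ne_top ENNReal.ofReal_ne_top measure_ball_lt_top.ne
    rw [← lintegral_const_mul' _ _ hfin]
    refine lintegral_mono_ae ?_
    filter_upwards [hw] with x hx
    calc _ ≤ ∫⁻ y in U, (Metric.ball x h).indicator
          (fun _ => ENNReal.ofReal (h ^ 2) * w x) y := by
          refine setLIntegral_mono' hUm fun y hy => ?_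
          by_cases hxy : ‖x - y‖ < h
          · rw [indicator_of_mem (by exact hxy), indicator_of_mem
              (mem_ball_iff_norm'.2 hxy)]
            exact hx y hy hxy
          · rw [indicator_of_notMem (by exact hxy)]
            exact zero_le
      _ ≤ ∫⁻ y, (Metric.ball x h).indicator (fun _ => ENNReal.ofReal (h ^ 2) * w x) y :=
          setLIntegral_le_lintegral _ _
      _ = _ := by
          rw [lintegral_indicator_const Metric.isOpen_ball.measurableSet, hvol, pow_add,
            ENNReal.ofReal_mul (by positivity)]
          ring
  have h3 := h1.trans (mul_le_mul_right h2 K)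
  have h0 : ENNReal.ofReal (h ^ (d + 2)) ≠ 0 := by
    rw [Ne, ENNReal.ofReal_eq_zero, not_le]; positivity
  rw [← ENNReal.mul_le_mul_iff_right h0 ENNReal.ofReal_ne_top]
  refine h3.trans_eq ?_
  ring

end

/-- The value at `z` of the function that on each element `s` has gradient `g s` and constant
part `b s`. -/
def affineValue (T : Mesh d) (g : Finset (Pt d) → Pt d) (b : Finset (Pt d) → ℝ) (z : Pt d) : ℝ :=
  ⟪g (T.cellAt z), z⟫ + b (T.cellAt z)

theorem measurable_affineValue (T : Mesh d) (g : Finset (Pt d) → Pt d) (b : Finset (Pt d) → ℝ) :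
    Measurable (affineValue T g b) :=
  ((Mesh.measurable_comp_cellAt g).inner measurable_id).add (Mesh.measurable_comp_cellAt b)

theorem measurable_norm_tang_sq {n w : Pt d → Pt d} (hn : Measurable n) (hw : Measurable w) :
    Measurable fun x => ENNReal.ofReal (‖tang (n x) (w x)‖ ^ 2) := by
  have h1 : Measurable fun x => ⟪n x, w x⟫ := hn.inner hw
  have h2 : Measurable fun x => tang (n x) (w x) := hw.sub (h1.smul hn)
  exact ENNReal.measurable_ofReal.comp (h2.norm.pow_const 2)

namespace Setup
open scoped ENNReal
variable {S : Set (Pt d)} {ν : Pt d → Pt d} {L ε δ₀ σ c₀ h : ℝ} {T : Mesh d}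
    {ρh : Pt d → ℝ} {nh : Pt d → Pt d} (H : Setup S ν L ε δ₀ σ c₀ h T ρh nh)
    {U : Set (Pt d)} {ρ η : ℝ} {K : ℝ≥0∞} (R : Region S L ε U ρ η K)
    {v : Pt d → ℝ} {g : Finset (Pt d) → Pt d} {b : Finset (Pt d) → ℝ}
    {ψ : Pt d → Pt d}
include H R

/-- The lift is continuous on `U`; a measurable version is obtained by changing it outside of `U`. -/
theorem exists_measurable_lift : ∃ ψ : Pt d → Pt d, Measurable ψ ∧ ∀ x ∈ U, ψ x = lift S T ρh x := by
  classical
  exact ⟨U.piecewise (lift S T ρh) fun _ => 0, (H.continuousOn_lift.mono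
    R.subset_reach).measurable_piecewise continuousOn_const R.isOpen.measurableSet,
    fun x hx => piecewise_eq_of_mem _ _ _ hx⟩

variable (hψ : Measurable ψ) (hψU : ∀ x ∈ U, ψ x = lift S T ρh x)
include hψU

omit R in
theorem ψ_mem {x : Pt d} (hx : x ∈ U) : ψ x ∈ T.surface ρh := by
  rw [hψU x hx]; exact H.lift_mem x

omit R in
theorem nearestPoint_ψ {x : Pt d} (hx : x ∈ U) : nearestPoint S (ψ x) = nearestPoint S x := by
  rw [hψU x hx]; exact H.nearestPoint_lift x

theorem norm_nearestPoint_ψ_sub_le {x y : Pt d} (hx : x ∈ U) (hy : y ∈ U) :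
    ‖nearestPoint S (ψ x) - nearestPoint S (ψ y)‖ ≤ 2 * ‖x - y‖ := by
  rw [H.nearestPoint_ψ hψU hx, H.nearestPoint_ψ hψU hy]
  exact H.normal.norm_nearestPoint_sub_le H.surface.isCompact H.nonempty (R.subset_reach hx)
    (R.subset_reach hy) H.reach

variable (hρ : h ≤ ρ) (hv : T.IsPiecewiseAffine ρh v g b)
include hρ hv hψ

/-- The oscillation of the gradients is bounded by the jumps. -/
theorem lintegral_grad_sub_sq_le :
    ∫⁻ x in U, ∫⁻ y in U, ENNReal.ofReal (‖h • g (T.cellAt (ψ x)) - h • g (T.cellAt (ψ y))‖ ^ 2) ≤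
      K * volume (Metric.ball (0 : Pt d) 1) * ∫⁻ x in U,
        ENNReal.ofReal (chainConst d σ * T.localJump ρh g (ψ x) (5 * h)) := by
  refine R.lintegral_norm_sub_sq_le (φ := fun x => h • g (T.cellAt (ψ x)))
    (((Mesh.measurable_comp_cellAt g).comp hψ).const_smul h) H.h_pos hρ ?_
  filter_upwards [ae_restrict_mem R.isOpen.measurableSet] with x hx y hy hxy
  rw [← ENNReal.ofReal_mul (sq_nonneg h)]
  apply ENNReal.ofReal_le_ofReal
  rw [← smul_sub, norm_smul, mul_pow, Real.norm_eq_abs, sq_abs]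
  gcongr
  exact H.grad_sub_sq_le hv (H.ψ_mem hψU hx) (H.ψ_mem hψU hy)
    ((H.norm_nearestPoint_ψ_sub_le R hψU hx hy).trans (by linarith))

variable {N : Pt d → Pt d} (hN : Measurable N)
  (hNae : ∀ᵐ z ∂(μHE[d - 1] : Measure (Pt d)).restrict (T.surface ρh),
    nh z = N z ∧ ‖N z‖ = 1 ∧ ‖unitNormal S (nearestPoint S z) - N z‖ ≤ c₀ * h)
include hNae

omit hψ hρ hv in
theorem ae_normal_ψ : ∀ᵐ x ∂volume.restrict U, x ∈ U ∧ ‖N (ψ x)‖ = 1 ∧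
    ‖unitNormal S (nearestPoint S (ψ x)) - N (ψ x)‖ ≤ c₀ * h := by
  filter_upwards [H.ae_lift R.isOpen.measurableSet R.subset_reach hNae,
    ae_restrict_mem R.isOpen.measurableSet] with x hx hxU
  rw [hψU x hxU]
  exact ⟨hxU, hx.2⟩

/-- The oscillation of the values is bounded by the tangential gradients, the gradients, and the
jumps. -/
theorem lintegral_value_sub_sq_le :
    ∫⁻ x in U, ∫⁻ y in U, ENNReal.ofReal (‖affineValue T g b (ψ x) - affineValue T g b (ψ y)‖ ^ 2) ≤
      K * volume (Metric.ball (0 : Pt d) 1) * ∫⁻ x in U,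
        ENNReal.ofReal (27 * ‖tang (N (ψ x)) (g (T.cellAt (ψ x)))‖ ^ 2 +
          3 * (8 * c₀ + 4 * L) ^ 2 * (h ^ 2 * ‖g (T.cellAt (ψ x))‖ ^ 2) +
          363 * (chainConst d σ * T.localJump ρh g (ψ x) (5 * h))) := by
  refine R.lintegral_norm_sub_sq_le ((measurable_affineValue T g b).comp hψ) H.h_pos hρ ?_
  filter_upwards [H.ae_normal_ψ R hψU hNae] with x ⟨hx, hx1, hx2⟩ y hy hxy
  rw [← ENNReal.ofReal_mul (sq_nonneg h)]
  apply ENNReal.ofReal_le_ofReal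
  have := H.value_sub_sq_le hv (H.ψ_mem hψU hx) (H.ψ_mem hψU hy)
    ((H.norm_nearestPoint_ψ_sub_le R hψU hx hy).trans (by linarith)) hx1 hx2
  rw [norm_sub_rev, Real.norm_eq_abs, sq_abs]
  rw [value_eq hv (H.ψ_mem hψU hx), value_eq hv (H.ψ_mem hψU hy)] at this
  exact this

end Setup

theorem tang_smul (n w : Pt d) (t : ℝ) : tang n (t • w) = t • tang n w := by
  rw [tang, tang, inner_smul_right, smul_sub, smul_smul]

open scoped ENNReal in
theorem lintegral_norm_sq_le_of_two_normals {F : Pt d → Pt d} (hF : Measurable F) {n₁ n₂ : Pt d}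
    (h₁ : ‖n₁‖ = 1) (h₂ : ‖n₂‖ = 1) (hc : |⟪n₁, n₂⟫| ≤ 1 / 2) (w₁ w₂ : Pt d) (U : Set (Pt d)) :
    ∫⁻ x in U, ENNReal.ofReal (‖F x‖ ^ 2) ≤
      4 * (((∫⁻ x in U, ENNReal.ofReal (‖w₁ - F x‖ ^ 2)) +
        volume U * ENNReal.ofReal (‖tang n₁ w₁‖ ^ 2)) +
      ((∫⁻ x in U, ENNReal.ofReal (‖w₂ - F x‖ ^ 2)) +
        volume U * ENNReal.ofReal (‖tang n₂ w₂‖ ^ 2))) := by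
  have hm : ∀ w, Measurable fun x => ENNReal.ofReal (‖w - F x‖ ^ 2) := fun w =>
    ENNReal.measurable_ofReal.comp ((hF.const_sub w).norm.pow_const 2)
  calc _ ≤ ∫⁻ x in U, 4 * ((ENNReal.ofReal (‖w₁ - F x‖ ^ 2) +
        ENNReal.ofReal (‖tang n₁ w₁‖ ^ 2)) + (ENNReal.ofReal (‖w₂ - F x‖ ^ 2) +
        ENNReal.ofReal (‖tang n₂ w₂‖ ^ 2))) := by
        refine lintegral_mono fun x => ?_
        rw [← ENNReal.ofReal_add (by positivity) (by positivity),
          ← ENNReal.ofReal_add (by positivity) (by positivity),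
          ← ENNReal.ofReal_add (by positivity) (by positivity),
          show (4 : ℝ≥0∞) = ENNReal.ofReal 4 by norm_num, ← ENNReal.ofReal_mul (by norm_num)]
        apply ENNReal.ofReal_le_ofReal
        rw [norm_sub_rev w₁, norm_sub_rev w₂]
        exact norm_sq_le_of_two_normals h₁ h₂ hc _ _ _
    _ = _ := by
        rw [lintegral_const_mul' _ _ (by norm_num), lintegral_add_right _
          ((hm w₂).add_const _), lintegral_add_right _ measurable_const,
          lintegral_add_right _ measurable_const, setLIntegral_const, setLIntegral_const]
        simp only [mul_comm (volume U)]

/-- The volume of the points over a small piece of `S`, per unit of area. -/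
def fiberConst (d : ℕ) (η : ℝ) : ℝ := η / 2 * (1 / 4) ^ d * volume.real (Metric.ball (0 : Pt d) 1)

theorem fiberConst_pos (d : ℕ) {η : ℝ} (hη : 0 < η) : 0 < fiberConst d η := by
  have := volume_real_unitBall_pos (d := d)
  unfold fiberConst
  positivity

namespace Setup
open scoped ENNReal
variable {S : Set (Pt d)} {ν : Pt d → Pt d} {L ε δ₀ σ c₀ h : ℝ} {T : Mesh d}
    {ρh : Pt d → ℝ} {nh : Pt d → Pt d} (H : Setup S ν L ε δ₀ σ c₀ h T ρh nh)
    {U : Set (Pt d)} {ρ η : ℝ} {K : ℝ≥0∞} (R : Region S L ε U ρ η K)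
    {v : Pt d → ℝ} {g : Finset (Pt d) → Pt d} {b : Finset (Pt d) → ℝ}
    {ψ : Pt d → Pt d} (hψ : Measurable ψ) (hψU : ∀ x ∈ U, ψ x = lift S T ρh x)
include H R hψ hψU

/-- The gradients are bounded by their oscillation and by the tangential gradients: over two points
with orthogonal normals, the tangential gradients control the whole gradient. -/
theorem lintegral_grad_sq_le {N : Pt d → Pt d} (hN : Measurable N)
    (hNae : ∀ᵐ z ∂(μHE[d - 1] : Measure (Pt d)).restrict (T.surface ρh),
      nh z = N z ∧ ‖N z‖ = 1 ∧ ‖unitNormal S (nearestPoint S z) - N z‖ ≤ c₀ * h) (h1 : h ≤ 1) :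
    (∫⁻ x in U, ENNReal.ofReal (‖h • g (T.cellAt (ψ x))‖ ^ 2)) * volume (Metric.ball (0 : Pt d) η) ≤
      8 * ((∫⁻ x in U, ∫⁻ y in U,
        ENNReal.ofReal (‖h • g (T.cellAt (ψ x)) - h • g (T.cellAt (ψ y))‖ ^ 2)) +
      volume U * ∫⁻ x in U, ENNReal.ofReal (‖tang (N (ψ x)) (g (T.cellAt (ψ x)))‖ ^ 2)) := by
  have hUm := R.isOpen.measurableSet
  have hK := H.surface.isCompact
  set F : Pt d → Pt d := fun x => h • g (T.cellAt (ψ x)) with hF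
  have hFm : Measurable F := ((Mesh.measurable_comp_cellAt g).comp hψ).const_smul h
  set w : Pt d → ℝ≥0∞ := fun x => (∫⁻ y in U, ENNReal.ofReal (‖F x - F y‖ ^ 2)) +
    volume U * ENNReal.ofReal (‖tang (N (ψ x)) (F x)‖ ^ 2) with hw
  have htm : Measurable fun x => ENNReal.ofReal (‖tang (N (ψ x)) (F x)‖ ^ 2) :=
    measurable_norm_tang_sq (hN.comp hψ) hFm
  have hwm : Measurable w :=
    ((isSqKernel_norm_sub_sq hFm).measurable.lintegral_prod_right').add (htm.const_mul _)
  have hwU : ∫⁻ x in U, w x ≤ (∫⁻ x in U, ∫⁻ y in U, ENNReal.ofReal (‖F x - F y‖ ^ 2)) +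
      volume U * ∫⁻ x in U, ENNReal.ofReal (‖tang (N (ψ x)) (g (T.cellAt (ψ x)))‖ ^ 2) := by
    rw [hw, lintegral_add_right _ (htm.const_mul _), lintegral_const_mul' _ _ R.volume_ne_top]
    gcongr with x
    -- The factor `h` is needed for the oscillation only; here it is dropped since `h ≤ 1`.
    rw [hF, tang_smul, norm_smul, Real.norm_of_nonneg H.h_pos.le]
    exact mul_le_of_le_one_left (norm_nonneg _) h1
  set Q := (∫⁻ x in U, ∫⁻ y in U, ENNReal.ofReal (‖F x - F y‖ ^ 2)) +
      volume U * ∫⁻ x in U, ENNReal.ofReal (‖tang (N (ψ x)) (g (T.cellAt (ψ x)))‖ ^ 2) with hQ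
  have hball : ∀ y : Pt d, volume (Metric.ball y η) = volume (Metric.ball (0 : Pt d) η) := by
    intro y
    rw [volume_ball_eq _ R.η_pos, volume_ball_eq _ R.η_pos]
  -- In the ball of radius `η` around any point of `S` the value of `w` is somewhere at most average.
  have key : ∀ y ∈ S, ∃ x ∈ U, ‖N (ψ x)‖ = 1 ∧ ‖unitNormal S (nearestPoint S x) - N (ψ x)‖ ≤ c₀ * h ∧
      L * ‖nearestPoint S x - y‖ ≤ 1 / 20 ∧ w x * volume (Metric.ball (0 : Pt d) η) ≤ Q := by
    intro y hy
    have hsub : Metric.ball y η ⊆ U := fun x hx =>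
      R.thick ((Metric.infDist_le_dist_of_mem hy).trans_lt hx)
    obtain ⟨x, hxB, ⟨hx, hx1, hx2⟩, hwx⟩ := exists_mul_measure_le_lintegral
      (Metric.isOpen_ball.measurableSet) (Metric.measure_ball_pos volume y R.η_pos).ne'
      (ae_restrict_of_ae_restrict_of_subset hsub (H.ae_normal_ψ R hψU hNae)) hwm
      measure_ball_lt_top.ne
    rw [H.nearestPoint_ψ hψU hx] at hx2
    refine ⟨x, hx, hx1, hx2, ?_, ?_⟩
    · have e1 := H.normal.norm_nearestPoint_sub_le hK H.nonempty (R.subset_reach hx)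
        (R.subset_reach (hsub (Metric.mem_ball_self R.η_pos))) H.reach
      rw [nearestPoint_of_mem hK hy] at e1
      have e2 := mem_ball_iff_norm.1 hxB
      have e3 := R.L_mul_η
      have hL := H.normal.pos
      calc L * ‖nearestPoint S x - y‖ ≤ L * (2 * η) := by
            gcongr
            linarith
        _ ≤ 1 / 20 := by linarith
    · rw [← hball y]
      exact hwx.trans ((lintegral_mono_set hsub).trans hwU)
  obtain ⟨y₁, hy₁, y₂, hy₂, horth⟩ := H.normal.exists_inner_eq_zero H.two_le hK H.nonempty
  obtain ⟨x₁, hx₁, hn₁, hd₁, hl₁, hw₁⟩ := key y₁ hy₁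
  obtain ⟨x₂, hx₂, hn₂, hd₂, hl₂, hw₂⟩ := key y₂ hy₂
  have hin := H.abs_inner_normal_le hy₁ hy₂ (nearestPoint_mem hK H.nonempty x₁)
    (nearestPoint_mem hK H.nonempty x₂) horth hn₁ hn₂ hd₁ hd₂ hl₁ hl₂
  have hmain : ∫⁻ x in U, ENNReal.ofReal (‖F x‖ ^ 2) ≤ 4 * (w x₁ + w x₂) :=
    lintegral_norm_sq_le_of_two_normals hFm hn₁ hn₂ hin (F x₁) (F x₂) U
  calc _ ≤ 4 * (w x₁ + w x₂) * volume (Metric.ball (0 : Pt d) η) := by gcongr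
    _ = 4 * (w x₁ * volume (Metric.ball (0 : Pt d) η) + w x₂ * volume (Metric.ball (0 : Pt d) η)) := by
      ring
    _ ≤ 4 * (Q + Q) := by gcongr
    _ = 8 * Q := by ring

/-- Integrals of `v` over the cut domain or the discrete surface, represented by the measure `μ`,
are bounded by integrals over the neighborhood `U`: each point of the cut domain is compared with
all points of `U` that project close to it. -/
theorem lintegral_value_sub_sq_le_of_measure (hv : T.IsPiecewiseAffine ρh v g b) (hη : h ≤ η)
    {μ : Measure (Pt d)} [SFinite μ] (hμ : ∀ᵐ x ∂μ, x ∈ T.cutDomain ρh) {Λ : ℝ≥0∞}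
    (hΛ : ∀ z, μ (Metric.closedBall z (5 * h)) ≤ Λ) (m : ℝ) :
    ENNReal.ofReal (fiberConst d η * h ^ (d - 1)) * ∫⁻ x, ENNReal.ofReal ((v x - m) ^ 2) ∂μ ≤
      Λ * ∫⁻ y in U, ENNReal.ofReal (3 * (affineValue T g b (ψ y) - m) ^ 2 +
        27 * (h ^ 2 * ‖g (T.cellAt (ψ y))‖ ^ 2) +
        363 * (h ^ 2 * (chainConst d σ * T.localJump ρh g (ψ y) (5 * h)))) := by
  have hUm := R.isOpen.measurableSet
  have hh := H.h_pos
  set W : Pt d → ℝ≥0∞ := fun y => ENNReal.ofReal (3 * (affineValue T g b (ψ y) - m) ^ 2 +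
        27 * (h ^ 2 * ‖g (T.cellAt (ψ y))‖ ^ 2) +
        363 * (h ^ 2 * (chainConst d σ * T.localJump ρh g (ψ y) (5 * h)))) with hW
  have hWm : Measurable W := by
    have e1 : Measurable fun y => affineValue T g b (ψ y) := (measurable_affineValue T g b).comp hψ
    have e2 : Measurable fun y => g (T.cellAt (ψ y)) := (Mesh.measurable_comp_cellAt g).comp hψ
    have e3 : Measurable fun y => T.localJump ρh g (ψ y) (5 * h) :=
      (Mesh.measurable_localJump g _).comp hψ
    exact ENNReal.measurable_ofReal.comp ((((e1.sub_const m).pow_const 2).const_mul 3 |>.add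
      ((((e2.norm).pow_const 2).const_mul _).const_mul 27)).add
      (((e3.const_mul _).const_mul _).const_mul 363))
  set A : Set (Pt d × Pt d) := {q | ‖q.1 - ψ q.2‖ ≤ 5 * h} with hA
  have hAm : MeasurableSet A :=
    measurableSet_le ((measurable_fst.sub (hψ.comp measurable_snd)).norm) measurable_const
  -- The kernel of the comparison: `x` is compared with those `y` whose lift is within `5 * h`.
  set k : Pt d → Pt d → ℝ≥0∞ := fun x y => A.indicator (fun q => W q.2) (x, y) with hk
  have hkm : Measurable (Function.uncurry k) := (hWm.comp measurable_snd).indicator hAm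
  have hpt : ∀ x ∈ T.cutDomain ρh, ENNReal.ofReal (fiberConst d η * h ^ (d - 1)) *
      ENNReal.ofReal ((v x - m) ^ 2) ≤ ∫⁻ y in U, k x y := by
    intro x hx
    obtain ⟨z₀, hz₀, hz⟩ := H.exists_value_sub_sq_le hv hx
    set O : Set (Pt d) := {y | Metric.infDist y S < η ∧ ‖nearestPoint S y - z₀‖ < h} with hO
    have hOU : O ⊆ U := fun y hy => R.thick hy.1
    have hOm : MeasurableSet O := by
      have hc : ContinuousOn (nearestPoint S) {y | Metric.infDist y S < η} :=
        (H.normal.continuousOn_nearestPoint H.surface.isCompact H.nonempty H.reach).mono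
          fun y hy => R.subset_reach (R.thick hy)
      have := hc.isOpen_inter_preimage (isOpen_lt (Metric.continuous_infDist_pt S)
        continuous_const) (Metric.isOpen_ball (x := z₀) (ε := h))
      convert this.measurableSet using 1
      ext y
      simp [hO, dist_eq_norm]
    have hvol := H.normal.le_volume_nearestPoint_mem H.surface.isCompact H.one_le
      ((mul_le_mul_of_nonneg_left R.η_le (mul_nonneg zero_le_four H.normal.pos.le)).trans H.reach)
      hh hη hz₀
    calc _ ≤ volume O * ENNReal.ofReal ((v x - m) ^ 2) := by
          gcongr
          exact hvol
      _ = ∫⁻ _ in O, ENNReal.ofReal ((v x - m) ^ 2) := by rw [setLIntegral_const, mul_comm]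
      _ ≤ ∫⁻ y in O, k x y := by
          refine setLIntegral_mono' hOm fun y hy => ?_
          obtain ⟨hxz, hvm⟩ := hz (ψ y) (H.ψ_mem hψU (hOU hy))
            (by rw [H.nearestPoint_ψ hψU (hOU hy)]; exact hy.2)
          rw [hk]
          dsimp only
          rw [indicator_of_mem (show (x, y) ∈ A from hxz)]
          apply ENNReal.ofReal_le_ofReal
          have := hvm m
          rw [value_eq hv (H.ψ_mem hψU (hOU hy))] at this
          exact this
      _ ≤ _ := lintegral_mono_set hOU
  rw [← lintegral_const_mul' _ _ ENNReal.ofReal_ne_top]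
  calc _ ≤ ∫⁻ x, (∫⁻ y in U, k x y) ∂μ := lintegral_mono_ae (hμ.mono hpt)
    _ = ∫⁻ y in U, ∫⁻ x, k x y ∂μ := lintegral_lintegral_swap hkm.aemeasurable
    _ ≤ ∫⁻ y in U, Λ * W y := by
        refine lintegral_mono fun y => ?_
        have : ∀ x, k x y = (Metric.closedBall (ψ y) (5 * h)).indicator (fun _ => W y) x := by
          intro x
          by_cases hx : ‖x - ψ y‖ ≤ 5 * h
          · rw [hk]; dsimp only
            rw [indicator_of_mem (show (x, y) ∈ A from hx), indicator_of_mem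
              (mem_closedBall_iff_norm.2 hx)]
          · rw [hk]; dsimp only
            rw [indicator_of_notMem (show (x, y) ∉ A from hx), indicator_of_notMem
              (fun hc => hx (mem_closedBall_iff_norm.1 hc))]
        simp_rw [this]
        rw [lintegral_indicator_const Metric.isClosed_closedBall.measurableSet, mul_comm]
        gcongr
        exact hΛ _
    _ = _ := lintegral_const_mul _ hWm

/-- The jumps near the lifted points, integrated over `U`, are bounded by the sum of the jumps. -/
theorem lintegral_localJump_le :
    ∫⁻ x in U, ENNReal.ofReal (T.localJump ρh g (ψ x) (5 * h)) ≤
      ENNReal.ofReal (volConst d ε * (11 * h) ^ (d - 1) *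
        ∑ q ∈ T.adjacentPairs ρh, ‖g q.1 - g q.2‖ ^ 2) := by
  classical
  have hUm := R.isOpen.measurableSet
  have hh := H.h_pos
  have hC := (volConst_pos d H.reach_pos).le
  set E : Finset (Pt d) × Finset (Pt d) → Set (Pt d) := fun q =>
    {z | q ∈ T.nearPairs ρh z (5 * h)} with hE
  -- The closure of `E q` is used to have a measurable set of the same diameter.
  have hle : ∀ x, ENNReal.ofReal (T.localJump ρh g (ψ x) (5 * h)) ≤ ∑ q ∈ T.adjacentPairs ρh,
      (ψ ⁻¹' closure (E q)).indicator (fun _ => ENNReal.ofReal (‖g q.1 - g q.2‖ ^ 2)) x := by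
    intro x
    rw [Mesh.localJump, ENNReal.ofReal_sum_of_nonneg fun _ _ => by positivity]
    calc _ ≤ ∑ q ∈ T.nearPairs ρh (ψ x) (5 * h), (ψ ⁻¹' closure (E q)).indicator
          (fun _ => ENNReal.ofReal (‖g q.1 - g q.2‖ ^ 2)) x := by
          refine Finset.sum_le_sum fun q hq => ?_
          rw [indicator_of_mem (show x ∈ ψ ⁻¹' closure (E q) from subset_closure hq)]
      _ ≤ _ := Finset.sum_le_sum_of_subset fun q hq => (Mesh.mem_nearPairs.1 hq).1
  have hm : ∀ q, MeasurableSet (ψ ⁻¹' closure (E q)) := fun q =>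
    hψ isClosed_closure.measurableSet
  calc _ ≤ ∫⁻ x in U, ∑ q ∈ T.adjacentPairs ρh,
      (ψ ⁻¹' closure (E q)).indicator (fun _ => ENNReal.ofReal (‖g q.1 - g q.2‖ ^ 2)) x :=
        lintegral_mono hle
    _ = ∑ q ∈ T.adjacentPairs ρh, ENNReal.ofReal (‖g q.1 - g q.2‖ ^ 2) *
        volume (ψ ⁻¹' closure (E q) ∩ U) := by
        rw [lintegral_finsetSum _ fun q _ => measurable_const.indicator (hm q)]
        refine Finset.sum_congr rfl fun q _ => ?_
        rw [lintegral_indicator_const (hm q), Measure.restrict_apply (hm q)]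
    _ ≤ ∑ q ∈ T.adjacentPairs ρh, ENNReal.ofReal (‖g q.1 - g q.2‖ ^ 2) *
        ENNReal.ofReal (volConst d ε * (11 * h) ^ (d - 1)) := by
        refine Finset.sum_le_sum fun q _ => ?_
        gcongr
        refine (measure_mono ?_).trans (H.volume_lift_mem_le (s := 11 * h) (by positivity)
          (by linarith [H.h_le]) (E := closure (E q)) ?_)
        · rintro x ⟨hx, hxU⟩
          refine ⟨R.subset_reach hxU, ?_⟩
          rw [← hψU x hxU]
          exact hx
        · have hdist : ∀ a ∈ E q, ∀ c ∈ E q, ‖a - c‖ ≤ 11 * h := by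
            intro a ha c hc
            obtain ⟨hq1, y, hy, hya⟩ := Mesh.mem_nearCells.1 (Mesh.mem_nearPairs.1 ha).2.1
            obtain ⟨-, y', hy', hyc⟩ := Mesh.mem_nearCells.1 (Mesh.mem_nearPairs.1 hc).2.1
            have e1 := mem_closedBall_iff_norm.1 hya
            have e2 := mem_closedBall_iff_norm.1 hyc
            have e3 := H.mesh.norm_sub_le (Mesh.cutCells_subset hq1) hy hy'
            have e4 := norm_sub_le_norm_sub_add_norm_sub a y c
            have e5 := norm_sub_le_norm_sub_add_norm_sub y y' c
            rw [norm_sub_rev a y] at e4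
            linarith
          have hcl : Metric.ediam (closure (E q)) ≤ ENNReal.ofReal (11 * h) := by
            rw [Metric.ediam_closure]
            refine Metric.ediam_le fun a ha c hc => ?_
            rw [edist_dist, dist_eq_norm]
            exact ENNReal.ofReal_le_ofReal (hdist a ha c hc)
          intro a ha c hc
          have := (Metric.edist_le_ediam_of_mem ha hc).trans hcl
          rwa [edist_dist, ENNReal.ofReal_le_ofReal_iff (by positivity), dist_eq_norm] at this
    _ = _ := by
        rw [← Finset.sum_mul, ← ENNReal.ofReal_sum_of_nonneg fun _ _ => by positivity,
          ← ENNReal.ofReal_mul (Finset.sum_nonneg fun _ _ => by positivity), mul_comm]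

end Setup

/-! ### The energy of a discrete function -/

/-- The square of the energy norm. -/
def energySq (T : Mesh d) (τ₀ : ℝ) (ρh : Pt d → ℝ) (nh : Pt d → Pt d) (v : Pt d → ℝ) : ℝ :=
  (∫ x in T.surface ρh, ‖T.tangentGrad nh v x‖ ^ 2 ∂μHE[d - 1]) + T.stabilization τ₀ ρh v

/-- A function `v` of the discrete space over a region, together with its gradients `g` and constant
parts `b` on the elements, and measurable versions `ψ` and `N` of the lift and of the discrete
normal. -/
structure Config (S : Set (Pt d)) (ν : Pt d → Pt d) (L ε δ₀ σ c₀ τ₀ : ℝ) (U : Set (Pt d)) (ρ η : ℝ)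
    (h : ℝ) (T : Mesh d) (ρh : Pt d → ℝ) (nh : Pt d → Pt d) (v : Pt d → ℝ)
    (g : Finset (Pt d) → Pt d) (b : Finset (Pt d) → ℝ) (ψ N : Pt d → Pt d) : Prop where
  setup : Setup S ν L ε δ₀ σ c₀ h T ρh nh
  τ₀_pos : 0 < τ₀
  le_ρ : h ≤ ρ
  le_η : h ≤ η
  le_one : h ≤ 1
  mem_V : v ∈ T.V ρh
  affine : T.IsPiecewiseAffine ρh v g b
  measurable_ψ : Measurable ψ
  ψ_eq : ∀ x ∈ U, ψ x = lift S T ρh x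
  measurable_N : Measurable N
  ae_normal : ∀ᵐ z ∂(μHE[d - 1] : Measure (Pt d)).restrict (T.surface ρh),
    nh z = N z ∧ ‖N z‖ = 1 ∧ ‖unitNormal S (nearestPoint S z) - N z‖ ≤ c₀ * h

theorem Mesh.surface_subset_cutDomain {T : Mesh d} {ρh : Pt d → ℝ} :
    T.surface ρh ⊆ T.cutDomain ρh := fun _ hz =>
  mem_iUnion₂.2 ⟨_, cellAt_mem_cutCells hz, (cellAt_spec hz.1).2⟩

/-! ### Bounds by the energy -/

section
open scoped ENNReal
variable {S : Set (Pt d)} {ν : Pt d → Pt d} {L ε δ₀ σ c₀ τ₀ : ℝ}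
    {U : Set (Pt d)} {ρ η : ℝ} {K : ℝ≥0∞}

namespace Config
variable {h : ℝ} {T : Mesh d} {ρh : Pt d → ℝ} {nh : Pt d → Pt d} {v : Pt d → ℝ}
    {g : Finset (Pt d) → Pt d} {b : Finset (Pt d) → ℝ} {ψ N : Pt d → Pt d}
    (c : Config S ν L ε δ₀ σ c₀ τ₀ U ρ η h T ρh nh v g b ψ N) (R : Region S L ε U ρ η K)
include c

theorem continuousOn : ContinuousOn v (T.cutDomain ρh) := by
  obtain ⟨⟨w, ⟨hw, -⟩, hvw⟩, -⟩ := c.mem_V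
  refine (hw.mono ?_).congr hvw
  intro x hx
  obtain ⟨s, hs, hxs⟩ := mem_iUnion₂.1 hx
  exact mem_iUnion₂.2 ⟨s, Mesh.cutCells_subset hs, hxs⟩

theorem tangentGrad_eq : ∀ᵐ z ∂(μHE[d - 1] : Measure (Pt d)).restrict (T.surface ρh),
    T.tangentGrad nh v z = tang (N z) (g (T.cellAt z)) ∧ ‖N z‖ = 1 := by
  filter_upwards [c.ae_normal, ae_restrict_mem c.setup.isCompact_surface.measurableSet] with z hz hzS
  refine ⟨?_, hz.2.1⟩
  have hg : T.grad v z = g (T.cellAt z) :=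
    Mesh.gradientWithin_hull (Mesh.cellAt_spec hzS.1).1
      (c.affine _ (Mesh.cellAt_mem_cutCells hzS)) (Mesh.cellAt_spec hzS.1).2
  rw [Mesh.tangentGrad, hg, hz.1, tang]

/-- The first part of the energy as a Lebesgue integral. The integrand is bounded and measurable, and
the discrete surface has finite area, so that the Bochner integral has no junk value. -/
theorem lintegral_surface_tang_sq_eq :
    ∫⁻ z in T.surface ρh, ENNReal.ofReal (‖tang (N z) (g (T.cellAt z))‖ ^ 2) ∂μHE[d - 1] =
      ENNReal.ofReal (∫ x in T.surface ρh, ‖T.tangentGrad nh v x‖ ^ 2 ∂μHE[d - 1]) := by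
  have hae := c.tangentGrad_eq
  have hG : Measurable fun z => g (T.cellAt z) := Mesh.measurable_comp_cellAt g
  have hm : Measurable fun z => ‖tang (N z) (g (T.cellAt z))‖ ^ 2 := by
    have h1 : Measurable fun z => ⟪N z, g (T.cellAt z)⟫ := c.measurable_N.inner hG
    exact (hG.sub (h1.smul c.measurable_N)).norm.pow_const 2
  have hint : IntegrableOn (fun z => ‖tang (N z) (g (T.cellAt z))‖ ^ 2) (T.surface ρh)
      (μHE[d - 1] : Measure (Pt d)) := by
    refine Measure.integrableOn_of_bounded (M := ∑ s ∈ T.cells, ‖g s‖ ^ 2)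
      c.setup.measure_surface_lt_top.ne hm.aestronglyMeasurable ?_
    filter_upwards [hae, ae_restrict_mem c.setup.isCompact_surface.measurableSet] with z hz hzS
    rw [Real.norm_of_nonneg (by positivity), norm_tang_sq hz.2]
    have := Finset.single_le_sum (f := fun s => ‖g s‖ ^ 2) (fun s _ => by positivity)
      (Mesh.cellAt_spec hzS.1).1
    linarith [sq_nonneg ⟪N z, g (T.cellAt z)⟫]
  rw [← ofReal_integral_eq_lintegral_ofReal hint (Filter.Eventually.of_forall fun _ => by positivity)]
  congr 1
  refine integral_congr_ae ?_
  filter_upwards [hae] with z hz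
  rw [hz.1]

theorem stabilization_nonneg : 0 ≤ T.stabilization τ₀ ρh v := Mesh.stabilization_nonneg c.τ₀_pos _

theorem energySq_nonneg : 0 ≤ energySq T τ₀ ρh nh v :=
  add_nonneg (integral_nonneg fun _ => by positivity) c.stabilization_nonneg

include R in
/-- The tangential gradients at the lifted points, integrated over `U`, are bounded by the energy. -/
theorem lintegral_tang_sq_le :
    ∫⁻ x in U, ENNReal.ofReal (‖tang (N (ψ x)) (g (T.cellAt (ψ x)))‖ ^ 2) ≤
      Setup.areaConst d ε * ENNReal.ofReal (energySq T τ₀ ρh nh v) := by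
  have hm := measurable_norm_tang_sq c.measurable_N (Mesh.measurable_comp_cellAt (T := T) g)
  have h1 := c.setup.lintegral_lift_le R.isOpen.measurableSet R.subset_reach hm.aemeasurable
  rw [c.lintegral_surface_tang_sq_eq] at h1
  have h2 : ∫⁻ x in U, ENNReal.ofReal (‖tang (N (ψ x)) (g (T.cellAt (ψ x)))‖ ^ 2) =
      ∫⁻ x in U, ENNReal.ofReal (‖tang (N (lift S T ρh x)) (g (T.cellAt (lift S T ρh x)))‖ ^ 2) :=
    setLIntegral_congr_fun R.isOpen.measurableSet fun x hx => by
      simp only [c.ψ_eq x hx]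
  rw [h2]
  refine h1.trans ?_
  gcongr
  exact le_add_of_nonneg_right c.stabilization_nonneg

include R in
/-- The jumps near the lifted points, integrated over `U`, are bounded by the energy. The volume over a
piece of diameter `h` and the area of a facet are both of order `h ^ (d - 1)`. -/
theorem lintegral_localJump_le :
    ∫⁻ x in U, ENNReal.ofReal (T.localJump ρh g (ψ x) (5 * h)) ≤
      ENNReal.ofReal (Setup.volConst d ε * 11 ^ (d - 1) * (σ ^ 2) ^ (d - 1) * 2 /
        (τ₀ * volume.real (Metric.ball (0 : Pt (d - 1)) 1))) *
      ENNReal.ofReal (energySq T τ₀ ρh nh v) := by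
  have H := c.setup
  have hτ := c.τ₀_pos
  have hω := volume_real_unitBall_pos (d := d - 1)
  have hV := Setup.volConst_pos d H.reach_pos
  have h1 := H.lintegral_localJump_le R c.measurable_ψ c.ψ_eq (g := g)
  refine h1.trans ?_
  have hσ : σ ≠ 0 := by
    obtain ⟨y, hy⟩ := H.nonempty
    obtain ⟨z, hz, -⟩ := H.approx.bijOn.surjOn hy
    exact (H.mesh.pos H.h_pos (Mesh.cellAt_spec hz.1).1).ne'
  rw [← ENNReal.ofReal_mul (by positivity)]
  apply ENNReal.ofReal_le_ofReal
  have h2 := Mesh.sum_jump_le_stabilization H.one_le H.mesh H.h_pos hτ c.affine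
  set J := ∑ q ∈ T.adjacentPairs ρh, ‖g q.1 - g q.2‖ ^ 2
  set θ := volume.real (Metric.ball (0 : Pt (d - 1)) 1)
  have h3 : T.stabilization τ₀ ρh v ≤ energySq T τ₀ ρh nh v :=
    le_add_of_nonneg_left (integral_nonneg fun _ => by positivity)
  have hσ2 : 0 < σ ^ 2 := by positivity
  calc Setup.volConst d ε * (11 * h) ^ (d - 1) * J =
      Setup.volConst d ε * 11 ^ (d - 1) * (σ ^ 2) ^ (d - 1) / (τ₀ * θ) *
        (τ₀ * ((h / σ ^ 2) ^ (d - 1) * θ) * J) := by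
        rw [mul_pow, div_pow]
        field_simp
    _ ≤ Setup.volConst d ε * 11 ^ (d - 1) * (σ ^ 2) ^ (d - 1) / (τ₀ * θ) *
        (2 * energySq T τ₀ ρh nh v) := by
        exact mul_le_mul_of_nonneg_left (by linarith) (by positivity)
    _ = _ := by ring

end Config

theorem lintegral_ofReal_add_three {α : Type*} [MeasurableSpace α] {μ : Measure α} {f₁ f₂ f₃ : α → ℝ}
    {k₁ k₂ k₃ : ℝ} (h₁ : Measurable f₁) (h₂ : Measurable f₂) (n₁ : ∀ x, 0 ≤ f₁ x)
    (n₂ : ∀ x, 0 ≤ f₂ x) (n₃ : ∀ x, 0 ≤ f₃ x) (hk₁ : 0 ≤ k₁) (hk₂ : 0 ≤ k₂) (hk₃ : 0 ≤ k₃) :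
    ∫⁻ x, ENNReal.ofReal (k₁ * f₁ x + k₂ * f₂ x + k₃ * f₃ x) ∂μ =
      ENNReal.ofReal k₁ * (∫⁻ x, ENNReal.ofReal (f₁ x) ∂μ) +
      ENNReal.ofReal k₂ * (∫⁻ x, ENNReal.ofReal (f₂ x) ∂μ) +
      ENNReal.ofReal k₃ * ∫⁻ x, ENNReal.ofReal (f₃ x) ∂μ := by
  have e : ∀ x, ENNReal.ofReal (k₁ * f₁ x + k₂ * f₂ x + k₃ * f₃ x) =
      ENNReal.ofReal k₁ * ENNReal.ofReal (f₁ x) + ENNReal.ofReal k₂ * ENNReal.ofReal (f₂ x) +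
        ENNReal.ofReal k₃ * ENNReal.ofReal (f₃ x) := by
    intro x
    have := mul_nonneg hk₁ (n₁ x)
    have := mul_nonneg hk₂ (n₂ x)
    have := mul_nonneg hk₃ (n₃ x)
    rw [ENNReal.ofReal_add (by positivity) (by positivity),
      ENNReal.ofReal_add (by positivity) (by positivity), ENNReal.ofReal_mul hk₁,
      ENNReal.ofReal_mul hk₂, ENNReal.ofReal_mul hk₃]
  have m₁ : Measurable fun x => ENNReal.ofReal k₁ * ENNReal.ofReal (f₁ x) :=
    (ENNReal.measurable_ofReal.comp h₁).const_mul _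
  have m₂ : Measurable fun x => ENNReal.ofReal k₂ * ENNReal.ofReal (f₂ x) :=
    (ENNReal.measurable_ofReal.comp h₂).const_mul _
  have m₁₂ : Measurable fun x => ENNReal.ofReal k₁ * ENNReal.ofReal (f₁ x) +
      ENNReal.ofReal k₂ * ENNReal.ofReal (f₂ x) := m₁.add m₂
  simp_rw [e]
  rw [lintegral_add_left m₁₂, lintegral_add_left m₁,
    lintegral_const_mul' _ _ ENNReal.ofReal_ne_top, lintegral_const_mul' _ _ ENNReal.ofReal_ne_top,
    lintegral_const_mul' _ _ ENNReal.ofReal_ne_top]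

namespace Config
variable {h : ℝ} {T : Mesh d} {ρh : Pt d → ℝ} {nh : Pt d → Pt d} {v : Pt d → ℝ}
    {g : Finset (Pt d) → Pt d} {b : Finset (Pt d) → ℝ} {ψ N : Pt d → Pt d}
    (c : Config S ν L ε δ₀ σ c₀ τ₀ U ρ η h T ρh nh v g b ψ N) (R : Region S L ε U ρ η K)
include c R

omit R in
theorem measurable_grad : Measurable fun x => g (T.cellAt (ψ x)) :=
  (Mesh.measurable_comp_cellAt g).comp c.measurable_ψ

omit R in
theorem measurable_value : Measurable fun x => affineValue T g b (ψ x) :=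
  (measurable_affineValue T g b).comp c.measurable_ψ

theorem lintegral_jump_le :
    ∫⁻ x in U, ENNReal.ofReal (chainConst d σ * T.localJump ρh g (ψ x) (5 * h)) ≤
      ENNReal.ofReal (chainConst d σ) *
        ENNReal.ofReal (Setup.volConst d ε * 11 ^ (d - 1) * (σ ^ 2) ^ (d - 1) * 2 /
          (τ₀ * volume.real (Metric.ball (0 : Pt (d - 1)) 1))) *
      ENNReal.ofReal (energySq T τ₀ ρh nh v) := by
  simp_rw [ENNReal.ofReal_mul (chainConst_nonneg d σ)]
  rw [lintegral_const_mul' _ _ ENNReal.ofReal_ne_top, mul_assoc]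
  gcongr
  exact c.lintegral_localJump_le R

omit R in
/-- The integrand in the comparison of values, separated into its parts. -/
theorem lintegral_comparison_le (m : ℝ) :
    ∫⁻ y in U, ENNReal.ofReal (3 * (affineValue T g b (ψ y) - m) ^ 2 +
        27 * (h ^ 2 * ‖g (T.cellAt (ψ y))‖ ^ 2) +
        363 * (h ^ 2 * (chainConst d σ * T.localJump ρh g (ψ y) (5 * h)))) ≤
      3 * (∫⁻ y in U, ENNReal.ofReal ((affineValue T g b (ψ y) - m) ^ 2)) +
      27 * (∫⁻ y in U, ENNReal.ofReal (‖h • g (T.cellAt (ψ y))‖ ^ 2)) +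
      363 * ∫⁻ y in U, ENNReal.ofReal (chainConst d σ * T.localJump ρh g (ψ y) (5 * h)) := by
  have hh := c.setup.h_pos
  have h3 := lintegral_ofReal_add_three (μ := volume.restrict U) (k₁ := 3) (k₂ := 27) (k₃ := 363)
    (f₁ := fun y => (affineValue T g b (ψ y) - m) ^ 2)
    (f₂ := fun y => ‖h • g (T.cellAt (ψ y))‖ ^ 2)
    (f₃ := fun y => chainConst d σ * T.localJump ρh g (ψ y) (5 * h))
    ((c.measurable_value.sub_const m).pow_const 2) ((c.measurable_grad.const_smul h).norm.pow_const 2)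
    (fun _ => by positivity) (fun _ => by positivity)
    (fun y => mul_nonneg (chainConst_nonneg d σ) (Mesh.localJump_nonneg g _ _))
    (by norm_num) (by norm_num) (by norm_num)
  simp only [ENNReal.ofReal_ofNat] at h3
  rw [← h3]
  refine lintegral_mono fun y => ENNReal.ofReal_le_ofReal ?_
  rw [norm_smul, Real.norm_of_nonneg hh.le, mul_pow]
  have hJ := mul_nonneg (chainConst_nonneg d σ) (T.localJump_nonneg (ρh := ρh) g (ψ y) (5 * h))
  -- The jumps enter with a spare factor `h ^ 2`, dropped since `h ≤ 1`.
  have := mul_le_of_le_one_left hJ (pow_le_one₀ hh.le c.le_one (n := 2))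
  linarith

/-- The oscillation of the values, separated into its parts. -/
theorem lintegral_value_sub_sq_le :
    ∫⁻ x in U, ∫⁻ y in U, ENNReal.ofReal (‖affineValue T g b (ψ x) - affineValue T g b (ψ y)‖ ^ 2) ≤
      K * volume (Metric.ball (0 : Pt d) 1) *
      (27 * (∫⁻ x in U, ENNReal.ofReal (‖tang (N (ψ x)) (g (T.cellAt (ψ x)))‖ ^ 2)) +
      ENNReal.ofReal (3 * (8 * c₀ + 4 * L) ^ 2) *
        (∫⁻ x in U, ENNReal.ofReal (‖h • g (T.cellAt (ψ x))‖ ^ 2)) +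
      363 * ∫⁻ x in U, ENNReal.ofReal (chainConst d σ * T.localJump ρh g (ψ x) (5 * h))) := by
  have hh := c.setup.h_pos
  refine (c.setup.lintegral_value_sub_sq_le R c.measurable_ψ c.ψ_eq c.le_ρ c.affine c.ae_normal).trans ?_
  gcongr
  have m1 : Measurable fun x => ‖tang (N (ψ x)) (g (T.cellAt (ψ x)))‖ ^ 2 := by
    have e1 : Measurable fun x => N (ψ x) := c.measurable_N.comp c.measurable_ψ
    have e2 : Measurable fun x => ⟪N (ψ x), g (T.cellAt (ψ x))⟫ := e1.inner c.measurable_grad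
    exact (c.measurable_grad.sub (e2.smul e1)).norm.pow_const 2
  have h3 := lintegral_ofReal_add_three (μ := volume.restrict U) (k₁ := 27)
    (k₂ := 3 * (8 * c₀ + 4 * L) ^ 2) (k₃ := 363)
    (f₁ := fun x => ‖tang (N (ψ x)) (g (T.cellAt (ψ x)))‖ ^ 2)
    (f₂ := fun y => ‖h • g (T.cellAt (ψ y))‖ ^ 2)
    (f₃ := fun y => chainConst d σ * T.localJump ρh g (ψ y) (5 * h))
    m1 ((c.measurable_grad.const_smul h).norm.pow_const 2)
    (fun _ => by positivity) (fun _ => by positivity)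
    (fun y => mul_nonneg (chainConst_nonneg d σ) (Mesh.localJump_nonneg g _ _))
    (by norm_num) (by positivity) (by norm_num)
  simp only [ENNReal.ofReal_ofNat, norm_smul, Real.norm_of_nonneg hh.le, mul_pow] at h3 ⊢
  exact h3.le

end Config

/-- Over the neighborhood `U`, the energy controls the gradients, the jumps, and the distance of
the values from a constant. -/
theorem exists_lintegral_le_energySq (R : Region S L ε U ρ η K) : ∃ C : ℝ≥0∞, C ≠ ⊤ ∧
    ∀ h T ρh nh v g b ψ N, Config S ν L ε δ₀ σ c₀ τ₀ U ρ η h T ρh nh v g b ψ N →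
      27 * (∫⁻ y in U, ENNReal.ofReal (‖h • g (T.cellAt (ψ y))‖ ^ 2)) +
        363 * (∫⁻ y in U, ENNReal.ofReal (chainConst d σ * T.localJump ρh g (ψ y) (5 * h))) ≤
          C * ENNReal.ofReal (energySq T τ₀ ρh nh v) ∧
      ∃ m, ∫⁻ y in U, ENNReal.ofReal ((affineValue T g b (ψ y) - m) ^ 2) ≤
          C * ENNReal.ofReal (energySq T τ₀ ρh nh v) := by
  set β := volume (Metric.ball (0 : Pt d) η) with hβ
  have hβ0 : β ≠ 0 := (Metric.measure_ball_pos volume _ R.η_pos).ne'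
  have hβt : β ≠ ⊤ := measure_ball_lt_top.ne
  set A := Setup.areaConst d ε with hA
  have hAt : A ≠ ⊤ := Setup.areaConst_ne_top d ε
  set kP := K * volume (Metric.ball (0 : Pt d) 1) with hkP
  have hkPt : kP ≠ ⊤ := ENNReal.mul_ne_top R.K_ne_top measure_ball_lt_top.ne
  set cJ := ENNReal.ofReal (chainConst d σ) *
        ENNReal.ofReal (Setup.volConst d ε * 11 ^ (d - 1) * (σ ^ 2) ^ (d - 1) * 2 /
          (τ₀ * volume.real (Metric.ball (0 : Pt (d - 1)) 1))) with hcJ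
  have hcJt : cJ ≠ ⊤ := ENNReal.mul_ne_top ENNReal.ofReal_ne_top ENNReal.ofReal_ne_top
  set c₁ := 8 * (kP * cJ + volume U * A) / β with hc₁
  have hc₁t : c₁ ≠ ⊤ := ENNReal.div_ne_top (ENNReal.mul_ne_top (by norm_num) (ENNReal.add_ne_top.2
    ⟨ENNReal.mul_ne_top hkPt hcJt, ENNReal.mul_ne_top R.volume_ne_top hAt⟩)) hβ0
  set cL := ENNReal.ofReal (3 * (8 * c₀ + 4 * L) ^ 2) with hcL
  set c₂ := kP * (27 * A + cL * c₁ + 363 * cJ) / volume U with hc₂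
  have hc₂t : c₂ ≠ ⊤ := by
    refine ENNReal.div_ne_top (ENNReal.mul_ne_top hkPt (ENNReal.add_ne_top.2 ⟨ENNReal.add_ne_top.2
      ⟨ENNReal.mul_ne_top (by norm_num) hAt, ENNReal.mul_ne_top ENNReal.ofReal_ne_top hc₁t⟩,
      ENNReal.mul_ne_top (by norm_num) hcJt⟩)) R.volume_ne_zero
  refine ⟨c₂ + (27 * c₁ + 363 * cJ), ENNReal.add_ne_top.2 ⟨hc₂t, ENNReal.add_ne_top.2
    ⟨ENNReal.mul_ne_top (by norm_num) hc₁t, ENNReal.mul_ne_top (by norm_num) hcJt⟩⟩,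
    fun h T ρh nh v g b ψ N c => ?_⟩
  set Q := ENNReal.ofReal (energySq T τ₀ ρh nh v) with hQ
  have hb := c.lintegral_tang_sq_le R
  have hj := c.lintegral_jump_le R
  rw [← hcJ] at hj
  have hDF := c.setup.lintegral_grad_sub_sq_le R c.measurable_ψ c.ψ_eq c.le_ρ c.affine
  have hF := c.setup.lintegral_grad_sq_le R c.measurable_ψ c.ψ_eq c.measurable_N c.ae_normal
    c.le_one (g := g)
  have hu := c.lintegral_value_sub_sq_le R
  have ha : ∫⁻ y in U, ENNReal.ofReal (‖h • g (T.cellAt (ψ y))‖ ^ 2) ≤ c₁ * Q := by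
    rw [hc₁, ENNReal.mul_comm_div, ← mul_div_assoc, ENNReal.le_div_iff_mul_le (Or.inl hβ0) (Or.inl hβt)]
    refine hF.trans ?_
    calc _ ≤ 8 * (kP * (cJ * Q) + volume U * (A * Q)) := by
          gcongr
          exact hDF.trans (by gcongr)
      _ = _ := by ring
  refine ⟨?_, ?_⟩
  · calc _ ≤ 27 * (c₁ * Q) + 363 * (cJ * Q) := by gcongr
      _ = (27 * c₁ + 363 * cJ) * Q := by ring
      _ ≤ _ := mul_le_mul' le_add_self le_rfl
  · have hum : Measurable fun y => ∫⁻ x in U,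
        ENNReal.ofReal (‖affineValue T g b (ψ y) - affineValue T g b (ψ x)‖ ^ 2) :=
      (isSqKernel_norm_sub_sq c.measurable_value).measurable.lintegral_prod_right'
    -- The constant is the value at a point whose mean square difference from the others is at most
    -- average.
    obtain ⟨y₀, -, -, hy₀⟩ := exists_mul_measure_le_lintegral R.isOpen.measurableSet
      R.volume_ne_zero (P := fun _ => True) (Filter.Eventually.of_forall fun _ => trivial) hum
      R.volume_ne_top
    refine ⟨affineValue T g b (ψ y₀), ?_⟩
    have h1 : ∫⁻ y in U, ENNReal.ofReal ((affineValue T g b (ψ y) - affineValue T g b (ψ y₀)) ^ 2) ≤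
        c₂ * Q := by
      rw [hc₂, ENNReal.mul_comm_div, ← mul_div_assoc,
        ENNReal.le_div_iff_mul_le (Or.inl R.volume_ne_zero) (Or.inl R.volume_ne_top)]
      have e1 : ∀ y, (affineValue T g b (ψ y) - affineValue T g b (ψ y₀)) ^ 2 =
          ‖affineValue T g b (ψ y₀) - affineValue T g b (ψ y)‖ ^ 2 := fun y => by
        rw [Real.norm_eq_abs, sq_abs]; ring
      simp_rw [e1]
      refine hy₀.trans (hu.trans ?_)
      calc _ ≤ kP * (27 * (A * Q) + cL * (c₁ * Q) + 363 * (cJ * Q)) := by gcongr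
        _ = _ := by ring
    exact h1.trans (mul_le_mul' le_self_add le_rfl)

/-! ### Comparison with the discrete surface and the cut domain -/

theorem lintegral_sq_le_sub (u : Pt d → ℝ) (m : ℝ) (U : Set (Pt d)) :
    ∫⁻ y in U, ENNReal.ofReal (u y ^ 2) ≤
      2 * (∫⁻ y in U, ENNReal.ofReal ((u y - m) ^ 2)) + 2 * (ENNReal.ofReal (m ^ 2) * volume U) := by
  rw [← setLIntegral_const, ← mul_add, ← lintegral_add_right _ measurable_const,
    ← lintegral_const_mul' _ _ (by norm_num)]
  refine lintegral_mono fun y => ?_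
  rw [← ENNReal.ofReal_add (by positivity) (by positivity),
    show (2 : ℝ≥0∞) = ENNReal.ofReal 2 by norm_num, ← ENNReal.ofReal_mul (by norm_num)]
  apply ENNReal.ofReal_le_ofReal
  nlinarith [sq_nonneg (u y - 2 * m)]

namespace Config
variable {h : ℝ} {T : Mesh d} {ρh : Pt d → ℝ} {nh : Pt d → Pt d} {v : Pt d → ℝ}
    {g : Finset (Pt d) → Pt d} {b : Finset (Pt d) → ℝ} {ψ N : Pt d → Pt d}
    (c : Config S ν L ε δ₀ σ c₀ τ₀ U ρ η h T ρh nh v g b ψ N) (R : Region S L ε U ρ η K)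
include c

/-- A function of mean zero on the discrete surface is no closer to `m` than zero is. -/
theorem sq_mul_measure_surface_le (m : ℝ) :
    ENNReal.ofReal (m ^ 2) * (μHE[d - 1] : Measure (Pt d)) (T.surface ρh) ≤
      ∫⁻ x in T.surface ρh, ENNReal.ofReal ((v x - m) ^ 2) ∂μHE[d - 1] := by
  have hfin := c.setup.measure_surface_lt_top
  have hK := c.setup.isCompact_surface
  have hv : ContinuousOn v (T.surface ρh) := c.continuousOn.mono Mesh.surface_subset_cutDomain
  have hfl : IsFiniteMeasure ((μHE[d - 1] : Measure (Pt d)).restrict (T.surface ρh)) :=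
    ⟨by rw [Measure.restrict_apply_univ]; exact hfin⟩
  have hI : ∀ f : Pt d → ℝ, ContinuousOn f (T.surface ρh) →
      Integrable f ((μHE[d - 1] : Measure (Pt d)).restrict (T.surface ρh)) := by
    intro f hf
    obtain ⟨M, hM⟩ := hK.exists_bound_of_continuousOn hf
    exact Integrable.of_bound (hf.aestronglyMeasurable hK.measurableSet) M
      ((ae_restrict_mem hK.measurableSet).mono hM)
  have h1 := hI v hv
  have h2 := hI (fun x => v x ^ 2) (hv.pow 2)
  have h3 := hI (fun x => (v x - m) ^ 2) ((hv.sub continuousOn_const).pow 2)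
  rw [← ofReal_integral_eq_lintegral_ofReal h3 (Filter.Eventually.of_forall fun _ => by positivity)]
  have h4 : ∫ x in T.surface ρh, (v x - m) ^ 2 ∂μHE[d - 1] =
      (∫ x in T.surface ρh, v x ^ 2 ∂μHE[d - 1]) +
        m ^ 2 * (μHE[d - 1] : Measure (Pt d)).real (T.surface ρh) := by
    have e : ∀ x, (v x - m) ^ 2 = v x ^ 2 - (2 * m) * v x + m ^ 2 := fun x => by ring
    have h5 : Integrable (fun x => v x ^ 2 - 2 * m * v x)
        ((μHE[d - 1] : Measure (Pt d)).restrict (T.surface ρh)) := h2.sub (h1.const_mul _)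
    simp_rw [e]
    rw [integral_add h5 (integrable_const _),
      integral_sub h2 (h1.const_mul _), integral_const_mul, c.mem_V.2, setIntegral_const]
    simp [mul_comm]
  rw [h4, ← ENNReal.ofReal_toReal hfin.ne, ← ENNReal.ofReal_mul (sq_nonneg m)]
  apply ENNReal.ofReal_le_ofReal
  exact le_add_of_nonneg_left (integral_nonneg fun _ => by positivity)

include R

/-- The area of the discrete surface is bounded below. -/
theorem volume_region_le :
    volume U ≤ Setup.areaConst d ε * (μHE[d - 1] : Measure (Pt d)) (T.surface ρh) := by
  have := c.setup.lintegral_lift_le R.isOpen.measurableSet R.subset_reach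
    (f := fun _ => 1) aemeasurable_const
  simpa using this

/-- The comparison over the neighborhood `U`, for the discrete surface. -/
theorem lintegral_surface_le (m : ℝ) :
    ENNReal.ofReal (fiberConst d η) *
      ∫⁻ x in T.surface ρh, ENNReal.ofReal ((v x - m) ^ 2) ∂μHE[d - 1] ≤
      ENNReal.ofReal (((5 + 1) * σ ^ 2) ^ d * volume.real (Metric.ball (0 : Pt (d - 1)) 1)) *
      (3 * (∫⁻ y in U, ENNReal.ofReal ((affineValue T g b (ψ y) - m) ^ 2)) +
      (27 * (∫⁻ y in U, ENNReal.ofReal (‖h • g (T.cellAt (ψ y))‖ ^ 2)) +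
      363 * ∫⁻ y in U, ENNReal.ofReal (chainConst d σ * T.localJump ρh g (ψ y) (5 * h)))) := by
  have hh := c.setup.h_pos
  have hfib := fiberConst_pos d R.η_pos
  have hfl : IsFiniteMeasure ((μHE[d - 1] : Measure (Pt d)).restrict (T.surface ρh)) :=
    ⟨by rw [Measure.restrict_apply_univ]; exact c.setup.measure_surface_lt_top⟩
  have h1 := c.setup.lintegral_value_sub_sq_le_of_measure R c.measurable_ψ c.ψ_eq c.affine c.le_η
    (μ := (μHE[d - 1] : Measure (Pt d)).restrict (T.surface ρh))
    ((ae_restrict_mem c.setup.isCompact_surface.measurableSet).mono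
      fun x hx => Mesh.surface_subset_cutDomain hx)
    (fun z => by
      rw [Measure.restrict_apply Metric.isClosed_closedBall.measurableSet, inter_comm]
      exact c.setup.measure_surface_inter_closedBall_le (by norm_num) z) m
  have h2 := h1.trans (mul_le_mul_right (c.lintegral_comparison_le m) _)
  have hp : ENNReal.ofReal (h ^ (d - 1)) ≠ 0 := by
    rw [Ne, ENNReal.ofReal_eq_zero, not_le]; positivity
  rw [ENNReal.ofReal_mul hfib.le, mul_left_comm (_ ^ d), ENNReal.ofReal_mul (by positivity : 0 ≤ h ^ (d - 1)),
    mul_comm (ENNReal.ofReal (fiberConst d η)), mul_assoc, mul_assoc,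
    ENNReal.mul_le_mul_iff_right hp ENNReal.ofReal_ne_top, add_assoc] at h2
  exact h2

/-- The comparison over the neighborhood `U`, for the cut domain. The volume of a ball brings one
more power of `h` than the area of a surface in it. -/
theorem lintegral_cutDomain_le :
    ENNReal.ofReal (fiberConst d η) * ∫⁻ x in T.cutDomain ρh, ENNReal.ofReal (v x ^ 2) ≤
      ENNReal.ofReal (5 ^ d * volume.real (Metric.ball (0 : Pt d) 1)) * ENNReal.ofReal h *
      (3 * (∫⁻ y in U, ENNReal.ofReal (affineValue T g b (ψ y) ^ 2)) +
      (27 * (∫⁻ y in U, ENNReal.ofReal (‖h • g (T.cellAt (ψ y))‖ ^ 2)) +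
      363 * ∫⁻ y in U, ENNReal.ofReal (chainConst d σ * T.localJump ρh g (ψ y) (5 * h)))) := by
  have hh := c.setup.h_pos
  have hfib := fiberConst_pos d R.η_pos
  have hm : MeasurableSet (T.cutDomain ρh) :=
    Finset.measurableSet_biUnion _ fun s _ => (Mesh.isCompact_hull s).measurableSet
  have h1 := c.setup.lintegral_value_sub_sq_le_of_measure R c.measurable_ψ c.ψ_eq c.affine c.le_η
    (μ := volume.restrict (T.cutDomain ρh)) (ae_restrict_mem hm)
    (Λ := ENNReal.ofReal ((5 * h) ^ d * volume.real (Metric.ball (0 : Pt d) 1)))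
    (fun z => by
      rw [← volume_closedBall_eq z (by positivity)]
      exact Measure.restrict_apply_le _ _) 0
  have h2 := h1.trans (mul_le_mul_right (c.lintegral_comparison_le 0) _)
  have hp : ENNReal.ofReal (h ^ (d - 1)) ≠ 0 := by
    rw [Ne, ENNReal.ofReal_eq_zero, not_le]; positivity
  have hpow : (5 * h) ^ d * volume.real (Metric.ball (0 : Pt d) 1) =
      h ^ (d - 1) * (5 ^ d * volume.real (Metric.ball (0 : Pt d) 1) * h) := by
    rw [mul_pow, ← mul_pow_sub_one (by have := c.setup.one_le; omega) h]
    ring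
  simp only [sub_zero] at h2 ⊢
  rw [hpow, ENNReal.ofReal_mul hfib.le, ENNReal.ofReal_mul (by positivity : 0 ≤ h ^ (d - 1)),
    mul_comm (ENNReal.ofReal (fiberConst d η)), mul_assoc, mul_assoc,
    ENNReal.mul_le_mul_iff_right hp ENNReal.ofReal_ne_top, add_assoc,
    ENNReal.ofReal_mul (q := h) (by positivity)] at h2
  exact h2

end Config

/-- The bound on the cut domain: the constant `m` approximating `v` is estimated on the discrete
surface, where `v` has mean zero, and is then absorbed in the comparison over the cut domain. -/
theorem exists_lintegral_cutDomain_le (R : Region S L ε U ρ η K) : ∃ C : ℝ≥0∞, C ≠ ⊤ ∧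
    ∀ h T ρh nh v g b ψ N, Config S ν L ε δ₀ σ c₀ τ₀ U ρ η h T ρh nh v g b ψ N →
      ∫⁻ x in T.cutDomain ρh, ENNReal.ofReal (v x ^ 2) ≤
        C * (ENNReal.ofReal h * ENNReal.ofReal (energySq T τ₀ ρh nh v)) := by
  obtain ⟨C₁, hC₁, hC⟩ := exists_lintegral_le_energySq (ν := ν) (δ₀ := δ₀) (σ := σ) (c₀ := c₀)
    (τ₀ := τ₀) R
  set φ := ENNReal.ofReal (fiberConst d η) with hφ
  have hφ0 : φ ≠ 0 := by
    rw [hφ, Ne, ENNReal.ofReal_eq_zero, not_le]; exact fiberConst_pos d R.η_pos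
  have hφt : φ ≠ ⊤ := ENNReal.ofReal_ne_top
  set A := Setup.areaConst d ε with hA
  have hAt : A ≠ ⊤ := Setup.areaConst_ne_top d ε
  set k₁ := ENNReal.ofReal (((5 + 1) * σ ^ 2) ^ d * volume.real (Metric.ball (0 : Pt (d - 1)) 1))
  have hk₁ : k₁ ≠ ⊤ := ENNReal.ofReal_ne_top
  set k₂ := ENNReal.ofReal (5 ^ d * volume.real (Metric.ball (0 : Pt d) 1))
  have hk₂ : k₂ ≠ ⊤ := ENNReal.ofReal_ne_top
  set C₂ := k₁ * (4 * C₁) / φ with hC₂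
  have hC₂t : C₂ ≠ ⊤ := ENNReal.div_ne_top (by finiteness) hφ0
  set C₃ := 3 * (2 * C₁ + 2 * (A * C₂)) + C₁ with hC₃
  refine ⟨k₂ * C₃ / φ, ENNReal.div_ne_top (by finiteness) hφ0, fun h T ρh nh v g b ψ N c => ?_⟩
  obtain ⟨hrest, m, hm⟩ := hC h T ρh nh v g b ψ N c
  set Q := ENNReal.ofReal (energySq T τ₀ ρh nh v) with hQ
  have h1 : ∫⁻ x in T.surface ρh, ENNReal.ofReal ((v x - m) ^ 2) ∂μHE[d - 1] ≤ C₂ * Q := by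
    rw [hC₂, ENNReal.mul_comm_div, ← mul_div_assoc, ENNReal.le_div_iff_mul_le (Or.inl hφ0) (Or.inl hφt),
      mul_comm]
    refine (c.lintegral_surface_le R m).trans ?_
    calc _ ≤ k₁ * (3 * (C₁ * Q) + C₁ * Q) := by gcongr
      _ = _ := by ring
  have h2 : ENNReal.ofReal (m ^ 2) * volume U ≤ A * (C₂ * Q) := by
    calc _ ≤ ENNReal.ofReal (m ^ 2) * (A * (μHE[d - 1] : Measure (Pt d)) (T.surface ρh)) := by
          gcongr
          exact c.volume_region_le R
      _ = A * (ENNReal.ofReal (m ^ 2) * (μHE[d - 1] : Measure (Pt d)) (T.surface ρh)) := by ring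
      _ ≤ _ := mul_le_mul' le_rfl ((c.sq_mul_measure_surface_le m).trans h1)
  rw [ENNReal.mul_comm_div, ← mul_div_assoc, ENNReal.le_div_iff_mul_le (Or.inl hφ0) (Or.inl hφt),
    mul_comm]
  refine (c.lintegral_cutDomain_le R).trans ?_
  calc _ ≤ k₂ * ENNReal.ofReal h * (3 * (2 * (C₁ * Q) + 2 * (A * (C₂ * Q))) + C₁ * Q) := by
        gcongr
        exact (lintegral_sq_le_sub _ m U).trans (by gcongr)
    _ = _ := by rw [hC₃]; ring

end
end CutFEM

end

/-! ### The inequality -/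

theorem mainTheorem2 (d : ℕ) (hd : d = 2 ∨ d = 3)
    (S : Set (CutFEM.Pt d)) (hS : CutFEM.IsClosedSurface S)
    (δ₀ : ℝ) (hδ₀ : 0 < δ₀)
    (hproj : ∀ x ∈ CutFEM.tube S δ₀, ∃! y, CutFEM.IsNearestPoint S x y)
    (σ c₀ τ₀ : ℝ) (hτ₀ : 0 < τ₀) :
    ∃ C > 0, ∃ h₀ > 0, ∀ h : ℝ, 0 < h → h ≤ h₀ →
      ∀ T : CutFEM.Mesh d, T.IsQuasiUniform σ h → CutFEM.tube S δ₀ ⊆ T.domain →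
      ∀ (ρh : CutFEM.Pt d → ℝ) (nh : CutFEM.Pt d → CutFEM.Pt d),
        T.IsApproximation S δ₀ c₀ h ρh nh →
      ∀ v ∈ T.V ρh,
        T.normCutDomain ρh v ≤ C * h ^ (1 / 2 : ℝ) * T.energyNorm τ₀ ρh nh v := by
  obtain ⟨ν, L, hν⟩ := hS.exists_normalField
  have hL := hν.pos
  -- A quarter of the radius of curvature: up to there the projection is Lipschitz continuous.
  set ε := 1 / (4 * L) with hε
  have hε0 : 0 < ε := by positivity
  have hLε : 4 * L * ε ≤ 1 := by rw [hε]; field_simp; rfl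
  obtain ⟨U, ρ, η, K, R⟩ := CutFEM.exists_region hS hL hε0
  obtain ⟨C, hC, hmain⟩ := CutFEM.exists_lintegral_cutDomain_le (ν := ν) (δ₀ := δ₀) (σ := σ)
    (c₀ := c₀) (τ₀ := τ₀) R
  have hρ := R.ρ_pos
  have hη := R.η_pos
  -- The summand `1` only makes the constant positive. The bounds on `h₀` are those required by
  -- `Region`, `Setup` and `Config`; `|c₀| + 1` stands in for `c₀`, the sign of which is not known.
  refine ⟨√C.toReal + 1, by positivity,
    min (min ρ η) (min 1 (min (ε / 22) (1 / (40 * (|c₀| + 1))))), by positivity, ?_⟩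
  intro h hh hh₀ T hT hdom ρh nh happ v hv
  obtain ⟨⟨hhρ, hhη⟩, hh1, hhε, hhc⟩ :
      (h ≤ ρ ∧ h ≤ η) ∧ h ≤ 1 ∧ h ≤ ε / 22 ∧ h ≤ 1 / (40 * (|c₀| + 1)) := by
    simpa only [le_min_iff] using hh₀
  have hc₀h : 40 * (c₀ * h) ≤ 1 := by
    rw [le_div_iff₀ (by positivity)] at hhc
    nlinarith [le_abs_self c₀]
  have H : CutFEM.Setup S ν L ε δ₀ σ c₀ h T ρh nh :=
    ⟨by omega, hS, hν, hε0, hLε, hh, hc₀h, by linarith, hT, hdom, happ⟩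
  obtain ⟨ψ, hψ, hψU⟩ := H.exists_measurable_lift R
  obtain ⟨N, hN, hNae⟩ := H.exists_measurable_normal
  obtain ⟨g, b, hgb⟩ := CutFEM.Mesh.exists_isPiecewiseAffine hv
  have c : CutFEM.Config S ν L ε δ₀ σ c₀ τ₀ U ρ η h T ρh nh v g b ψ N :=
    ⟨H, hτ₀, hhρ, hhη, hh1, hv, hgb, hψ, hψU, hN, hNae⟩
  have hle := hmain h T ρh nh v g b ψ N c
  have hE := c.energySq_nonneg
  have hint : ∫ x in T.cutDomain ρh, v x ^ 2 ≤
      C.toReal * (h * CutFEM.energySq T τ₀ ρh nh v) := by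
    have hm : MeasurableSet (T.cutDomain ρh) :=
      Finset.measurableSet_biUnion _ fun s _ => (CutFEM.Mesh.isCompact_hull s).measurableSet
    rw [integral_eq_lintegral_of_nonneg_ae (Filter.Eventually.of_forall fun _ => sq_nonneg _)
      ((c.continuousOn.pow 2).aestronglyMeasurable hm)]
    refine (ENNReal.toReal_mono (ENNReal.mul_ne_top hC
      (ENNReal.mul_ne_top ENNReal.ofReal_ne_top ENNReal.ofReal_ne_top)) hle).trans_eq ?_
    rw [ENNReal.toReal_mul, ENNReal.toReal_mul, ENNReal.toReal_ofReal hh.le, ENNReal.toReal_ofReal hE]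
  calc T.normCutDomain ρh v ≤ √(C.toReal * (h * CutFEM.energySq T τ₀ ρh nh v)) :=
        Real.sqrt_le_sqrt hint
    _ = √C.toReal * h ^ (1 / 2 : ℝ) * T.energyNorm τ₀ ρh nh v := by
        rw [Real.sqrt_mul ENNReal.toReal_nonneg, Real.sqrt_mul hh.le, ← Real.sqrt_eq_rpow, mul_assoc]
        rfl
    _ ≤ _ := by
        have h1 : 0 ≤ T.energyNorm τ₀ ρh nh v := Real.sqrt_nonneg _
        gcongr
        exact le_add_of_nonneg_right zero_le_one
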